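/- **Setting.** Let $H_\alpha$, $\alpha=1,\dots,k$, be smooth real functions on $T^*\mathbb{R}^n\ni(p,q)$ and let $f_{\alpha\beta}^\gamma$ be the structure constants, in a basis, of a real $k$-dimensional Lie algebra $\mathfrak g$. (In the BV-BFV application $\mathfrak g$ is unimodular, $\{H_\alpha,H_\beta\}=f_{\alpha\beta}^\gamma H_\gamma$, and the same relation holds for star commutators divided by $\mathrm i\hbar$; the statement below does not need these conditions.) Let $t_a<t_b$, let $q_a\in\mathbb{R}^n$, $p^b\in(\mathbb{R}^n)^*$, and let $T\in\mathfrak g$, with $\langle H,T\rangle=T^\alpha H_\alpha$. Let $c_a^\alpha,c_b^\alpha,T^+_\alpha$ be odd parameters, and put $\theta(t)=1$ for $t>0$, $\theta(t)=0$ for $t\le 0$, and $\phi(s)=\frac{s-t_a}{t_b-t_a}$. For the discontinuous splitting, with $q_a,c_a$ fixed at $t_a$ and $p^b,c_b$ fixed at $t_b$ (Case I), with residual fields $T,T^+$ given by $e=\frac{T\,dt}{t_b-t_a}+\hat e$ and $e^+=T^++\hat e^+$, and on the gauge-fixing lagrangian $\hat p_+=\hat q^+=\hat e=\hat c^+=0$,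 the BV action is $$ \begin{aligned} S={}&T^+_\alpha(c_b^\alpha-c_a^\alpha)-p^b_i\hat q^i(t_b)+\hat e^+_\alpha(t_b)c_b^\alpha-\hat p_i(t_a)q_a^i-\hat e^+_\alpha(t_a)c^\alpha_a\\ &+\int_{t_a}^{t_b}\Big(\hat p_i\,d\hat q^i-\hat e^+_\alpha\,d\hat c^\alpha-\tfrac{T^\alpha dt}{t_b-t_a}H_\alpha(\hat p,\hat q)+f_{\alpha\beta}^\gamma\,(T^+_\gamma+\hat e^+_\gamma)\,\hat c^\alpha\,\tfrac{T^\beta dt}{t_b-t_a}\Big). \end{aligned} $$ The partition function $Z_{\mathrm I}(q_a,c_a,p^b,c_b;T,T^+)$ is the perturbative integral of $\mathrm e^{\frac{\mathrm i}{\hbar}S}$ over the hatted fields: one expands in the bulk vertices (each of degree one in $T$) and evaluates every term by Wick's theorem, with the propagators $$\langle\hat q^i(s)\hat p_j(t)\rangle=\mathrm i\hbar\,\delta^i_j\,\theta(s-t),\qquad \langle\hat c^\alpha(s)\hat e^+_\beta(t)\rangle=\mathrm i\hbar\,\delta^\alpha_\beta\,(\theta(s-t)-\phi(s)),$$ and with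 the contractions of the physical fields with the endpoint sources $q_a,p^b$ summed up. It is a formal power series in $T$ whose coefficients are formal Laurent series in $\hbar$ with values in the Grassmann algebra of the odd parameters, times an exponential $\mathrm e^{w/\hbar}$, $w\in\mathbb{C}$. Let $Z_{\mathrm I}^{\mathrm{phys}}(q_a,p^b;T)$ be the same integral with $\hat c,\hat e^+,T^+$ put to zero in $S$, and let $Z_{\mathrm I}^{\mathrm{gh}}(c_a,c_b;T,T^+)$ be the integral over $\hat c,\hat e^+$ of the exponential of the terms of $S$ which contain ghosts. Let $\star$ be the star product $$(\varphi\star\psi)(p,q)=\mathrm e^{\mathrm i\hbar\frac{\partial^2}{\partial\tilde q^i\partial\tilde p_i}}\varphi(\tilde p,q)\,\psi(p,\tilde q)\Big|_{\tilde p=p,\ \tilde q=q},$$ and let $\mathrm e_\star^{h}=\sum_{m\ge0}\frac1{m!}\,h\star\cdots\star h$. Let $\hat S^f_{HJ}(q_a,p^b;\mathrm e^T)$ be the Hamilton--Jacobi action for $f=p_iq^i$, i.e. the value of $$S^f[p,q,e]=-p_i(t_b)q^i(t_b)+\int_{t_a}^{t_b}\big(p_i\,dq^i-e^\alpha H_\alpha(p,q)\big),\qquad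 e=\tfrac{T\,dt}{t_b-t_a},$$ whose path-ordered exponential is $\mathrm e^T$, on the solution of $dq^i=e^\alpha\frac{\partial H_\alpha}{\partial p_i}$, $dp_i=-e^\alpha\frac{\partial H_\alpha}{\partial q^i}$ with $q(t_a)=q_a$ and $p(t_b)=p^b$. **Theorem.** 1. $Z_{\mathrm I}=Z_{\mathrm I}^{\mathrm{phys}}\cdot Z_{\mathrm I}^{\mathrm{gh}}$. 2. $Z_{\mathrm I}^{\mathrm{phys}}(q_a,p^b;T)=\mathrm e^{-\frac{\mathrm i}{\hbar}p^b_iq^i_a}\ \mathrm e_\star^{-\frac{\mathrm i}{\hbar}\langle H,T\rangle}(p^b,q_a)$. 3. There are formal power series $\mathcal S_l(T)$ in $T$, $l\ge 0$, without constant term, such that $$Z_{\mathrm I}^{\mathrm{phys}}(q_a,p^b;T)=\exp\Big(\tfrac{\mathrm i}{\hbar}\big(-p^b_iq_a^i+\mathcal S_0(T)+\hbar\,\mathcal S_1(T)+\hbar^2\mathcal S_2(T)+\cdots\big)\Big).$$ The leading term is the sum of the tree diagrams. Its part of degree $m\ge1$ in $T$ is $$\frac{(-1)^{m-1}}{m!}\sum_{E}\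 \int_{[t_a,t_b]^m}\prod_{(r,s)\in E}\theta(t_r-t_s)\,d^mt\ \cdot\prod_{(r,s)\in E}\Big(\sum_i\tfrac{\partial}{\partial q^i_r}\tfrac{\partial}{\partial p_{i,s}}\Big)\prod_{r=1}^m\frac{-\langle H,T\rangle(p_r,q_r)}{t_b-t_a}\bigg|_{(p_r,q_r)=(p^b,q_a)\ \forall r},$$ where $E$ runs over the oriented trees with vertex set $\{1,\dots,m\}$. 4. The leading term is the classical Hamilton--Jacobi action: for every $r>0$ and every sufficiently small $T$ there is exactly one solution of the above boundary value problem which stays at distance less than $r$ from the constant path $(p^b,q_a)$, and the corresponding $\hat S^f_{HJ}(q_a,p^b;\mathrm e^T)$ has the asymptotic expansion $-p^b_iq_a^i+\mathcal S_0(T)$ as $T\to0$, that is, the difference between it and the truncation of this series at degree $m$ in $T$ is $O(\|T\|^{m+1})$ for every $m$. In this sense $$Z_{\mathrm I}^{\mathrm{phys}}(q_a,p^b;T)=\mathrm e^{\frac{\mathrm i}{\hbar}\left(\hat S^f_{HJ}(q_a,p^b;\mathrm e^T)+O(\hbar)\right)}.$$ -/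

import Mathlib

open scoped ContDiff Topology

noncomputable section

namespace BVBFV

/-! ### Phase space, constraints, classical Hamilton–Jacobi action -/

/-- The target `T^*ℝ^N`, with points `(p, q)`. -/
abbrev Phase (N : ℕ) : Type := (Fin N → ℝ) × (Fin N → ℝ)

/-- The direction `∂/∂p_i`. -/
def dirP {N : ℕ} (i : Fin N) : Phase N := (Pi.single i 1, 0)

/-- The direction `∂/∂q^i`. -/
def dirQ {N : ℕ} (i : Fin N) : Phase N := (0, Pi.single i 1)

/-- `∂H/∂p_i` -/
def partialP {N : ℕ} (H : Phase N → ℝ) (i : Fin N) (x : Phase N) : ℝ := fderiv ℝ H x (dirP i)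

/-- `∂H/∂q^i` -/
def partialQ {N : ℕ} (H : Phase N → ℝ) (i : Fin N) (x : Phase N) : ℝ := fderiv ℝ H x (dirQ i)

/-- The function `⟨H, T⟩ = T^α H_α`. -/
def pairHT {N : ℕ} {ι : Type*} [Fintype ι] (H : ι → Phase N → ℝ) (T : ι → ℝ) (x : Phase N) : ℝ :=
  ∑ α, T α * H α x

/-- `x = (p, q)` solves on `[ta, tb]` the evolution equations
`dq^i = e^α ∂H_α/∂p_i`, `dp_i = - e^α ∂H_α/∂q^i` of the connection one-form `e = e^α(t) dt`
(the constraints `H_α = 0` are not imposed), with `q(ta) = qa` and `p(tb) = pb`. -/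
structure IsEvolution {N : ℕ} {ι : Type*} [Fintype ι] (H : ι → Phase N → ℝ) (ta tb : ℝ)
    (e : ℝ → ι → ℝ) (qa pb : Fin N → ℝ) (x : ℝ → Phase N) : Prop where
  evol : ∀ t ∈ Set.Icc ta tb, HasDerivWithinAt x
    ((fun i => -∑ α, e t α * partialQ (H α) i (x t)), (fun i => ∑ α, e t α * partialP (H α) i (x t)))
    (Set.Icc ta tb) t
  initial : (x ta).2 = qa
  final : (x tb).1 = pb

/-- The action `S^f[p,q,e] = - p_i(tb) q^i(tb) + ∫_{ta}^{tb} (p_i dq^i - e^α H_α(p,q))`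
for the polarization change `f = p_i q^i` at the final endpoint. -/
def actionF {N : ℕ} {ι : Type*} [Fintype ι] (H : ι → Phase N → ℝ) (ta tb : ℝ)
    (e : ℝ → ι → ℝ) (x : ℝ → Phase N) : ℝ :=
  -(∑ i, (x tb).1 i * (x tb).2 i) +
    ∫ t in ta..tb,
      ((∑ i, (x t).1 i * derivWithin (fun s => (x s).2 i) (Set.Icc ta tb) t)
        - ∑ α, e t α * H α (x t))

/-- The connection one-form `T dt / (tb - ta)`; its path-ordered exponential over `[ta, tb]`
is the group element `e^T`. -/
def constConnection {ι : Type*} (ta tb : ℝ) (T : ι → ℝ) : ℝ → ι → ℝ :=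
  fun _ α => T α / (tb - ta)

/-- `x` solves the evolution equations for the connection `T dt/(tb - ta)` with the endpoint
values `qa`, `pb`, and stays at distance less than `r` from the constant path `(pb, qa)`, which is
the solution for `T = 0`. -/
def IsBranch {N : ℕ} {ι : Type*} [Fintype ι] (H : ι → Phase N → ℝ) (ta tb : ℝ)
    (qa pb : Fin N → ℝ) (r : ℝ) (T : ι → ℝ) (x : ℝ → Phase N) : Prop :=
  IsEvolution H ta tb (constConnection ta tb T) qa pb x ∧
    ∀ t ∈ Set.Icc ta tb, dist (x t) (pb, qa) < r

open Classical in
/-- The classical Hamilton–Jacobi action `Ŝ^f_HJ(qa, pb; e^T)`: the value of `S^f` on the solution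
of the evolution equations (the one in the `r`-neighbourhood of the constant path, in case there
are several). -/
def hatSHJ {N : ℕ} {ι : Type*} [Fintype ι] (H : ι → Phase N → ℝ) (ta tb : ℝ)
    (qa pb : Fin N → ℝ) (r : ℝ) (T : ι → ℝ) : ℝ :=
  if h : ∃ x, IsBranch H ta tb qa pb r T x then
    actionF H ta tb (constConnection ta tb T) h.choose
  else 0

/-! ### Formal series in `ħ` -/

/-- The field `ℂ((ħ))` of formal Laurent series in `ħ`. -/
def Kħ : Type := LaurentSeries ℂ

instance : Field Kħ := inferInstanceAs (Field (LaurentSeries ℂ))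

instance : CharZero Kħ :=
  charZero_of_injective_ringHom (f := (HahnSeries.C : ℂ →+* LaurentSeries ℂ))
    HahnSeries.C_injective

/-- The coefficient of `ħ^k`. -/
def coeffħ (a : Kħ) (k : ℤ) : ℂ := HahnSeries.coeff (show LaurentSeries ℂ from a) k

/-- The inclusion of `ℂ[[ħ]]` in `ℂ((ħ))`. -/
def ofħ : PowerSeries ℂ →+* Kħ := HahnSeries.ofPowerSeries ℤ ℂ

/-- Complex constants in `ℂ((ħ))`. -/
def cst (z : ℂ) : Kħ := ofħ (PowerSeries.C z)

/-- The element `i/ħ`. -/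
def iOverHbar : Kħ := (HahnSeries.single (-1 : ℤ) Complex.I : LaurentSeries ℂ)

/-- The element `iħ`. -/
def iHbar : Kħ := (HahnSeries.single (1 : ℤ) Complex.I : LaurentSeries ℂ)

open Classical in
/-- The Laurent series with given coefficients (bounded below in degree; otherwise `0`). -/
def laurentMk (a : ℤ → ℂ) : Kħ :=
  if h : BddBelow (Function.support a) then
    (HahnSeries.ofSuppBddBelow a h : LaurentSeries ℂ)
  else 0

/-- The Heaviside function, with `θ(0) = 0`. -/
def heaviside (t : ℝ) : ℝ := if 0 < t then 1 else 0

/-- `φ(s) = (s - ta)/(tb - ta)`. -/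
def phi (ta tb s : ℝ) : ℝ := (s - ta) / (tb - ta)

/-! ### Grassmann algebras of the ghost sector -/

/-- Labels of the odd parameters `c_a^α`, `c_b^α`, `T^+_α` (in this order). -/
abbrev ParamGen (ι : Type*) : Type _ := ι ⊕ ι ⊕ ι

/-- Labels of all odd generators: the parameters, and the values `ĉ^α(t)` and `ê^+_α(t)` of the
fluctuations (in this order). -/
abbrev FieldGen (ι : Type*) : Type _ := ParamGen ι ⊕ (ℝ × ι) ⊕ (ℝ × ι)

/-- The Grassmann algebra over `ℂ((ħ))` generated by `c_a^α, c_b^α, T^+_α`. -/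
abbrev GrParam (ι : Type*) : Type _ := ExteriorAlgebra Kħ (ParamGen ι →₀ Kħ)

/-- The Grassmann algebra over `ℂ((ħ))` generated by `c_a^α, c_b^α, T^+_α, ĉ^α(t), ê^+_α(t)`. -/
abbrev GrField (ι : Type*) : Type _ := ExteriorAlgebra Kħ (FieldGen ι →₀ Kħ)

section Grassmann

variable {ι : Type*}

/-- An odd generator as an element of the Grassmann algebra. -/
def odd (a : FieldGen ι) : GrField ι := ExteriorAlgebra.ι Kħ (Finsupp.single a 1)

/-- `c_a^α` -/
def cA (α : ι) : GrField ι := odd (Sum.inl (Sum.inl α))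

/-- `c_b^α` -/
def cB (α : ι) : GrField ι := odd (Sum.inl (Sum.inr (Sum.inl α)))

/-- `T^+_α` -/
def Tplus (α : ι) : GrField ι := odd (Sum.inl (Sum.inr (Sum.inr α)))

/-- `ĉ^α(t)` -/
def hatC (t : ℝ) (α : ι) : GrField ι := odd (Sum.inr (Sum.inl (t, α)))

/-- `ê^+_α(t)` -/
def hatEplus (t : ℝ) (α : ι) : GrField ι := odd (Sum.inr (Sum.inr (t, α)))

/-- The ghost propagator in Case I,
`⟨ĉ^α(s) ê^+_β(t)⟩ = iħ δ^α_β (θ(s-t) - φ(s)) = - ⟨ê^+_β(t) ĉ^α(s)⟩`,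
all other two-point functions of odd generators being zero. -/
def ghostProp [DecidableEq ι] (ta tb : ℝ) : FieldGen ι → FieldGen ι → Kħ
  | Sum.inr (Sum.inl (s, α)), Sum.inr (Sum.inr (t, β)) =>
      if α = β then iHbar * cst ((heaviside (s - t) - phi ta tb s : ℝ) : ℂ) else 0
  | Sum.inr (Sum.inr (t, β)), Sum.inr (Sum.inl (s, α)) =>
      if α = β then -(iHbar * cst ((heaviside (s - t) - phi ta tb s : ℝ) : ℂ)) else 0
  | _, _ => 0

/-- The ghost propagator as a bilinear form on the span of the odd generators. -/
def ghostForm [DecidableEq ι] (ta tb : ℝ) : LinearMap.BilinForm Kħ (FieldGen ι →₀ Kħ) :=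
  Finsupp.lift ((FieldGen ι →₀ Kħ) →ₗ[Kħ] Kħ) Kħ (FieldGen ι)
    (fun a => Finsupp.lift Kħ Kħ (FieldGen ι) (fun b => ghostProp ta tb a b))

theorem ghostProp_swap [DecidableEq ι] (ta tb : ℝ) (a b : FieldGen ι) :
    ghostProp ta tb a b = -ghostProp ta tb b a := by
  rcases a with a | ⟨s, α⟩ | ⟨s, α⟩ <;> rcases b with b | ⟨t, β⟩ | ⟨t, β⟩ <;>
    simp [ghostProp] <;> split_ifs <;> simp

theorem ghostForm_swap [DecidableEq ι] (ta tb : ℝ) (x y : FieldGen ι →₀ Kħ) :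
    ghostForm ta tb x y = -ghostForm ta tb y x := by
  have h : ghostForm (ι := ι) ta tb = -(ghostForm ta tb).flip := by
    ext a b
    simpa [ghostForm] using ghostProp_swap ta tb a b
  conv_lhs => rw [h]
  simp

theorem ghostForm_quadratic [DecidableEq ι] (ta tb : ℝ) :
    (-ghostForm (ι := ι) ta tb).toQuadraticMap =
      (0 : QuadraticForm Kħ (FieldGen ι →₀ Kħ)) - 0 := by
  ext x
  have h := ghostForm_swap ta tb x x
  have h2 : ghostForm ta tb x x = 0 := by
    have h3 : (2 : Kħ) * ghostForm ta tb x x = 0 := by linear_combination h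
    exact (mul_eq_zero.mp h3).resolve_left two_ne_zero
  simp [h2]

/-- The projection which kills the fluctuation generators. -/
def killFields : (FieldGen ι →₀ Kħ) →ₗ[Kħ] (ParamGen ι →₀ Kħ) :=
  Finsupp.lift (ParamGen ι →₀ Kħ) Kħ (FieldGen ι)
    (Sum.elim (fun a => Finsupp.single a 1) (fun _ => 0))

/-- The Gaussian Berezin integral over the ghost fluctuations, i.e. Wick's theorem for the ghost
propagator `⟨ ⟩`. It is the linear map `W` with `W(1) = 1` and
`W(m x) = m W(x) + ⟨m, ·⟩ ⌟ W(x)` for `m` in the span of the generators (a generator `m` is either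
left alone or contracted with one of the factors of `x`), followed by setting all the
uncontracted fluctuations to zero. -/
def ghostWick [DecidableEq ι] (ta tb : ℝ) : GrField ι →ₗ[Kħ] GrParam ι :=
  (ExteriorAlgebra.map killFields).toLinearMap ∘ₗ
    CliffordAlgebra.changeForm (ghostForm_quadratic ta tb)

/-- The exponential of a nilpotent element of the Grassmann algebra. -/
def grExp (a : GrField ι) : GrField ι :=
  ∑ m ∈ Finset.range (nilpotencyClass a), cst (1 / (m.factorial : ℂ)) • a ^ m

/-- The monomial `∏_{s ∈ S} s` in the odd parameters, in a fixed order. -/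
def grMonomial (S : Finset (ParamGen ι)) : GrParam ι :=
  (S.toList.map fun s => ExteriorAlgebra.ι Kħ (Finsupp.single s 1)).prod

/-- The coefficient of `grMonomial S`, computed by applying the left derivatives with respect to
the elements of `S` and setting the remaining odd parameters to zero. -/
def grCoeff (S : Finset (ParamGen ι)) (x : GrParam ι) : Kħ :=
  ExteriorAlgebra.algebraMapInv
    (S.toList.foldl
      (fun (y : GrParam ι) s => CliffordAlgebra.contractLeft (Finsupp.lapply s) y) x)

end Grassmann

/-! ### Wick's theorem in the physical sector -/

section Physical

variable {N n : ℕ}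

/-- The derivative of a function of the fields at `n` times in a given direction. -/
def partialAt (r : Fin n) (v : Phase N) (F : (Fin n → Phase N) → ℂ) : (Fin n → Phase N) → ℂ :=
  fun x => fderiv ℝ F x (Pi.single r v)

/-- The operator `∑_i ∂/∂q^i_r ∂/∂p_{i,s}` joining the insertions `r` and `s` by one edge. -/
def edgeOp (r s : Fin n) (F : (Fin n → Phase N) → ℂ) : (Fin n → Phase N) → ℂ :=
  fun x => ∑ i : Fin N, partialAt r (dirQ i) (partialAt s (dirP i) F) x

/-- The sum of all contractions `q̂^i(t_r) p̂_j(t_s) ↦ δ^i_j θ(t_r - t_s)`; together with the factor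
`iħ` this is the propagator `⟨q̂^i(s) p̂_j(t)⟩ = iħ δ^i_j θ(s - t)`. -/
def contraction (t : Fin n → ℝ) (F : (Fin n → Phase N) → ℂ) : (Fin n → Phase N) → ℂ :=
  fun x => ∑ r, ∑ s, (heaviside (t r - t s) : ℂ) * edgeOp r s F x

/-- The contraction of the fields at time `t` with the endpoint sources
`(i/ħ)(- p^b_i q̂^i(tb) - p̂_i(ta) q_a^i)`, that is
`p̂_i(t) ↦ (i/ħ)(-p^b_i)·iħ θ(tb - t)` and `q̂^i(t) ↦ (i/ħ)(-q_a^i)·iħ θ(t - ta)`. -/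
def sourceMean (ta tb : ℝ) (qa pb : Fin N → ℝ) (t : ℝ) : Phase N :=
  (heaviside (tb - t) • pb, heaviside (t - ta) • qa)

/-- The contraction of the two endpoint sources with each other is
`(i/ħ)² p^b_i q_a^j ⟨q̂^i(tb) p̂_j(ta)⟩ = w/ħ`; this is the number `w`. -/
def sourceWeight (ta tb : ℝ) (qa pb : Fin N → ℝ) : ℂ :=
  Complex.I ^ 2 * Complex.I * (heaviside (tb - ta) * ∑ i, pb i * qa i : ℝ)

/-- For a function `F(t, x)` of `n` times and of the physical fields at these times, the
integral over `t ∈ [ta, tb]^n` of its Gaussian expectation value in the presence of the endpoint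
sources, `∫ dt exp(iħ · contraction) F(t, x)` at `x_r = sourceMean(t_r)`; the exponential and the
integral are taken coefficientwise in `ħ`. -/
def physIntegral (ta tb : ℝ) (qa pb : Fin N → ℝ)
    (F : (Fin n → ℝ) → (Fin n → Phase N) → Kħ) : Kħ :=
  laurentMk fun k => ∑ᶠ j : ℕ, (Complex.I ^ j / (j.factorial : ℂ)) *
    ∫ t in Set.Icc (fun _ : Fin n => ta) (fun _ => tb),
      ((contraction t)^[j] fun x => coeffħ (F t x) (k - j)) fun r => sourceMean ta tb qa pb (t r)

end Physical

/-! ### The partition function -/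

/-- The ring in which partition functions live: formal combinations of exponentials `e^{w/ħ}`,
`w ∈ ℂ`, with coefficients in `GrParam ι [[ε]]`. The formal parameter `ε` counts the bulk vertices,
each of which is linear in `T`: the coefficient of `ε^n` is the part of degree `n` in `T`. -/
abbrev States (ι : Type*) : Type _ := AddMonoidAlgebra (PowerSeries (GrParam ι)) ℂ

section Partition

variable {N : ℕ} {ι : Type*} [Fintype ι] [DecidableEq ι]

/-- The perturbative functional integral
`∫ exp((i/ħ)(∫ p̂ dq̂ - ê^+ dĉ - p^b q̂(tb) - p̂(ta) q_a + J + ε ∫_{ta}^{tb} L(t, p̂(t), q̂(t)) dt))`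
over the fluctuations `p̂, q̂, ĉ, ê^+`, with ghost source `J` and bulk density `L`:
`e^{(i/ħ) ε ∫ L}` is expanded, and the Gaussian integral of each term is given by Wick's theorem. -/
def feynmanIntegral (ta tb : ℝ) (qa pb : Fin N → ℝ) (J : GrField ι)
    (L : ℝ → Phase N → GrField ι) : States ι :=
  AddMonoidAlgebra.single (sourceWeight ta tb qa pb) (PowerSeries.mk fun n =>
    ∑ S : Finset (ParamGen ι),
      (cst (1 / (n.factorial : ℂ)) * iOverHbar ^ n *
        physIntegral ta tb qa pb (n := n) (fun t x =>
          grCoeff S (ghostWick ta tb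
            (grExp (iOverHbar • J) * (List.ofFn fun r => L (t r) (x r)).prod)))) •
      grMonomial S)

/-- The bulk density (the kinetic terms `p dq - e^+ dc` being omitted) of the BV action with
constant structure functions `f α β γ = f_{αβ}^γ`,
`- e^α H_α + c^α (q^+_i ∂H_α/∂p_i - p_+^i ∂H_α/∂q^i) - ½ f_{αβ}^γ c^+_γ c^α c^β + f_{αβ}^γ e^+_γ c^α e^β`,
as a function of the values of the fields. -/
def bvDensity (f : ι → ι → ι → ℝ) (H : ι → Phase N → ℝ) (x : Phase N) (e : ι → ℝ)
    (c : ι → GrField ι) (pplus qplus : Fin N → GrField ι) (eplus : ι → GrField ι)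
    (cplus : ι → ℝ) : GrField ι :=
  -(∑ α, cst (e α * H α x : ℝ) • (1 : GrField ι))
  + ∑ α, c α * ∑ i, (cst (partialP (H α) i x : ℂ) • qplus i - cst (partialQ (H α) i x : ℂ) • pplus i)
  - ∑ α, ∑ β, ∑ γ, cst ((1 / 2 * f α β γ * cplus γ : ℝ) : ℂ) • (c α * c β)
  + ∑ α, ∑ β, ∑ γ, cst ((f α β γ * e β : ℝ) : ℂ) • (eplus γ * c α)

/-- The bulk density at time `t`, for `p̂(t), q̂(t)` the components of `x`, in the splitting
`e = T dt/(tb - ta) + ê`, `e^+ = T^+ + ê^+` and on the gauge-fixing lagrangian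
`p̂_+ = q̂^+ = ê = ĉ^+ = 0`. -/
def bulkDensity (ta tb : ℝ) (f : ι → ι → ι → ℝ) (H : ι → Phase N → ℝ) (T : ι → ℝ)
    (t : ℝ) (x : Phase N) : GrField ι :=
  bvDensity f H x (fun α => T α / (tb - ta) + 0) (hatC t) 0 0
    (fun α => Tplus α + hatEplus t α) 0

/-- The ghost boundary terms
`T^+_α (c_b^α - c_a^α) + ê^+_α(tb) c_b^α - ê^+_α(ta) c_a^α` of the adapted BV action. -/
def ghostSource (ta tb : ℝ) : GrField ι :=
  ∑ α, (Tplus α * (cB α - cA α) + hatEplus tb α * cB α - hatEplus ta α * cA α)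

/-- The structure constants `f_{αβ}^γ` of a Lie algebra with respect to a basis,
`[b_α, b_β] = f_{αβ}^γ b_γ`. -/
def structureConst {𝔤 : Type*} [LieRing 𝔤] [LieAlgebra ℝ 𝔤] (b : Module.Basis ι ℝ 𝔤)
    (α β γ : ι) : ℝ := b.repr ⁅b α, b β⁆ γ

/-- The partition function `Z_I(q_a, c_a, p^b, c_b; T, T^+)`. -/
def ZI (ta tb : ℝ) (f : ι → ι → ι → ℝ) (H : ι → Phase N → ℝ) (qa pb : Fin N → ℝ)
    (T : ι → ℝ) : States ι :=
  feynmanIntegral ta tb qa pb (ghostSource ta tb) (bulkDensity ta tb f H T)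

/-- The physical part: the ghost fields `c, e^+` of the gauge-fixed action are put to zero. -/
def ZIphys (ta tb : ℝ) (f : ι → ι → ι → ℝ) (H : ι → Phase N → ℝ) (qa pb : Fin N → ℝ)
    (T : ι → ℝ) : States ι :=
  feynmanIntegral ta tb qa pb 0 (fun _ x => bvDensity f H x (fun α => T α / (tb - ta)) 0 0 0 0 0)

/-- The ghost part: the functional integral over `ĉ, ê^+` of the terms of the gauge-fixed action
which contain ghosts. It depends on `c_a, c_b, T^+, T` only, and not on `H_α, q_a, p^b`. -/
def ZIgh (ta tb : ℝ) (f : ι → ι → ι → ℝ) (T : ι → ℝ) : States ι :=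
  feynmanIntegral (N := 0) ta tb 0 0 (ghostSource ta tb) (bulkDensity ta tb f 0 T)

end Partition

/-! ### Star exponential -/

section Star

variable {N : ℕ}

/-- The operator `∂²/∂q̃^i∂p̃_i` on functions of `(p̃, q̃)`. -/
def starOp (F : Phase N → ℂ) : Phase N → ℂ :=
  fun y => ∑ i : Fin N, fderiv ℝ (fun z => fderiv ℝ F z (dirP i)) y (dirQ i)

/-- The star product
`(φ ⋆ ψ)(p,q) = exp(iħ ∂²/∂q̃^i∂p̃_i) φ(p̃,q) ψ(p,q̃)` at `p̃ = p`, `q̃ = q`,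
on functions with values in `ℂ[[ħ]]`. -/
def starProd (φ ψ : Phase N → PowerSeries ℂ) : Phase N → PowerSeries ℂ :=
  fun x => PowerSeries.mk fun k => ∑ jl ∈ Finset.HasAntidiagonal.antidiagonal k,
    (Complex.I ^ jl.1 / (jl.1.factorial : ℂ)) *
      (starOp^[jl.1] fun y => PowerSeries.coeff jl.2 (φ (y.1, x.2) * ψ (x.1, y.2))) x

/-- The star powers `h ⋆ ⋯ ⋆ h`. -/
def starPow (h : Phase N → ℝ) : ℕ → Phase N → PowerSeries ℂ
  | 0 => fun _ => 1
  | n + 1 => starProd (fun x => PowerSeries.C (h x : ℂ)) (starPow h n)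

/-- The star exponential `e_⋆^{-(i/ħ) ε h}` at the point `x`, as a formal power series in `ε`. -/
def starExp (h : Phase N → ℝ) (x : Phase N) : PowerSeries Kħ :=
  PowerSeries.mk fun n => cst (1 / (n.factorial : ℂ)) * (-iOverHbar) ^ n *
    ofħ (starPow h n x)

end Star

/-! ### Exponentials of formal actions; trees -/

/-- The inclusion of the series without odd parameters. -/
def scalarState {ι : Type*} (A : PowerSeries Kħ) : PowerSeries (GrParam ι) :=
  PowerSeries.map (algebraMap Kħ (GrParam ι)) A

/-- `exp W` for a power series `W` in `ε` with zero constant term. -/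
def expSeries (W : PowerSeries Kħ) : PowerSeries Kħ :=
  PowerSeries.mk fun n => ∑ m ∈ Finset.range (n + 1),
    cst (1 / (m.factorial : ℂ)) * PowerSeries.coeff n (W ^ m)

/-- `exp((i/ħ)(a + 𝒮))` for `a ∈ ℂ` and `𝒮 ∈ ℂ[[ħ]][[ε]]` with zero constant term in `ε`. -/
def expAction {ι : Type*} (a : ℂ) (𝒮 : PowerSeries (PowerSeries ℂ)) : States ι :=
  AddMonoidAlgebra.single (Complex.I * a) (scalarState (expSeries
    (PowerSeries.C iOverHbar * PowerSeries.map ofħ 𝒮)))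

open Classical in
/-- The sets `E` of directed edges on the vertices `0, …, n-1` which are the oriented trees:
the underlying undirected graph is a tree and `E` has exactly `n - 1` elements. -/
def orientedTrees (n : ℕ) : Finset (Finset (Fin n × Fin n)) :=
  Finset.univ.filter fun E =>
    (SimpleGraph.fromRel fun r s => (r, s) ∈ E).IsTree ∧ E.card + 1 = n

/-- The sum of the tree diagrams with `n ≥ 1` bulk vertices, as a contribution to the exponent
`(i/ħ) S` (so that the prefactor is `(i/ħ)^n (iħ)^(n-1) = (i/ħ) (-1)^(n-1)`): the vertices
are `-⟨H,T⟩ dt/(tb - ta)`, placed at times in `[ta, tb]` along the interval and evaluated (after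
summation over the edges which end at the endpoints) at `(p^b, q_a)`, and an edge from `r` to `s`
stands for `θ(t_r - t_s) ∂/∂q^i_r ∂/∂p_{i,s}`. -/
def treeAction {N : ℕ} {ι : Type*} [Fintype ι] (H : ι → Phase N → ℝ) (ta tb : ℝ)
    (qa pb : Fin N → ℝ) (n : ℕ) (T : ι → ℝ) : ℂ :=
  ((-1) ^ (n - 1) / (n.factorial : ℂ)) * ∑ E ∈ orientedTrees n,
    (∫ t in Set.Icc (fun _ : Fin n => ta) (fun _ => tb),
      ∏ rs ∈ E, (heaviside (t rs.1 - t rs.2) : ℂ)) *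
    (E.toList.foldr (fun rs F => edgeOp rs.1 rs.2 F)
      (fun x : Fin n → Phase N => ∏ r, (-(pairHT H T (x r) / (tb - ta)) : ℂ))) fun _ => (pb, qa)

end BVBFV

end

open scoped ContDiff Topology

noncomputable section

/-! A constant-coefficient differential operator acting on the factors of a product over a vertex
set is a polynomial in symbols `X (r, j)`, and `ev` evaluates it. A Wick contraction is then
multiplication by the symbol `timeEdges`. Up to prefactors, the term of order n of the physical
partition function is the integral over n times of the exponential of this symbol, applied to n
copies of -⟨H,T⟩/(tb - ta), with a formal variable in place of iħ.

Star exponential. For pairwise distinct times the Heaviside factors let ∂/∂p act on the earlier and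
∂/∂q on the later vertex, so splitting off the earliest vertex is one star multiplication
(`mapLin_ev_expX_of_injective`). The integrand is constant almost everywhere, and the integral over
the cube is a star power of -⟨H,T⟩ (`graphSum_eq_starPower`).

Logarithm. Since θ is 0 or 1, exp(θc) = 1 + θ(exp c - 1), and the same integral is a sum over all
sets of directed edges (`expX_timeEdges`). Weights are multiplicative over disjoint vertex sets
(`graphWeight_join`), so sorting by the component of one vertex gives the linked cluster recursion
`graphSum_succ`, and by `expSeries_egf` the partition function is the exponential of the connected
diagrams. Each factor exp c - 1 carries a power of ħ, and a connected set on n vertices has at least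
n - 1 edges. Hence the connected part may be divided by ħ^(n-1), and its leading term is the sum
over trees (`coeff_connectedSum`).

Classical action. The star recursion reads Z' = f ⋆ Z. Writing it for Z = exp W and keeping the
leading powers of ħ gives the formal Hamilton-Jacobi equation S' = -⟨H,T⟩(p - ∂S/∂q, q)
(`hamiltonJacobi_leading`, `hamiltonJacobi_leadingAction`). Truncations of S satisfy it up to a
power of ‖T‖. Along a solution of the boundary value problem, with reversed time τ = (tb - t)/(tb -
ta), the defect p - pb + ∂S/∂q(τ, q) vanishes at tb and obeys a linear differential inequality, so
it is small (`IsBranch.exists_momentum_bound`). Then the Lagrangian is, up to a small error, minus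
the derivative of S(τ, q) - pb·q, which yields the action (`IsBranch.exists_action_bound`).
Existence and uniqueness of the solution for small T are a contraction argument.

Factorization. A bulk vertex is a scalar plus an even ghost term, and all of these commute, so a
product of vertices expands over the subset of physical vertices (`list_prod_add`). The ghost Wick
coefficients are finite sums of bounded measurable functions of the times (`exists_ghostCoeff_eq`),
Fubini separates the two groups of times, and the binomial coefficients turn the sum into a product
of series (`ZI_eq_mul`). -/

namespace BVBFV

/-! ### Commuting derivations and iterated derivatives. -/

section Jets

/-- A family of commuting derivations of a commutative real algebra. -/
structure CommDer (J : Type) (𝓕 : Type*) [CommRing 𝓕] [Algebra ℝ 𝓕] where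
  d : J → Derivation ℝ 𝓕 𝓕
  comm : ∀ i j f, d i (d j f) = d j (d i f)

variable {J : Type} {𝓕 : Type*} [CommRing 𝓕] [Algebra ℝ 𝓕]

/-- The iterated derivative of `f` with multi-index `m`. -/
def CommDer.jet (D : CommDer J 𝓕) (f : 𝓕) (m : J →₀ ℕ) : 𝓕 :=
  haveI : LeftCommutative (fun (j : J) (g : 𝓕) => D.d j g) := ⟨fun i j g => D.comm i j g⟩
  Multiset.foldr (fun j g => D.d j g) f (Finsupp.toMultiset m)

@[simp] theorem CommDer.jet_zero (D : CommDer J 𝓕) (f : 𝓕) : D.jet f 0 = f := by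
  simp [CommDer.jet]

theorem CommDer.jet_single_add (D : CommDer J 𝓕) (f : 𝓕) (j : J) (m : J →₀ ℕ) :
    D.jet f (Finsupp.single j 1 + m) = D.d j (D.jet f m) := by
  simp [CommDer.jet]

theorem CommDer.d_jet (D : CommDer J 𝓕) (f : 𝓕) (j : J) (m : J →₀ ℕ) :
    D.jet (D.d j f) m = D.d j (D.jet f m) := by
  have : LeftCommutative (fun (j : J) (g : 𝓕) => D.d j g) := ⟨fun i j g => D.comm i j g⟩
  unfold CommDer.jet
  generalize Finsupp.toMultiset m = s
  induction s using Multiset.induction_on with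
  | empty => simp
  | cons a s ih => simp only [Multiset.foldr_cons, ih, D.comm a j]

end Jets

theorem curry_single_add {V J : Type} [DecidableEq V] (r r' : V) (j : J) (m : V × J →₀ ℕ) :
    (Finsupp.single (r, j) 1 + m).curry r' =
      if r' = r then Finsupp.single j 1 + m.curry r' else m.curry r' := by
  classical
  ext i
  split_ifs with h
  · subst h
    simp [Finsupp.curry_apply, Finsupp.single_apply]
  · have : ¬ (r = r' ∧ j = i) := fun h' => h h'.1.symm
    simp [Finsupp.curry_apply, this]

theorem derivation_prod {V : Type*} {𝓑 : Type*} [CommRing 𝓑] [Algebra ℝ 𝓑] [DecidableEq V]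
    (δ : Derivation ℝ 𝓑 𝓑) (s : Finset V) (g : V → 𝓑) :
    δ (∏ r ∈ s, g r) = ∑ r ∈ s, (∏ r' ∈ s.erase r, g r') • δ (g r) := by
  induction s using Finset.induction_on with
  | empty => simp
  | insert a s ha ih =>
    rw [Finset.prod_insert ha, Derivation.leibniz, ih, Finset.sum_insert ha,
      Finset.erase_insert ha, add_comm, Finset.smul_sum]
    congr 1
    refine Finset.sum_congr rfl fun r hr => ?_
    have hra : a ≠ r := fun h => ha (h ▸ hr)
    rw [Finset.erase_insert_of_ne hra, Finset.prod_insert fun h => ha (Finset.mem_of_mem_erase h),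
      smul_smul]

/-! ### Symbols of differential operators acting on products. -/

section Evaluation

variable {J : Type} {V κ₁ κ₂ : Type} [Fintype V] [Fintype κ₁] [Fintype κ₂]
variable {𝓑 : Type*} [CommRing 𝓑] [Algebra ℝ 𝓑]

open MvPolynomial in
/-- The linear functional on symbols of differential operators acting on the factors
of a product over `V`: a monomial is sent to the product of the jets `D r` of the factors. -/
def ev (D : V → (J →₀ ℕ) → 𝓑) : MvPolynomial (V × J) ℝ →ₗ[ℝ] 𝓑 :=
  (basisMonomials (V × J) ℝ).constr ℝ fun m => ∏ r, D r (m.curry r)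

theorem ev_monomial (D : V → (J →₀ ℕ) → 𝓑) (m : V × J →₀ ℕ) (a : ℝ) :
    ev D (MvPolynomial.monomial m a) = a • ∏ r, D r (m.curry r) := by
  have h : MvPolynomial.monomial m a = a • (MvPolynomial.basisMonomials (V × J) ℝ) m := by
    simp [MvPolynomial.smul_monomial]
  rw [h, map_smul, ev, Module.Basis.constr_basis]

theorem ev_one (D : V → (J →₀ ℕ) → 𝓑) : ev D 1 = ∏ r, D r 0 := by
  have h0 : (0 : V × J →₀ ℕ).curry = 0 := by ext; simp
  simpa [h0] using ev_monomial D 0 1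

/-- A variable is one derivative on the factor `r`; it can be moved from the symbol into the jet of
that factor. -/
theorem ev_X_mul [DecidableEq V] (D : V → (J →₀ ℕ) → 𝓑) (r : V) (j : J)
    (P : MvPolynomial (V × J) ℝ) :
    ev D (MvPolynomial.X (r, j) * P) =
      ev (Function.update D r fun m => D r (Finsupp.single j 1 + m)) P := by
  induction P using MvPolynomial.induction_on' with
  | add p q hp hq => rw [mul_add, map_add, map_add, hp, hq]
  | monomial m a =>
    rw [MvPolynomial.X, MvPolynomial.monomial_mul, one_mul, ev_monomial, ev_monomial]
    congr 1
    refine Finset.prod_congr rfl fun r' _ => ?_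
    rw [curry_single_add]
    by_cases h : r' = r
    · subst h; simp
    · simp [h]

/-- Symbols on complementary sets of vertices act on different factors, so the evaluation splits.
This is the algebraic half of the factorization of disconnected diagrams. -/
theorem ev_rename_mul (D : V → (J →₀ ℕ) → 𝓑) (e : κ₁ ⊕ κ₂ ≃ V)
    (P : MvPolynomial (κ₁ × J) ℝ) (Q : MvPolynomial (κ₂ × J) ℝ) :
    ev D (MvPolynomial.rename (Prod.map (e ∘ Sum.inl) id) P *
      MvPolynomial.rename (Prod.map (e ∘ Sum.inr) id) Q) =
      ev (fun r => D (e (Sum.inl r))) P * ev (fun r => D (e (Sum.inr r))) Q := by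
  have hinl : Function.Injective (Prod.map (e ∘ Sum.inl) (id : J → J)) :=
    (e.injective.comp Sum.inl_injective).prodMap Function.injective_id
  have hinr : Function.Injective (Prod.map (e ∘ Sum.inr) (id : J → J)) :=
    (e.injective.comp Sum.inr_injective).prodMap Function.injective_id
  induction P using MvPolynomial.induction_on' with
  | add p q hp hq => simp only [map_add, add_mul, hp, hq]
  | monomial m a =>
    induction Q using MvPolynomial.induction_on' with
    | add p q hp hq => simp only [map_add, mul_add, hp, hq]
    | monomial m' a' =>
      rw [MvPolynomial.rename_monomial, MvPolynomial.rename_monomial, MvPolynomial.monomial_mul,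
        ev_monomial, ev_monomial, ev_monomial, smul_mul_smul_comm, ← e.prod_comp,
        Fintype.prod_sum_type]
      congr 2
      · refine Finset.prod_congr rfl fun r _ => ?_
        congr 1
        ext j
        have h1 := Finsupp.mapDomain_apply hinl m (r, j)
        have h2 := Finsupp.mapDomain_of_notMem_range (f := Prod.map (e ∘ Sum.inr) (id : J → J)) m'
          (e (Sum.inl r), j) (by rintro ⟨⟨a, b⟩, h⟩; simp at h)
        simp only [Prod.map, Function.comp, id] at h1
        simp [Finsupp.curry_apply, h1, h2]
      · refine Finset.prod_congr rfl fun r _ => ?_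
        congr 1
        ext j
        have h1 := Finsupp.mapDomain_apply hinr m' (r, j)
        have h2 := Finsupp.mapDomain_of_notMem_range (f := Prod.map (e ∘ Sum.inl) (id : J → J)) m
          (e (Sum.inr r), j) (by rintro ⟨⟨a, b⟩, h⟩; simp at h)
        simp only [Prod.map, Function.comp, id] at h1
        simp [Finsupp.curry_apply, h1, h2]

theorem ev_rename (D : V → (J →₀ ℕ) → 𝓑) (e : κ₁ ≃ V) (P : MvPolynomial (κ₁ × J) ℝ) :
    ev D (MvPolynomial.rename (Prod.map e id) P) = ev (fun r => D (e r)) P := by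
  have h := ev_rename_mul (κ₂ := Empty) D ((Equiv.sumEmpty κ₁ Empty).trans e) P 1
  have h2 : (⇑((Equiv.sumEmpty κ₁ Empty).trans e) ∘ Sum.inl) = e := by ext; simp
  rw [h2] at h
  simpa [ev_one] using h

theorem map_ev {𝓒 : Type*} [CommRing 𝓒] [Algebra ℝ 𝓒] (φ : 𝓑 →ₐ[ℝ] 𝓒) (D : V → (J →₀ ℕ) → 𝓑)
    (P : MvPolynomial (V × J) ℝ) : φ (ev D P) = ev (fun r m => φ (D r m)) P := by
  induction P using MvPolynomial.induction_on' with
  | add p q hp hq => simp only [map_add, hp, hq]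
  | monomial m a => simp [ev_monomial]

/-- The Leibniz rule: a derivative of the whole product is the sum of the derivatives of its
factors. -/
theorem CommDer.d_ev [DecidableEq V] (D : CommDer J 𝓑) (f : V → 𝓑) (j : J)
    (P : MvPolynomial (V × J) ℝ) :
    D.d j (ev (fun r => D.jet (f r)) P) =
      ev (fun r => D.jet (f r)) ((∑ r, MvPolynomial.X (r, j)) * P) := by
  induction P using MvPolynomial.induction_on' with
  | add p q hp hq => simp only [map_add, mul_add, hp, hq]
  | monomial m a =>
    rw [Finset.sum_mul, map_sum, ev_monomial, Derivation.map_smul, derivation_prod,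
      Finset.smul_sum]
    refine Finset.sum_congr rfl fun r _ => ?_
    rw [MvPolynomial.X, MvPolynomial.monomial_mul, one_mul, ev_monomial,
      ← Finset.mul_prod_erase _ _ (Finset.mem_univ r), curry_single_add, if_pos rfl,
      CommDer.jet_single_add]
    congr 1
    rw [smul_eq_mul, mul_comm]
    congr 1
    refine Finset.prod_congr rfl fun r' hr' => ?_
    rw [curry_single_add, if_neg (Finset.ne_of_mem_erase hr')]

end Evaluation

/-! ### Exponential power series. -/

section ExpSeries

open PowerSeries

variable {A B : Type*} [CommRing A] [Algebra ℝ A] [CommRing B] [Algebra ℝ B]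

/-- A linear map applied to the coefficients of a power series. -/
def mapLin (L : A →ₗ[ℝ] B) : A⟦X⟧ →ₗ[ℝ] B⟦X⟧ where
  toFun F := PowerSeries.mk fun n => L (coeff n F)
  map_add' F G := by ext; simp
  map_smul' c F := by ext; simp

@[simp] theorem coeff_mapLin (L : A →ₗ[ℝ] B) (F : A⟦X⟧) (n : ℕ) :
    coeff n (mapLin L F) = L (coeff n F) := by simp [mapLin]

/-- The power series `exp(c X)`. -/
def expX (c : A) : A⟦X⟧ := PowerSeries.mk fun j => ((j.factorial : ℝ)⁻¹) • c ^ j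

@[simp] theorem coeff_expX (c : A) (j : ℕ) : coeff j (expX c) = ((j.factorial : ℝ)⁻¹) • c ^ j := by
  simp [expX]

theorem expX_zero : expX (0 : A) = 1 := by
  ext j
  rcases j with _ | j <;> simp [coeff_one]

theorem expX_add (a b : A) : expX (a + b) = expX a * expX b := by
  ext n
  rw [coeff_mul, coeff_expX, (Commute.all a b).add_pow', Finset.smul_sum]
  refine Finset.sum_congr rfl fun p hp => ?_
  rw [Finset.HasAntidiagonal.mem_antidiagonal] at hp
  rw [coeff_expX, coeff_expX, smul_mul_smul_comm, ← Nat.cast_smul_eq_nsmul ℝ, smul_smul]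
  congr 1
  have h := Nat.add_choose_mul_factorial_mul_factorial p.1 p.2
  rw [← Nat.choose_symm_add] at h
  rw [← hp, ← h]
  have h1 : ((p.1 + p.2).choose p.1 : ℝ) ≠ 0 := by
    exact_mod_cast (Nat.choose_pos (Nat.le_add_right _ _)).ne'
  have h2 := Nat.cast_ne_zero (R := ℝ).mpr p.1.factorial_ne_zero
  have h3 := Nat.cast_ne_zero (R := ℝ).mpr p.2.factorial_ne_zero
  push_cast
  field_simp

theorem expX_sum {σ : Type*} (s : Finset σ) (c : σ → A) :
    expX (∑ i ∈ s, c i) = ∏ i ∈ s, expX (c i) := by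
  classical
  induction s using Finset.induction_on with
  | empty => simp [expX_zero]
  | insert a s ha ih => rw [Finset.sum_insert ha, Finset.prod_insert ha, expX_add, ih]

theorem X_dvd_expX_sub_one (c : A) : (X : A⟦X⟧) ∣ expX c - 1 := by
  rw [X_dvd_iff, map_sub, ← coeff_zero_eq_constantCoeff_apply, coeff_expX]; simp

end ExpSeries

/-! ### Integrals over cubes of times. -/

section Fubini

open MeasureTheory

variable {V κ₁ κ₂ : Type} [Fintype V] [Fintype κ₁] [Fintype κ₂]

/-- Fubini's theorem for a cube whose coordinates are divided into two groups. -/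
theorem cube_integral_mul {𝕜 : Type*} [RCLike 𝕜] (ta tb : ℝ) (e : κ₁ ⊕ κ₂ ≃ V)
    (f : (κ₁ → ℝ) → 𝕜) (g : (κ₂ → ℝ) → 𝕜) :
    ∫ t in Set.Icc (fun _ : V => ta) (fun _ => tb), f (t ∘ e ∘ Sum.inl) * g (t ∘ e ∘ Sum.inr) =
      (∫ t in Set.Icc (fun _ : κ₁ => ta) (fun _ => tb), f t) *
        ∫ t in Set.Icc (fun _ : κ₂ => ta) (fun _ => tb), g t := by
  have h1 := (volume_measurePreserving_piCongrLeft (fun _ : V => ℝ) e)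
  have h2 := (volume_measurePreserving_sumPiEquivProdPi (fun _ : κ₁ ⊕ κ₂ => ℝ)).symm
  have h3 := h1.comp h2
  have hemb := (MeasurableEquiv.measurableEmbedding
    (MeasurableEquiv.piCongrLeft (fun _ : V => ℝ) e)).comp
    (MeasurableEquiv.measurableEmbedding
      (MeasurableEquiv.sumPiEquivProdPi (fun _ : κ₁ ⊕ κ₂ => ℝ)).symm)
  have hval : ∀ (x : (κ₁ → ℝ) × (κ₂ → ℝ)) (r : κ₁ ⊕ κ₂),
      (MeasurableEquiv.piCongrLeft (fun _ : V => ℝ) e)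
        ((MeasurableEquiv.sumPiEquivProdPi (fun _ : κ₁ ⊕ κ₂ => ℝ)).symm x) (e r) =
        Sum.elim x.1 x.2 r := by
    intro x r
    rw [MeasurableEquiv.coe_piCongrLeft, Equiv.piCongrLeft_apply_apply]
    cases r <;> rfl
  rw [← h3.setIntegral_preimage_emb hemb, ← setIntegral_prod_mul]
  have hset : (⇑(MeasurableEquiv.piCongrLeft (fun _ : V => ℝ) e) ∘
      ⇑(MeasurableEquiv.sumPiEquivProdPi (fun _ : κ₁ ⊕ κ₂ => ℝ)).symm) ⁻¹'
        Set.Icc (fun _ : V => ta) (fun _ => tb) =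
      Set.Icc (fun _ : κ₁ => ta) (fun _ => tb) ×ˢ Set.Icc (fun _ : κ₂ => ta) (fun _ => tb) := by
    ext x
    simp only [Set.mem_preimage, Set.mem_Icc, Set.mem_prod, Pi.le_def, Function.comp]
    rw [← e.forall_congr_right, ← e.forall_congr_right]
    simp only [hval, Sum.forall, Sum.elim_inl, Sum.elim_inr]
    tauto
  rw [hset]
  refine integral_congr_ae (Filter.Eventually.of_forall fun x => ?_)
  simp only
  congr 2 <;> · ext r; simp only [Function.comp, hval, Sum.elim_inl, Sum.elim_inr]

theorem cube_integral_equiv {𝕜 : Type*} [RCLike 𝕜] (ta tb : ℝ) (e : κ₁ ≃ V)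
    (f : (κ₁ → ℝ) → 𝕜) :
    ∫ t in Set.Icc (fun _ : V => ta) (fun _ => tb), f (t ∘ e) =
      ∫ t in Set.Icc (fun _ : κ₁ => ta) (fun _ => tb), f t := by
  have h := cube_integral_mul (κ₂ := Empty) ta tb ((Equiv.sumEmpty κ₁ Empty).trans e) f
    (fun _ => (1 : 𝕜))
  have h2 : (⇑((Equiv.sumEmpty κ₁ Empty).trans e) ∘ Sum.inl) = e := by ext; simp
  rw [h2] at h
  -- The cube without coordinates is one point, of measure one.
  have h3 : ∫ t in Set.Icc (fun _ : Empty => ta) (fun _ => tb), (1 : 𝕜) = 1 := by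
    have : Set.Icc (fun _ : Empty => ta) (fun _ => tb) = Set.univ := by
      ext x; simp
    rw [this, Measure.restrict_univ, volume_pi, Measure.pi_of_empty, integral_dirac]
  rw [h3] at h
  simpa using h

end Fubini

/-! ### Mayer factors and weights of edge sets. -/

section Mayer

open MeasureTheory PowerSeries

variable {N : ℕ} {V κ₁ κ₂ : Type}

/-- The symbol of the edge from `r` to `s`. -/
def edge (N : ℕ) (r s : V) : MvPolynomial (V × (Fin N ⊕ Fin N)) ℝ :=
  ∑ i : Fin N, MvPolynomial.X (r, Sum.inr i) * MvPolynomial.X (s, Sum.inl i)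

theorem rename_edge (φ : κ₁ → V) (r s : κ₁) :
    MvPolynomial.rename (Prod.map φ id) (edge N r s) = edge N (φ r) (φ s) := by
  simp [edge]

/-- A renaming of the vertices, applied to the coefficients of power series. -/
def renameSeries {J : Type} (φ : κ₁ → V) :
    (MvPolynomial (κ₁ × J) ℝ)⟦X⟧ →+* (MvPolynomial (V × J) ℝ)⟦X⟧ :=
  PowerSeries.map (MvPolynomial.rename (R := ℝ) (Prod.map φ (id : J → J))).toRingHom

@[simp] theorem coeff_renameSeries {J : Type} (φ : κ₁ → V) (P : (MvPolynomial (κ₁ × J) ℝ)⟦X⟧)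
    (n : ℕ) : coeff n (renameSeries φ P) =
      MvPolynomial.rename (Prod.map φ (id : J → J)) (coeff n P) := by
  simp [renameSeries]

theorem renameSeries_expX {J : Type} (φ : κ₁ → V) (c : MvPolynomial (κ₁ × J) ℝ) :
    renameSeries φ (expX c) = expX (MvPolynomial.rename (Prod.map φ (id : J → J)) c) := by
  ext1 n
  simp

/-- The product of the Mayer factors of a set of edges. -/
def mayer (N : ℕ) (E : Finset (V × V)) : (MvPolynomial (V × (Fin N ⊕ Fin N)) ℝ)⟦X⟧ :=
  ∏ e ∈ E, (expX (edge N e.1 e.2) - 1)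

theorem map_mayer (φ : κ₁ ↪ V) (E : Finset (κ₁ × κ₁)) :
    renameSeries φ (mayer N E) =
      mayer N (E.map (φ.prodMap φ)) := by
  simp only [mayer, map_prod, Finset.prod_map, map_sub, map_one]
  refine Finset.prod_congr rfl fun e _ => ?_
  rw [renameSeries_expX, rename_edge]
  rfl

/-- The inclusion of the first group of vertices. -/
def inlEmb (e : κ₁ ⊕ κ₂ ≃ V) : κ₁ ↪ V := ⟨e ∘ Sum.inl, e.injective.comp Sum.inl_injective⟩

/-- The inclusion of the second group of vertices. -/
def inrEmb (e : κ₁ ⊕ κ₂ ≃ V) : κ₂ ↪ V := ⟨e ∘ Sum.inr, e.injective.comp Sum.inr_injective⟩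

theorem disjoint_edges (e : κ₁ ⊕ κ₂ ≃ V) (E₁ : Finset (κ₁ × κ₁)) (E₂ : Finset (κ₂ × κ₂)) :
    Disjoint (E₁.map ((inlEmb e).prodMap (inlEmb e))) (E₂.map ((inrEmb e).prodMap (inrEmb e))) := by
  rw [Finset.disjoint_left]
  rintro x h1 h2
  simp only [Finset.mem_map, Prod.exists] at h1 h2
  obtain ⟨a, b, -, rfl⟩ := h1
  obtain ⟨c, d, -, h⟩ := h2
  simp [inlEmb, inrEmb, Function.Embedding.prodMap] at h

/-- The union of two sets of edges on complementary sets of vertices. -/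
def joinEdges (e : κ₁ ⊕ κ₂ ≃ V) (E₁ : Finset (κ₁ × κ₁)) (E₂ : Finset (κ₂ × κ₂)) :
    Finset (V × V) :=
  (E₁.map ((inlEmb e).prodMap (inlEmb e))).disjUnion
    (E₂.map ((inrEmb e).prodMap (inrEmb e))) (disjoint_edges e E₁ E₂)

variable [Fintype V] [Fintype κ₁] [Fintype κ₂]

/-- The measure of the set of times compatible with a set of edges. -/
def timeWeight (ta tb : ℝ) (E : Finset (V × V)) : ℝ :=
  ∫ t in Set.Icc (fun _ : V => ta) (fun _ => tb), ∏ e ∈ E, heaviside (t e.1 - t e.2)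

variable {𝓕 : Type*} [CommRing 𝓕] [Algebra ℝ 𝓕]

/-- The contribution of a set of edges to the partition function with vertices `V`. -/
def graphWeight (ta tb : ℝ) (δ : (Fin N ⊕ Fin N →₀ ℕ) → 𝓕) (E : Finset (V × V)) : 𝓕⟦X⟧ :=
  timeWeight ta tb E • mapLin (ev fun _ => δ) (mayer N E)

theorem mapLin_ev_rename_mul {J : Type} (D : V → (J →₀ ℕ) → 𝓕) (e : κ₁ ⊕ κ₂ ≃ V)
    (P : (MvPolynomial (κ₁ × J) ℝ)⟦X⟧) (Q : (MvPolynomial (κ₂ × J) ℝ)⟦X⟧) :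
    mapLin (ev D)
      (renameSeries (e ∘ Sum.inl) P *
      renameSeries (e ∘ Sum.inr) Q) =
      mapLin (ev fun r => D (e (Sum.inl r))) P * mapLin (ev fun r => D (e (Sum.inr r))) Q := by
  ext n
  simp only [coeff_mapLin, coeff_mul, map_sum, coeff_renameSeries]
  refine Finset.sum_congr rfl fun p _ => ?_
  exact ev_rename_mul D e _ _

theorem mapLin_ev_rename {J : Type} (D : V → (J →₀ ℕ) → 𝓕) (e : κ₁ ≃ V)
    (P : (MvPolynomial (κ₁ × J) ℝ)⟦X⟧) :
    mapLin (ev D)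
      (renameSeries e P) =
      mapLin (ev fun r => D (e r)) P := by
  ext n
  simp only [coeff_mapLin, coeff_renameSeries]
  exact ev_rename D e _

/-- Both ingredients of a weight are multiplicative: the volume of admissible times by Fubini, and
the differential operator because it acts on disjoint groups of factors. -/
theorem graphWeight_join (ta tb : ℝ) (δ : (Fin N ⊕ Fin N →₀ ℕ) → 𝓕) (e : κ₁ ⊕ κ₂ ≃ V)
    (E₁ : Finset (κ₁ × κ₁)) (E₂ : Finset (κ₂ × κ₂)) :
    graphWeight ta tb δ (joinEdges e E₁ E₂) =
      graphWeight ta tb δ E₁ * graphWeight ta tb δ E₂ := by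
  have h1 : timeWeight ta tb (joinEdges e E₁ E₂) = timeWeight ta tb E₁ * timeWeight ta tb E₂ := by
    rw [timeWeight, timeWeight, timeWeight, ← cube_integral_mul ta tb e]
    simp only [joinEdges, Finset.prod_disjUnion, Finset.prod_map]
    rfl
  have h2 : mayer N (joinEdges e E₁ E₂) =
      renameSeries (e ∘ Sum.inl)
          (mayer N E₁) *
      renameSeries (e ∘ Sum.inr)
          (mayer N E₂) := by
    rw [mayer, joinEdges, Finset.prod_disjUnion]
    exact congrArg₂ (· * ·) (map_mayer (inlEmb e) E₁).symm (map_mayer (inrEmb e) E₂).symm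
  rw [graphWeight, h1, h2, mapLin_ev_rename_mul, graphWeight, graphWeight, smul_mul_smul_comm]

/-- All vertices carry the same function, so relabelling them changes nothing. -/
theorem graphWeight_map (ta tb : ℝ) (δ : (Fin N ⊕ Fin N →₀ ℕ) → 𝓕) (e : κ₁ ≃ V)
    (E : Finset (κ₁ × κ₁)) :
    graphWeight ta tb δ (E.map (e.toEmbedding.prodMap e.toEmbedding)) =
      graphWeight ta tb δ E := by
  have h1 : timeWeight ta tb (E.map (e.toEmbedding.prodMap e.toEmbedding)) =
      timeWeight ta tb E := by
    rw [timeWeight, timeWeight, ← cube_integral_equiv ta tb e]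
    simp only [Finset.prod_map]
    rfl
  rw [graphWeight, h1, ← map_mayer]
  congr 1
  exact mapLin_ev_rename _ e _

end Mayer

/-! ### Linked cluster expansion. -/

section Cluster

open PowerSeries

variable {N : ℕ} {V κ₁ κ₂ : Type}

/-- The undirected graph underlying a set of directed edges. -/
abbrev edgeGraph (E : Finset (V × V)) : SimpleGraph V :=
  SimpleGraph.fromRel fun r s => (r, s) ∈ E

theorem edgeGraph_adj_of_mem {E : Finset (V × V)} {r s : V} (h : (r, s) ∈ E) (hne : r ≠ s) :
    (edgeGraph E).Adj r s := by
  rw [SimpleGraph.fromRel_adj]; exact ⟨hne, Or.inl h⟩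

theorem mem_joinEdges (e : κ₁ ⊕ κ₂ ≃ V) (E₁ : Finset (κ₁ × κ₁)) (E₂ : Finset (κ₂ × κ₂))
    (a b : κ₁ ⊕ κ₂) : (e a, e b) ∈ joinEdges e E₁ E₂ ↔
      (∃ r s, a = Sum.inl r ∧ b = Sum.inl s ∧ (r, s) ∈ E₁) ∨
      (∃ r s, a = Sum.inr r ∧ b = Sum.inr s ∧ (r, s) ∈ E₂) := by
  simp only [joinEdges, Finset.mem_disjUnion, Finset.mem_map, Prod.exists, inlEmb, inrEmb,
    Function.Embedding.coe_prodMap, Function.Embedding.coeFn_mk, Prod.map_apply,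
    Function.comp_apply, Prod.mk.injEq, EmbeddingLike.apply_eq_iff_eq]
  constructor
  · rintro (⟨r, s, h, rfl, rfl⟩ | ⟨r, s, h, rfl, rfl⟩)
    · exact Or.inl ⟨r, s, rfl, rfl, h⟩
    · exact Or.inr ⟨r, s, rfl, rfl, h⟩
  · rintro (⟨r, s, rfl, rfl, h⟩ | ⟨r, s, rfl, rfl, h⟩)
    · exact Or.inl ⟨r, s, h, rfl, rfl⟩
    · exact Or.inr ⟨r, s, h, rfl, rfl⟩

/-- No edge crosses between the two groups, so a path that starts in the first group stays there. -/
theorem reachable_join (e : κ₁ ⊕ κ₂ ≃ V) (E₁ : Finset (κ₁ × κ₁)) (E₂ : Finset (κ₂ × κ₂))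
    (v : κ₁) (u : V) : (edgeGraph (joinEdges e E₁ E₂)).Reachable (e (Sum.inl v)) u ↔
      ∃ r, u = e (Sum.inl r) ∧ (edgeGraph E₁).Reachable v r := by
  constructor
  · intro h
    rw [SimpleGraph.reachable_iff_reflTransGen] at h
    induction h with
    | refl => exact ⟨v, rfl, SimpleGraph.Reachable.refl _⟩
    | @tail b c _ hbc ih =>
      obtain ⟨r, rfl, hr⟩ := ih
      obtain ⟨c, rfl⟩ := e.surjective c
      rw [SimpleGraph.fromRel_adj, mem_joinEdges, mem_joinEdges] at hbc
      rcases hbc with ⟨hne, (⟨r', s, h1, rfl, h2⟩ | ⟨r', s, h1, -, -⟩) |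
        (⟨r', s, rfl, h1, h2⟩ | ⟨r', s, -, h1, -⟩)⟩
      · obtain rfl := Sum.inl_injective h1
        exact ⟨s, rfl, hr.trans (SimpleGraph.Adj.reachable
          (edgeGraph_adj_of_mem h2 fun h => hne (by rw [h])))⟩
      · cases h1
      · obtain rfl := Sum.inl_injective h1
        exact ⟨r', rfl, hr.trans (SimpleGraph.Adj.reachable
          (edgeGraph_adj_of_mem h2 fun h => hne (by rw [h]))).symm⟩
      · cases h1
  · rintro ⟨r, rfl, hr⟩
    let φ : edgeGraph E₁ →g edgeGraph (joinEdges e E₁ E₂) :=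
      { toFun := fun r => e (Sum.inl r)
        map_rel' := by
          intro a b hab
          rw [SimpleGraph.fromRel_adj] at hab ⊢
          refine ⟨fun h => hab.1 (Sum.inl_injective (e.injective h)), ?_⟩
          rw [mem_joinEdges, mem_joinEdges]
          rcases hab.2 with h | h
          · exact Or.inl (Or.inl ⟨a, b, rfl, rfl, h⟩)
          · exact Or.inr (Or.inl ⟨b, a, rfl, rfl, h⟩) }
    exact hr.map φ

theorem joinEdges_injective (e : κ₁ ⊕ κ₂ ≃ V) :
    Function.Injective fun p : Finset (κ₁ × κ₁) × Finset (κ₂ × κ₂) => joinEdges e p.1 p.2 := by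
  rintro ⟨E₁, E₂⟩ ⟨E₁', E₂'⟩ h
  simp only at h
  have h1 : E₁ = E₁' := by
    ext ⟨r, s⟩
    have := Finset.ext_iff.mp h (e (Sum.inl r), e (Sum.inl s))
    simpa [mem_joinEdges] using this
  have h2 : E₂ = E₂' := by
    ext ⟨r, s⟩
    have := Finset.ext_iff.mp h (e (Sum.inr r), e (Sum.inr s))
    simpa [mem_joinEdges] using this
  rw [h1, h2]

/-- If the first group is exactly the component of `v`, no edge can leave it, and the edge set is
determined by its restrictions to the two groups. -/
theorem exists_joinEdges (e : κ₁ ⊕ κ₂ ≃ V) (v : κ₁) (E : Finset (V × V))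
    (h : ∀ u, (edgeGraph E).Reachable (e (Sum.inl v)) u ↔ ∃ r, u = e (Sum.inl r)) :
    ∃ E₁ E₂, E = joinEdges e E₁ E₂ := by
  have hmix : ∀ a b, ((e a, e b) ∈ E → (a.isLeft ↔ b.isLeft)) := by
    intro a b hab
    by_cases hne : a = b
    · rw [hne]
    have hadj : (edgeGraph E).Adj (e a) (e b) :=
      edgeGraph_adj_of_mem hab fun h => hne (e.injective h)
    -- Lying in the first group means being reachable from `v`, a property shared by the two ends of
    -- an edge.
    have key : ∀ a : κ₁ ⊕ κ₂, a.isLeft ↔ (edgeGraph E).Reachable (e (Sum.inl v)) (e a) := by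
      intro a
      rw [h]
      cases a <;> simp
    rw [key, key]
    exact ⟨fun h => h.trans hadj.reachable, fun h => h.trans hadj.reachable.symm⟩
  refine ⟨E.preimage ((inlEmb e).prodMap (inlEmb e)) (Function.Embedding.injective _).injOn,
    E.preimage ((inrEmb e).prodMap (inrEmb e)) (Function.Embedding.injective _).injOn, ?_⟩
  ext ⟨a, b⟩
  obtain ⟨a, rfl⟩ := e.surjective a
  obtain ⟨b, rfl⟩ := e.surjective b
  rw [mem_joinEdges]
  have := hmix a b
  rcases a with a | a <;> rcases b with b | b <;> simp [inlEmb, inrEmb] at this ⊢ <;> assumption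

variable [Fintype V] [Fintype κ₁] [Fintype κ₂]
variable {𝓕 : Type*} [CommRing 𝓕] [Algebra ℝ 𝓕]

/-- The sum of all diagrams with vertices `V`. -/
def graphSum (ta tb : ℝ) (δ : (Fin N ⊕ Fin N →₀ ℕ) → 𝓕) (V : Type) [Fintype V] : 𝓕⟦X⟧ :=
  ∑ E : Finset (V × V), graphWeight ta tb δ E

open Classical in
/-- The sum of all connected diagrams with vertices `V`. -/
def connectedSum (ta tb : ℝ) (δ : (Fin N ⊕ Fin N →₀ ℕ) → 𝓕) (V : Type) [Fintype V] : 𝓕⟦X⟧ :=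
  ∑ E : Finset (V × V) with (edgeGraph E).Connected, graphWeight ta tb δ E

theorem graphSum_equiv (ta tb : ℝ) (δ : (Fin N ⊕ Fin N →₀ ℕ) → 𝓕) (e : κ₁ ≃ V) :
    graphSum ta tb δ κ₁ = graphSum ta tb δ V := by
  refine Fintype.sum_equiv (e.prodCongr e).finsetCongr _ _ fun E => ?_
  rw [← graphWeight_map ta tb δ e]
  rfl

theorem connectedSum_equiv (ta tb : ℝ) (δ : (Fin N ⊕ Fin N →₀ ℕ) → 𝓕) (e : κ₁ ≃ V) :
    connectedSum ta tb δ κ₁ = connectedSum ta tb δ V := by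
  classical
  rw [connectedSum, connectedSum, Finset.sum_filter, Finset.sum_filter]
  refine Fintype.sum_equiv (e.prodCongr e).finsetCongr _ _ fun E => ?_
  have h1 := graphWeight_map ta tb δ e E
  have h2 : (edgeGraph E).Connected ↔ (edgeGraph ((e.prodCongr e).finsetCongr E)).Connected := by
    refine SimpleGraph.Iso.connected_iff ⟨e, ?_⟩
    intro a b
    simp [SimpleGraph.fromRel_adj, Equiv.finsetCongr_apply]
  by_cases hE : (edgeGraph E).Connected
  · rw [if_pos hE, if_pos (h2.mp hE), ← h1]; rfl
  · rw [if_neg hE, if_neg fun h => hE (h2.mpr h)]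

open Classical in
-- Edge sets whose component of `v` is the first group correspond to pairs: a connected set on that
-- group and an arbitrary set on the complement.
theorem sum_component_eq (ta tb : ℝ) (δ : (Fin N ⊕ Fin N →₀ ℕ) → 𝓕) (e : κ₁ ⊕ κ₂ ≃ V)
    (v : κ₁) :
    ∑ E : Finset (V × V) with
      (∀ u, (edgeGraph E).Reachable (e (Sum.inl v)) u ↔ ∃ r, u = e (Sum.inl r)),
        graphWeight ta tb δ E = connectedSum ta tb δ κ₁ * graphSum ta tb δ κ₂ := by
  rw [connectedSum, graphSum, Finset.sum_mul_sum, ← Finset.sum_product']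
  symm
  have hreach : ∀ (E₁ : Finset (κ₁ × κ₁)) (E₂ : Finset (κ₂ × κ₂)),
      (∀ u, (edgeGraph (joinEdges e E₁ E₂)).Reachable (e (Sum.inl v)) u ↔
        ∃ r, u = e (Sum.inl r)) ↔ (edgeGraph E₁).Connected := by
    intro E₁ E₂
    simp only [reachable_join]
    constructor
    · intro h
      rw [SimpleGraph.connected_iff_exists_forall_reachable]
      refine ⟨v, fun r => ?_⟩
      obtain ⟨r', h1, h2⟩ := (h (e (Sum.inl r))).mpr ⟨r, rfl⟩
      rw [Sum.inl_injective (e.injective h1)]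
      exact h2
    · intro h u
      exact ⟨fun ⟨r, h1, _⟩ => ⟨r, h1⟩, fun ⟨r, h1⟩ => ⟨r, h1, h.preconnected v r⟩⟩
  refine Finset.sum_bij (fun p _ => joinEdges e p.1 p.2) ?_ ?_ ?_ ?_
  · rintro ⟨E₁, E₂⟩ h
    simp only [Finset.mem_product, Finset.mem_filter, Finset.mem_univ, true_and, and_true] at h ⊢
    exact (hreach E₁ E₂).mpr h
  · intro p _ p' _ h
    exact joinEdges_injective e h
  · intro E hE
    rw [Finset.mem_filter] at hE
    obtain ⟨E₁, E₂, rfl⟩ := exists_joinEdges e v E hE.2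
    refine ⟨(E₁, E₂), ?_, rfl⟩
    simp only [Finset.mem_product, Finset.mem_filter, Finset.mem_univ, true_and, and_true]
    exact (hreach E₁ E₂).mp hE.2
  · rintro ⟨E₁, E₂⟩ _
    exact (graphWeight_join ta tb δ e E₁ E₂).symm

open Classical in
-- The edge sets are sorted by the component `B` of the vertex `v`.
theorem graphSum_eq_sum_component (ta tb : ℝ) (δ : (Fin N ⊕ Fin N →₀ ℕ) → 𝓕) (v : V) :
    graphSum ta tb δ V = ∑ B : Finset V with v ∈ B,
      connectedSum ta tb δ {x // x ∈ B} * graphSum ta tb δ {x // x ∉ B} := by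
  have hmaps : ∀ E ∈ (Finset.univ : Finset (Finset (V × V))),
      (Finset.univ.filter fun u => (edgeGraph E).Reachable v u) ∈
        (Finset.univ.filter fun B : Finset V => v ∈ B) := by
    intro E _
    simp
  rw [graphSum, ← Finset.sum_fiberwise_of_maps_to hmaps]
  refine Finset.sum_congr rfl fun B hB => ?_
  rw [Finset.mem_filter] at hB
  rw [← sum_component_eq ta tb δ (Equiv.sumCompl fun x => x ∈ B) ⟨v, hB.2⟩]
  refine Finset.sum_congr (Finset.filter_congr fun E _ => ?_) fun _ _ => rfl
  rw [Finset.ext_iff]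
  refine forall_congr' fun u => ?_
  simp

/-- The linked cluster expansion. -/
theorem graphSum_succ (ta tb : ℝ) (δ : (Fin N ⊕ Fin N →₀ ℕ) → 𝓕) (n : ℕ) :
    graphSum ta tb δ (Fin (n + 1)) = ∑ k ∈ Finset.range (n + 1),
      n.choose k • (connectedSum ta tb δ (Fin (k + 1)) * graphSum ta tb δ (Fin (n - k))) := by
  classical
  rw [graphSum_eq_sum_component ta tb δ (0 : Fin (n + 1))]
  have hB : ∀ (B : Finset (Fin (n + 1))) (_ : Fintype {x // x ∈ B}) (_ : Fintype {x // x ∉ B}),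
      connectedSum ta tb δ {x // x ∈ B} * graphSum ta tb δ {x // x ∉ B} =
        connectedSum ta tb δ (Fin B.card) * graphSum ta tb δ (Fin (n + 1 - B.card)) := by
    intro B _ _
    rw [connectedSum_equiv ta tb δ (Fintype.equivFinOfCardEq
        (Fintype.card_of_subtype B fun _ => Iff.rfl)),
      graphSum_equiv ta tb δ (Fintype.equivFinOfCardEq (n := n + 1 - B.card) (by
        rw [Fintype.card_of_subtype Bᶜ fun x => by simp, Finset.card_compl, Fintype.card_fin]))]
  simp only [hB]
  -- A component that contains 0 is `insert 0 A`, with `A` a subset of the remaining n vertices;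
  -- this is the source of the binomial coefficient.
  have hfil : ∀ _ : DecidablePred fun B : Finset (Fin (n + 1)) => (0 : Fin (n + 1)) ∈ B,
      (Finset.univ.filter fun B : Finset (Fin (n + 1)) => (0 : Fin (n + 1)) ∈ B) =
      ((Finset.univ.erase (0 : Fin (n + 1))).powerset).image (insert 0) := by
    intro _
    ext B
    simp only [Finset.mem_filter, Finset.mem_univ, true_and, Finset.mem_image,
      Finset.mem_powerset]
    constructor
    · intro h
      exact ⟨B.erase 0, Finset.erase_subset_erase _ (Finset.subset_univ _), Finset.insert_erase h⟩
    · rintro ⟨A, -, rfl⟩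
      exact Finset.mem_insert_self _ _
  have hnot : ∀ A ∈ (Finset.univ.erase (0 : Fin (n + 1))).powerset, (0 : Fin (n + 1)) ∉ A :=
    fun A hA h0 => Finset.notMem_erase _ _ (Finset.mem_powerset.mp hA h0)
  rw [hfil, Finset.sum_image]
  · rw [Finset.sum_congr rfl fun A hA => by rw [Finset.card_insert_of_notMem (hnot A hA)],
      Finset.sum_powerset_apply_card fun k =>
        connectedSum ta tb δ (Fin (k + 1)) * graphSum ta tb δ (Fin (n + 1 - (k + 1)))]
    rw [Finset.card_erase_of_mem (Finset.mem_univ _), Finset.card_univ, Fintype.card_fin]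
    refine Finset.sum_congr (by simp) fun k _ => ?_
    rw [show n + 1 - (k + 1) = n - k by omega, Nat.add_sub_cancel]
  · intro A hA A' hA' h
    rw [← Finset.erase_insert (hnot A hA), h, Finset.erase_insert (hnot A' hA')]

end Cluster

/-! ### Star powers as time-ordered contractions. -/

section Star

open PowerSeries

variable {N n : ℕ} {𝓕 : Type*} [CommRing 𝓕] [Algebra ℝ 𝓕]

/-- The term `(∂/∂p · ∂/∂q)^j` of the star product. -/
def starTerm (D : CommDer (Fin N ⊕ Fin N) 𝓕) : ℕ → 𝓕 → 𝓕 → 𝓕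
  | 0, f, U => f * U
  | j + 1, f, U => ∑ k, starTerm D j (D.d (Sum.inl k) f) (D.d (Sum.inr k) U)

/-- The star product, with formal parameter `X` in place of `iħ`. -/
def starMul (D : CommDer (Fin N ⊕ Fin N) 𝓕) (f : 𝓕) (U : 𝓕⟦X⟧) : 𝓕⟦X⟧ :=
  PowerSeries.mk fun n => ∑ p ∈ Finset.HasAntidiagonal.antidiagonal n,
    ((p.1.factorial : ℝ)⁻¹) • starTerm D p.1 f (coeff p.2 U)

/-- The star powers, with formal parameter `X` in place of `iħ`. -/
def starPower (D : CommDer (Fin N ⊕ Fin N) 𝓕) (f : 𝓕) : ℕ → 𝓕⟦X⟧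
  | 0 => 1
  | n + 1 => starMul D f (starPower D f n)

theorem starTerm_smul (D : CommDer (Fin N ⊕ Fin N) 𝓕) (c : ℝ) (j : ℕ) (f U : 𝓕) :
    starTerm D j f (c • U) = c • starTerm D j f U := by
  induction j generalizing f U with
  | zero => simp [starTerm]
  | succ j ih => simp [starTerm, ih, Finset.smul_sum]

theorem starTerm_smul_left (D : CommDer (Fin N ⊕ Fin N) 𝓕) (c : ℝ) (j : ℕ) (f U : 𝓕) :
    starTerm D j (c • f) U = c • starTerm D j f U := by
  induction j generalizing f U with
  | zero => simp [starTerm]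
  | succ j ih => simp [starTerm, ih, Finset.smul_sum]

theorem starPower_smul (D : CommDer (Fin N ⊕ Fin N) 𝓕) (c : ℝ) (f : 𝓕) (n : ℕ) :
    starPower D (c • f) n = c ^ n • starPower D f n := by
  induction n with
  | zero => simp [starPower]
  | succ n ih =>
    ext k
    rw [starPower, ih, starPower, coeff_smul, starMul, starMul, coeff_mk, coeff_mk,
      Finset.smul_sum]
    refine Finset.sum_congr rfl fun p _ => ?_
    rw [coeff_smul, starTerm_smul, starTerm_smul_left, smul_smul, smul_smul, smul_smul]
    congr 1
    ring

/-- The exponent `∑ θ(t_r - t_s) c_{rs}`. -/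
def timeEdges (N : ℕ) {V : Type} [Fintype V] (t : V → ℝ) : MvPolynomial (V × (Fin N ⊕ Fin N)) ℝ :=
  ∑ r, ∑ s, heaviside (t r - t s) • edge N r s

/-- The vertices of `Fin (n + 1)` as the successors together with zero. -/
def succEquiv (n : ℕ) : Fin n ⊕ Unit ≃ Fin (n + 1) :=
  (Equiv.optionEquivSumPUnit (Fin n)).symm.trans (finSuccEquiv n).symm

theorem succEquiv_inl (n : ℕ) : ⇑(succEquiv n) ∘ Sum.inl = Fin.succ := by
  ext r; simp [succEquiv]

/-- Vertex 0 carries `g` and the others carry `f`. Each factor of the power puts ∂/∂p_i on `g` and,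
by the Leibniz rule `CommDer.d_ev`, ∂/∂q^i on the product of all the others, which is the recursion
that defines `starTerm`. -/
theorem ev_starTerm (D : CommDer (Fin N ⊕ Fin N) 𝓕) (f g : 𝓕) (j : ℕ)
    (Q : MvPolynomial (Fin n × (Fin N ⊕ Fin N)) ℝ) :
    ev (fun r => D.jet ((Fin.cons g fun _ => f : Fin (n + 1) → 𝓕) r))
      (MvPolynomial.rename (Prod.map Fin.succ id) Q *
        (∑ i : Fin N, MvPolynomial.X (0, Sum.inl i) *
          ∑ r : Fin n, MvPolynomial.X (r.succ, Sum.inr i)) ^ j) =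
      starTerm D j g (ev (fun _ => D.jet f) Q) := by
  induction j generalizing g Q with
  | zero =>
    have h := ev_rename_mul (fun r => D.jet ((Fin.cons g fun _ => f : Fin (n + 1) → 𝓕) r))
      (succEquiv n) Q 1
    rw [succEquiv_inl] at h
    rw [pow_zero, starTerm, ← map_one (MvPolynomial.rename (R := ℝ)
      (Prod.map (succEquiv n ∘ Sum.inr) (id : Fin N ⊕ Fin N → _))), h, mul_comm]
    congr 1
    rw [ev_one]; simp [succEquiv]
  | succ j ih =>
    rw [starTerm, pow_succ', ← mul_assoc, mul_comm (MvPolynomial.rename _ Q), mul_assoc,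
      Finset.sum_mul, map_sum]
    refine Finset.sum_congr rfl fun i _ => ?_
    have hren : (∑ r : Fin n, MvPolynomial.X (r.succ, Sum.inr i)) =
        MvPolynomial.rename (R := ℝ) (Prod.map Fin.succ (id : Fin N ⊕ Fin N → _))
          (∑ r : Fin n, MvPolynomial.X (r, Sum.inr i)) := by simp
    rw [mul_assoc, ev_X_mul, ← mul_assoc, hren, ← map_mul, D.d_ev, ← ih]
    congr 1
    congr 1
    funext r m
    refine Fin.cases ?_ (fun r => ?_) r
    · simp [CommDer.jet_single_add, CommDer.d_jet]
    · simp [Function.update]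

/-- An edge from `r` to `s` needs t_r > t_s. The earliest vertex 0 therefore only receives edges,
one from each other vertex, and hence only momentum derivatives. -/
theorem timeEdges_succ (t : Fin (n + 1) → ℝ) (ht : StrictMono t) :
    timeEdges N t = MvPolynomial.rename (Prod.map Fin.succ id) (timeEdges N (t ∘ Fin.succ)) +
      ∑ i : Fin N, MvPolynomial.X (0, Sum.inl i) *
          ∑ r : Fin n, MvPolynomial.X (r.succ, Sum.inr i) := by
  have h0 : ∀ s, heaviside (t 0 - t s) = 0 := fun s => by
    rw [heaviside, if_neg]
    have := ht.monotone (Fin.zero_le s)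
    linarith
  have h1 : ∀ r : Fin n, heaviside (t r.succ - t 0) = 1 := fun r => by
    rw [heaviside, if_pos]
    have := ht (Fin.succ_pos r)
    linarith
  simp only [timeEdges, Fin.sum_univ_succ, h0, h1, zero_smul, Finset.sum_const_zero, one_smul,
    zero_add, map_sum, map_smul, rename_edge, Finset.sum_add_distrib, Function.comp]
  refine (add_comm _ _).trans ?_
  congr 1
  simp only [edge, Finset.mul_sum]
  rw [Finset.sum_comm]
  simp only [mul_comm]

/-- By `timeEdges_succ` the exponential factors; the edges into vertex 0 produce one more star
multiplication from the left. -/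
theorem mapLin_ev_expX_of_strictMono (D : CommDer (Fin N ⊕ Fin N) 𝓕) (f : 𝓕) (t : Fin n → ℝ)
    (ht : StrictMono t) :
    mapLin (ev fun _ => D.jet f) (expX (timeEdges N t)) = starPower D f n := by
  induction n with
  | zero =>
    have : timeEdges N t = 0 := by simp [timeEdges]
    rw [this, expX_zero]
    ext k
    rw [coeff_mapLin, starPower, coeff_one, coeff_one]
    split_ifs
    · rw [ev_one]; simp
    · simp
  | succ n ih =>
    rw [timeEdges_succ t ht, expX_add, starPower]
    ext k
    rw [coeff_mapLin, coeff_mul, map_sum, starMul, coeff_mk, ← Finset.Nat.sum_antidiagonal_swap]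
    refine Finset.sum_congr rfl fun p _ => ?_
    rw [← ih (t ∘ Fin.succ) fun a b h => ht (Fin.succ_lt_succ_iff.mpr h), coeff_mapLin,
      ← ev_starTerm, ← map_smul]
    simp only [Prod.fst_swap, Prod.snd_swap, coeff_expX, map_smul, map_pow]
    rw [mul_smul_comm]
    simp only [map_smul]
    congr 2
    congr 1
    funext r
    refine Fin.cases ?_ (fun r => ?_) r <;> simp

/-- All factors are equal, so the times may be sorted. -/
theorem mapLin_ev_expX_of_injective (D : CommDer (Fin N ⊕ Fin N) 𝓕) (f : 𝓕) (t : Fin n → ℝ)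
    (ht : Function.Injective t) :
    mapLin (ev fun _ => D.jet f) (expX (timeEdges N t)) = starPower D f n := by
  have hs : StrictMono (t ∘ Tuple.sort t) :=
    (Tuple.monotone_sort t).strictMono_of_injective (ht.comp (Equiv.injective _))
  rw [← mapLin_ev_expX_of_strictMono D f _ hs]
  have h : timeEdges N t =
      MvPolynomial.rename (Prod.map (Tuple.sort t) id) (timeEdges N (t ∘ Tuple.sort t)) := by
    simp only [timeEdges, map_sum, map_smul, rename_edge, Function.comp]
    rw [← Equiv.sum_comp (Tuple.sort t)]
    refine Finset.sum_congr rfl fun r _ => ?_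
    rw [← Equiv.sum_comp (Tuple.sort t)]
  rw [h, ← renameSeries_expX, mapLin_ev_rename]

/-- Since θ is 0 or 1, exp(θc) = 1 + θ(exp c - 1); expanding the product over all pairs gives a sum
over sets of edges. -/
theorem expX_timeEdges {V : Type} [Fintype V] (t : V → ℝ) :
    expX (timeEdges N t) = ∑ E : Finset (V × V),
      (∏ e ∈ E, heaviside (t e.1 - t e.2)) • mayer N E := by
  classical
  have h1 : timeEdges N t = ∑ e : V × V, heaviside (t e.1 - t e.2) • edge N e.1 e.2 := by
    rw [timeEdges, Fintype.sum_prod_type]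
  have h2 : ∀ e : V × V, expX (heaviside (t e.1 - t e.2) • edge N e.1 e.2) =
      1 + heaviside (t e.1 - t e.2) • (expX (edge N e.1 e.2) - 1) := by
    intro e
    rw [heaviside]
    split_ifs <;> simp [expX_zero]
  rw [h1, expX_sum, Finset.prod_congr rfl fun e _ => h2 e, Finset.prod_one_add,
    Finset.powerset_univ]
  refine Finset.sum_congr rfl fun E _ => ?_
  rw [Finset.prod_smul, mayer]

end Star

/-! ### Lowest coefficients of products of power series. -/

section LeadingCoefficients

open PowerSeries

variable {R : Type*} [CommRing R]

theorem coeff_zero_mul_eq (F G : R⟦X⟧) : coeff 0 (F * G) = coeff 0 F * coeff 0 G := by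
  simp

theorem coeff_add_mul_of_dvd {F G : R⟦X⟧} {a b : ℕ} (hF : X ^ a ∣ F) (hG : X ^ b ∣ G) :
    coeff (a + b) (F * G) = coeff a F * coeff b G := by
  obtain ⟨F, rfl⟩ := hF
  obtain ⟨G, rfl⟩ := hG
  have h : X ^ a * F * (X ^ b * G) = X ^ (a + b) * (F * G) := by ring
  rw [h]
  have key : ∀ (k : ℕ) (H : R⟦X⟧), coeff k (X ^ k * H) = constantCoeff H := by
    intro k H
    simpa using coeff_X_pow_mul H k 0
  rw [key, key, key, map_mul]

theorem X_pow_card_dvd_prod {σ : Type*} (s : Finset σ) (F : σ → R⟦X⟧) (h : ∀ i, X ∣ F i) :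
    X ^ s.card ∣ ∏ i ∈ s, F i := by
  rw [← Finset.prod_const]
  exact Finset.prod_dvd_prod_of_dvd _ _ fun i _ => h i

theorem coeff_card_prod {σ : Type*} (s : Finset σ) (F : σ → R⟦X⟧) (h : ∀ i, X ∣ F i) :
    coeff s.card (∏ i ∈ s, F i) = ∏ i ∈ s, coeff 1 (F i) := by
  classical
  induction s using Finset.induction_on with
  | empty => simp
  | insert a s ha ih =>
    rw [Finset.prod_insert ha, Finset.prod_insert ha, Finset.card_insert_of_notMem ha, add_comm,
      coeff_add_mul_of_dvd (by simpa using h a) (X_pow_card_dvd_prod s F h), ih]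

end LeadingCoefficients

/-! ### Connected diagrams of lowest order are trees. -/

section Trees

open PowerSeries

variable {N n : ℕ} {V : Type}

theorem X_pow_card_dvd_mayer (E : Finset (V × V)) : X ^ E.card ∣ mayer N E :=
  X_pow_card_dvd_prod _ _ fun _ => X_dvd_expX_sub_one _

/-- In lowest order each Mayer factor contributes its linear term, that is, one contraction. -/
theorem coeff_card_mayer (E : Finset (V × V)) :
    coeff E.card (mayer N E) = ∏ e ∈ E, edge N e.1 e.2 := by
  rw [mayer, coeff_card_prod _ _ fun _ => X_dvd_expX_sub_one _]
  refine Finset.prod_congr rfl fun e _ => ?_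
  rw [map_sub, coeff_expX, coeff_one]
  simp

/-- Loops and opposite pairs of directed edges only diminish the number of undirected edges. -/
theorem card_edgeSet_le (E : Finset (V × V)) : Nat.card (edgeGraph E).edgeSet ≤ E.card := by
  classical
  have hsub : (edgeGraph E).edgeSet ⊆ ↑(E.image fun p => s(p.1, p.2)) := by
    intro x
    induction x using Sym2.ind with
    | _ a b =>
      intro h
      rw [SimpleGraph.mem_edgeSet, SimpleGraph.fromRel_adj] at h
      rw [Finset.mem_coe, Finset.mem_image]
      rcases h.2 with h | h
      · exact ⟨_, h, rfl⟩
      · exact ⟨_, h, Sym2.eq_swap⟩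
  calc Nat.card (edgeGraph E).edgeSet ≤ Nat.card (↑(E.image fun p => s(p.1, p.2)) : Set (Sym2 V)) :=
        Nat.card_mono (Finset.finite_toSet _) hsub
    _ ≤ E.card := by
        rw [Nat.card_coe_set_eq, Set.ncard_coe_finset]
        exact Finset.card_image_le

theorem card_le_of_connected {E : Finset (Fin n × Fin n)} (h : (edgeGraph E).Connected) :
    n ≤ E.card + 1 := by
  have h1 := h.card_vert_le_card_edgeSet_add_one
  rw [Nat.card_fin] at h1
  exact h1.trans (Nat.add_le_add_right (card_edgeSet_le E) 1)

/-- A connected graph on n vertices has at least n - 1 edges, so n - 1 directed edges force the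
underlying graph to be a tree. -/
theorem mem_orientedTrees {E : Finset (Fin n × Fin n)} :
    E ∈ orientedTrees n ↔ (edgeGraph E).Connected ∧ E.card + 1 = n := by
  classical
  rw [orientedTrees, Finset.mem_filter, SimpleGraph.isTree_iff_connected_and_card, Nat.card_fin]
  constructor
  · rintro ⟨-, ⟨h1, -⟩, h2⟩
    exact ⟨h1, h2⟩
  · rintro ⟨h1, h2⟩
    refine ⟨Finset.mem_univ _, ⟨h1, ?_⟩, h2⟩
    have h3 := h1.card_vert_le_card_edgeSet_add_one
    rw [Nat.card_fin] at h3
    have h4 : Nat.card (SimpleGraph.fromRel fun r s => (r, s) ∈ E).edgeSet ≤ E.card :=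
      card_edgeSet_le E
    exact le_antisymm (by omega) h3

variable [Fintype V] {𝓕 : Type*} [CommRing 𝓕] [Algebra ℝ 𝓕]

theorem X_pow_dvd_graphWeight (ta tb : ℝ) (δ : (Fin N ⊕ Fin N →₀ ℕ) → 𝓕) (E : Finset (V × V))
    {k : ℕ} (hk : k ≤ E.card) : X ^ k ∣ graphWeight ta tb δ E := by
  rw [X_pow_dvd_iff]
  intro m hm
  rw [graphWeight, coeff_smul, coeff_mapLin,
    X_pow_dvd_iff.mp (X_pow_card_dvd_mayer E) m (hm.trans_le hk), map_zero, smul_zero]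

/-- Connectedness of n + 1 vertices needs n edges, each of which carries a power of the formal
variable. -/
theorem X_pow_dvd_connectedSum (ta tb : ℝ) (δ : (Fin N ⊕ Fin N →₀ ℕ) → 𝓕) (n : ℕ) :
    X ^ n ∣ connectedSum ta tb δ (Fin (n + 1)) := by
  classical
  rw [connectedSum]
  refine Finset.dvd_sum fun E hE => ?_
  have h : (edgeGraph E).Connected := by simpa using hE
  have := card_le_of_connected h
  exact X_pow_dvd_graphWeight ta tb δ E (by omega)

/-- A connected edge set that is not an oriented tree has more than n edges and starts at a higher
order. -/
theorem coeff_connectedSum (ta tb : ℝ) (δ : (Fin N ⊕ Fin N →₀ ℕ) → 𝓕) (n : ℕ) :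
    coeff n (connectedSum ta tb δ (Fin (n + 1))) = ∑ E ∈ orientedTrees (n + 1),
      timeWeight ta tb E • ev (fun _ => δ) (∏ e ∈ E, edge N e.1 e.2) := by
  classical
  rw [connectedSum, map_sum]
  symm
  refine Finset.sum_subset_zero_on_sdiff ?_ ?_ ?_
  · intro E hE
    have h := (mem_orientedTrees.mp hE).1
    simpa using h
  · intro E hE
    rw [Finset.mem_sdiff, mem_orientedTrees] at hE
    have h0 : (edgeGraph E).Connected := by simpa using hE.1
    have h1 := card_le_of_connected h0
    have h2 : E.card + 1 ≠ n + 1 := fun h => hE.2 ⟨h0, h⟩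
    exact X_pow_dvd_iff.mp (X_pow_dvd_graphWeight ta tb δ E (k := n + 1) (by omega)) n (by omega)
  · intro E hE
    have h : n = E.card := by
      have := (mem_orientedTrees.mp hE).2
      omega
    have hc := coeff_card_mayer (N := N) E
    rw [← h] at hc
    rw [graphWeight, coeff_smul, coeff_mapLin, hc]

end Trees

/-! ### Hamilton-Jacobi equation from the star recursion; the outer variable counts vertices, the
inner one replaces iħ. -/

section HamiltonJacobi

open PowerSeries

variable {N : ℕ} {𝓕 : Type*} [CommRing 𝓕] [Algebra ℝ 𝓕]

/-- A derivation applied to the coefficients of a power series. -/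
def mapDer (δ : Derivation ℝ 𝓕 𝓕) : Derivation ℝ 𝓕⟦X⟧ 𝓕⟦X⟧ :=
  Derivation.mk' (mapLin δ.toLinearMap) fun F G => by
    ext n
    simp only [coeff_mapLin, coeff_mul, map_sum, map_add, smul_eq_mul, Derivation.coeFn_coe,
      Derivation.leibniz, Finset.sum_add_distrib]
    congr 1
    rw [← Finset.Nat.sum_antidiagonal_swap]
    rfl

@[simp] theorem coeff_mapDer (δ : Derivation ℝ 𝓕 𝓕) (F : 𝓕⟦X⟧) (n : ℕ) :
    coeff n (mapDer δ F) = δ (coeff n F) := by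
  change coeff n (mapLin δ.toLinearMap F) = _
  simp

/-- The homogeneous terms (times factorials) of the Taylor expansion in the momenta, with
increments `c`. -/
def taylorTerm (D : CommDer (Fin N ⊕ Fin N) 𝓕) {𝓑 : Type*} [CommRing 𝓑] (φ : 𝓕 → 𝓑)
    (c : Fin N → 𝓑) : ℕ → 𝓕 → 𝓑
  | 0, f => φ f
  | j + 1, f => ∑ k, c k * taylorTerm D φ c j (D.d (Sum.inl k) f)

/-- The position derivatives on double series. -/
def dq (D : CommDer (Fin N ⊕ Fin N) 𝓕) (k : Fin N) : Derivation ℝ 𝓕⟦X⟧⟦X⟧ 𝓕⟦X⟧⟦X⟧ :=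
  mapDer (mapDer (D.d (Sum.inr k)))

/-- `∂/∂q^k` conjugated by the exponential of `W`, multiplied by the formal parameter. -/
def conjDq (D : CommDer (Fin N ⊕ Fin N) 𝓕) (W : 𝓕⟦X⟧⟦X⟧) (k : Fin N) (Y : 𝓕⟦X⟧⟦X⟧) : 𝓕⟦X⟧⟦X⟧ :=
  C X * (dq D k Y + dq D k W * Y)

/-- `starTerm` on double series. -/
def starTermSeries (D : CommDer (Fin N ⊕ Fin N) 𝓕) : ℕ → 𝓕 → 𝓕⟦X⟧⟦X⟧ → 𝓕⟦X⟧⟦X⟧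
  | 0, f, Y => C (C f) * Y
  | j + 1, f, Y => ∑ k, starTermSeries D j (D.d (Sum.inl k) f) (dq D k Y)

/-- `starTerm` conjugated by the exponential of `W`. -/
def conjStarTerm (D : CommDer (Fin N ⊕ Fin N) 𝓕) (W : 𝓕⟦X⟧⟦X⟧) :
    ℕ → 𝓕 → 𝓕⟦X⟧⟦X⟧ → 𝓕⟦X⟧⟦X⟧
  | 0, f, Y => C (C f) * Y
  | j + 1, f, Y => ∑ k, conjStarTerm D W j (D.d (Sum.inl k) f) (conjDq D W k Y)

theorem coeff_starTermSeries (D : CommDer (Fin N ⊕ Fin N) 𝓕) (j : ℕ) (f : 𝓕) (Y : 𝓕⟦X⟧⟦X⟧)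
    (b n : ℕ) :
    coeff b (coeff n (starTermSeries D j f Y)) = starTerm D j f (coeff b (coeff n Y)) := by
  induction j generalizing f Y with
  | zero => simp [starTermSeries, starTerm]
  | succ j ih => simp [starTermSeries, starTerm, ih, dq]

theorem dq_C_X_mul (D : CommDer (Fin N ⊕ Fin N) 𝓕) (k : Fin N) (Y : 𝓕⟦X⟧⟦X⟧) :
    dq D k (C X * Y) = C X * dq D k Y := by
  ext n b
  rw [dq, coeff_mapDer, coeff_C_mul, coeff_C_mul, coeff_mapDer, coeff_mapDer]
  rcases b with _ | b
  · rw [coeff_zero_X_mul, coeff_zero_X_mul, map_zero]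
  · rw [coeff_succ_X_mul, coeff_succ_X_mul, coeff_mapDer]

theorem starTermSeries_C_X_mul (D : CommDer (Fin N ⊕ Fin N) 𝓕) (j : ℕ) (f : 𝓕)
    (Y : 𝓕⟦X⟧⟦X⟧) :
    starTermSeries D j f (C X * Y) = C X * starTermSeries D j f Y := by
  induction j generalizing f Y with
  | zero => simp only [starTermSeries]; ring
  | succ j ih => simp only [starTermSeries, dq_C_X_mul, ih, Finset.mul_sum]

/-- If ∂Z = ∂W·Z, then conjugation by Z replaces X∂ by X∂ + X∂W. Each of the j position derivatives
of a star term absorbs one of the j powers of X. -/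
theorem starTermSeries_mul (D : CommDer (Fin N ⊕ Fin N) 𝓕) {W Z : 𝓕⟦X⟧⟦X⟧}
    (hZ : ∀ k, dq D k Z = dq D k W * Z) (j : ℕ) (f : 𝓕) (Y : 𝓕⟦X⟧⟦X⟧) :
    C X ^ j * starTermSeries D j f (Z * Y) = Z * conjStarTerm D W j f Y := by
  induction j generalizing f Y with
  | zero => simp only [starTermSeries, conjStarTerm]; ring
  | succ j ih =>
    simp only [starTermSeries, conjStarTerm, Finset.mul_sum]
    refine Finset.sum_congr rfl fun k _ => ?_
    rw [← ih, pow_succ, mul_assoc, ← starTermSeries_C_X_mul]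
    congr 2
    rw [conjDq, Derivation.leibniz, hZ, smul_eq_mul, smul_eq_mul]
    ring

/-- `Y` is divisible by the `n`-th power of the inner variable in degree `n` of the outer one,
and `y` collects the quotients at zero. -/
def HasLeading (Y : 𝓕⟦X⟧⟦X⟧) (y : 𝓕⟦X⟧) : Prop :=
  ∀ n, X ^ n ∣ coeff n Y ∧ coeff n (coeff n Y) = coeff n y

theorem HasLeading.add {Y Y' : 𝓕⟦X⟧⟦X⟧} {y y' : 𝓕⟦X⟧} (h : HasLeading Y y)
    (h' : HasLeading Y' y') : HasLeading (Y + Y') (y + y') := fun n => by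
  simp only [map_add]
  exact ⟨dvd_add (h n).1 (h' n).1, by rw [(h n).2, (h' n).2]⟩

theorem HasLeading.sum {σ : Type*} (s : Finset σ) {Y : σ → 𝓕⟦X⟧⟦X⟧} {y : σ → 𝓕⟦X⟧}
    (h : ∀ i ∈ s, HasLeading (Y i) (y i)) : HasLeading (∑ i ∈ s, Y i) (∑ i ∈ s, y i) := fun n => by
  simp only [map_sum]
  exact ⟨Finset.dvd_sum fun i hi => (h i hi n).1, Finset.sum_congr rfl fun i hi => (h i hi n).2⟩

theorem HasLeading.smul (c : ℝ) {Y : 𝓕⟦X⟧⟦X⟧} {y : 𝓕⟦X⟧} (h : HasLeading Y y) :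
    HasLeading (c • Y) (c • y) := fun n => by
  simp only [coeff_smul]
  exact ⟨dvd_smul_of_dvd c (h n).1, by rw [(h n).2]⟩

theorem HasLeading.mul {Y Y' : 𝓕⟦X⟧⟦X⟧} {y y' : 𝓕⟦X⟧} (h : HasLeading Y y)
    (h' : HasLeading Y' y') : HasLeading (Y * Y') (y * y') := fun n => by
  rw [coeff_mul, coeff_mul]
  constructor
  · refine Finset.dvd_sum fun p hp => ?_
    rw [Finset.HasAntidiagonal.mem_antidiagonal] at hp
    rw [← hp, pow_add]
    exact mul_dvd_mul (h _).1 (h' _).1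
  · rw [map_sum]
    refine Finset.sum_congr rfl fun p hp => ?_
    rw [Finset.HasAntidiagonal.mem_antidiagonal] at hp
    rw [← (h _).2, ← (h' _).2, ← coeff_add_mul_of_dvd (h _).1 (h' _).1, hp]

theorem hasLeading_C_C (f : 𝓕) : HasLeading (C (C f)) (C f) := fun n => by
  rcases n with _ | n <;> simp [coeff_C]

theorem X_pow_dvd_mapDer (δ : Derivation ℝ 𝓕 𝓕) {F : 𝓕⟦X⟧} {n : ℕ} (h : X ^ n ∣ F) :
    X ^ n ∣ mapDer δ F := by
  rw [X_pow_dvd_iff] at h ⊢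
  intro m hm
  rw [coeff_mapDer, h m hm, map_zero]

/-- The additional power of X is not compensated by a vertex, so this term does not contribute to
the leading order. -/
theorem HasLeading.C_X_mul_dq (D : CommDer (Fin N ⊕ Fin N) 𝓕) (k : Fin N) {Y : 𝓕⟦X⟧⟦X⟧} {y : 𝓕⟦X⟧}
    (h : HasLeading Y y) : HasLeading (C X * dq D k Y) 0 := fun n => by
  have h1 : X ^ (n + 1) ∣ coeff n (C X * dq D k Y) := by
    rw [coeff_C_mul, dq, coeff_mapDer, pow_succ']
    exact mul_dvd_mul_left _ (X_pow_dvd_mapDer _ (h n).1)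
  exact ⟨(pow_dvd_pow _ n.le_succ).trans h1, by
    rw [X_pow_dvd_iff.mp h1 n n.lt_succ_self, map_zero]⟩

/-- To leading order only the multiplication by X∂W survives in X∂ + X∂W; the star term becomes a
Taylor term in the momenta with increments ∂v. -/
theorem HasLeading.conjStarTerm (D : CommDer (Fin N ⊕ Fin N) 𝓕) {W : 𝓕⟦X⟧⟦X⟧} {v : 𝓕⟦X⟧}
    (hW : ∀ k, HasLeading (C X * dq D k W) (mapDer (D.d (Sum.inr k)) v)) (j : ℕ) (f : 𝓕)
    {Y : 𝓕⟦X⟧⟦X⟧} {y : 𝓕⟦X⟧} (h : HasLeading Y y) :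
    HasLeading (conjStarTerm D W j f Y)
      (taylorTerm D C (fun k => mapDer (D.d (Sum.inr k)) v) j f * y) := by
  induction j generalizing f Y y with
  | zero => exact (hasLeading_C_C f).mul h
  | succ j ih =>
    rw [BVBFV.conjStarTerm, taylorTerm, Finset.sum_mul]
    refine HasLeading.sum _ fun k _ => ?_
    have h1 := (h.C_X_mul_dq D k).add ((hW k).mul h)
    have h2 : C X * dq D k Y + C X * dq D k W * Y = conjDq D W k Y := by rw [conjDq]; ring
    rw [h2, zero_add] at h1
    convert ih (D.d (Sum.inl k) f) h1 using 1
    ring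

theorem coeff_coeff_C_X_pow_mul (j b n : ℕ) (Y : 𝓕⟦X⟧⟦X⟧) :
    coeff b (coeff n (C X ^ j * Y)) = if j ≤ b then coeff (b - j) (coeff n Y) else 0 := by
  rw [← map_pow, coeff_C_mul]
  exact coeff_X_pow_mul' _ _ _

/-- The exponential generating series. -/
def egf {R : Type*} [CommRing R] [Algebra ℝ R] (Z : ℕ → R) : R⟦X⟧ :=
  PowerSeries.mk fun n => ((n.factorial : ℝ)⁻¹) • Z n

theorem derivative_egf {R : Type*} [CommRing R] [Algebra ℝ R] (Z : ℕ → R) :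
    derivative R (egf Z) = egf fun n => Z (n + 1) := by
  ext n
  rw [coeff_derivative, egf, egf, coeff_mk, coeff_mk, Nat.factorial_succ, mul_comm,
    ← Nat.cast_succ, ← nsmul_eq_mul, ← Nat.cast_smul_eq_nsmul ℝ, smul_smul]
  congr 1
  have h1 := Nat.cast_ne_zero (R := ℝ).mpr n.factorial_ne_zero
  push_cast
  field_simp

theorem egf_mul {R : Type*} [CommRing R] [Algebra ℝ R] (Z W : ℕ → R) :
    egf W * egf Z = egf fun n => ∑ k ∈ Finset.range (n + 1), n.choose k • (W k * Z (n - k)) := by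
  ext n
  rw [coeff_mul, egf, egf, egf, coeff_mk,
    Finset.Nat.sum_antidiagonal_eq_sum_range_succ_mk, Finset.smul_sum]
  refine Finset.sum_congr rfl fun k hk => ?_
  have hk : k ≤ n := Nat.lt_succ_iff.mp (Finset.mem_range.mp hk)
  rw [coeff_mk, coeff_mk, smul_mul_smul_comm, ← Nat.cast_smul_eq_nsmul ℝ, smul_smul]
  congr 1
  rw [Nat.cast_choose ℝ hk]
  have h1 := Nat.cast_ne_zero (R := ℝ).mpr n.factorial_ne_zero
  field_simp

theorem derivative_mul_eq {R : Type*} [CommRing R] (F G : R⟦X⟧) :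
    derivative R (F * G) = F * derivative R G + G * derivative R F := by
  rw [Derivation.leibniz, smul_eq_mul, smul_eq_mul]

/-- Uniqueness for a linear formal differential equation: the coefficients vanish one after another,
because n + 1 is invertible. -/
theorem eq_zero_of_derivative_eq_mul {R : Type*} [CommRing R] [Algebra ℝ R] {G U : R⟦X⟧}
    (h : derivative R U = G * U) (h0 : constantCoeff U = 0) : U = 0 := by
  ext n
  induction n using Nat.strong_induction_on with
  | _ n ih =>
    rcases n with _ | n
    · simpa using h0
    · have h1 := congrArg (coeff n) h
      rw [coeff_derivative, coeff_mul, Finset.sum_eq_zero] at h1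
      · have h2 : ((n : ℝ) + 1) • coeff (n + 1) U = 0 := by
          rw [Algebra.smul_def, map_add, map_natCast, map_one, mul_comm, h1]
        have h3 : ((n : ℝ) + 1) ≠ 0 := by positivity
        have h4 := congrArg (fun x => ((n : ℝ) + 1)⁻¹ • x) h2
        simpa [smul_smul, h3] using h4
      · intro p hp
        rw [Finset.HasAntidiagonal.mem_antidiagonal] at hp
        rw [ih p.2 (by omega), map_zero, mul_zero]

theorem derivative_mapDer (δ : Derivation ℝ 𝓕 𝓕) (F : 𝓕⟦X⟧) :
    derivative 𝓕 (mapDer δ F) = mapDer δ (derivative 𝓕 F) := by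
  ext n
  rw [coeff_derivative, coeff_mapDer, coeff_mapDer, coeff_derivative, Derivation.leibniz,
    ← Nat.cast_succ, Derivation.map_natCast, smul_zero, zero_add, smul_eq_mul, mul_comm]

/-- The leading terms of the connected parts of the star powers satisfy the
Hamilton–Jacobi equation. -/
theorem hamiltonJacobi_leading (D : CommDer (Fin N ⊕ Fin N) 𝓕) (f : 𝓕) (W : ℕ → 𝓕⟦X⟧)
    (hW0 : W 0 = 0) (hW : ∀ n, X ^ n ∣ W (n + 1))
    (hZ : ∀ n, starPower D f (n + 1) = ∑ k ∈ Finset.range (n + 1),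
      n.choose k • (W (k + 1) * starPower D f (n - k))) (n : ℕ) :
    let v : 𝓕⟦X⟧ := egf fun n => coeff (n - 1) (W n)
    ((n : ℝ) + 1) • coeff (n + 1) v = ∑ j ∈ Finset.range (n + 1), ((j.factorial : ℝ)⁻¹) •
      coeff n (taylorTerm D C (fun k => mapDer (D.d (Sum.inr k)) v) j f) := by
  intro v
  set Zs : 𝓕⟦X⟧⟦X⟧ := egf (starPower D f) with hZs
  set Ws : 𝓕⟦X⟧⟦X⟧ := egf W with hWs
  -- The binomial recursion is the equation Z' = W'Z for exponential generating series.
  have hode : derivative _ Zs = derivative _ Ws * Zs := by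
    rw [hZs, hWs, derivative_egf, derivative_egf, egf_mul]
    congr 1
    funext n
    exact hZ n
  have hdq : ∀ k, dq D k Zs = dq D k Ws * Zs := by
    intro k
    rw [← sub_eq_zero]
    -- The difference U = ∂Z - ∂W·Z solves U' = W'U with initial value zero. This replaces the
    -- explicit formula Z = exp W.
    refine eq_zero_of_derivative_eq_mul (G := derivative _ Ws) ?_ ?_
    · rw [map_sub, dq, derivative_mapDer, hode, derivative_mul_eq, Derivation.leibniz,
        derivative_mapDer, hode]
      simp only [smul_eq_mul]
      ring
    · rw [← coeff_zero_eq_constantCoeff_apply, map_sub, coeff_zero_mul_eq, dq, coeff_mapDer,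
        coeff_mapDer, hWs, hZs, egf, egf, coeff_mk, coeff_mk, hW0, starPower]
      simp
  have hWlead : ∀ k, HasLeading (C X * dq D k Ws) (mapDer (D.d (Sum.inr k)) v) := by
    intro k m
    rw [coeff_C_mul, dq, coeff_mapDer, coeff_mapDer, hWs, egf, coeff_mk]
    rcases m with _ | m
    · simp [hW0, v, egf]
    · refine ⟨?_, ?_⟩
      · rw [pow_succ']
        exact mul_dvd_mul_left _ (X_pow_dvd_mapDer _ (dvd_smul_of_dvd _ (hW m)))
      · rw [coeff_succ_X_mul, coeff_mapDer, coeff_smul]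
        simp [v, egf]
  have hunit : IsUnit Zs := by
    rw [isUnit_iff_constantCoeff, ← coeff_zero_eq_constantCoeff_apply, hZs, egf, coeff_mk]
    simp [starPower]
  -- `T` is the truncation at j ≤ n of the conjugated star multiplication by `f`, applied to 1.
  set T : 𝓕⟦X⟧⟦X⟧ := ∑ j ∈ Finset.range (n + 1), ((j.factorial : ℝ)⁻¹) • conjStarTerm D Ws j f 1
    with hT
  -- Z' = f ⋆ Z, and terms with j > n do not reach inner degree n, so Z W' and Z T agree modulo
  -- X^(n+1).
  have hmod : ∀ m, X ^ (n + 1) ∣ coeff m (Zs * (derivative _ Ws - T)) := by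
    intro m
    have hTZ : Zs * T = ∑ j ∈ Finset.range (n + 1), ((j.factorial : ℝ)⁻¹) •
        (C X ^ j * starTermSeries D j f Zs) := by
      rw [hT, Finset.mul_sum]
      refine Finset.sum_congr rfl fun j _ => ?_
      rw [mul_smul_comm, ← starTermSeries_mul D hdq, mul_one]
    rw [mul_sub, mul_comm Zs, ← hode, hTZ, X_pow_dvd_iff]
    intro b hb
    rw [map_sub, map_sub, sub_eq_zero, hZs, derivative_egf, ← hZs, egf, coeff_mk, coeff_smul,
      starPower, starMul, coeff_mk, Finset.Nat.sum_antidiagonal_eq_sum_range_succ_mk,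
      map_sum, map_sum, Finset.smul_sum]
    have hsub : Finset.range b.succ ⊆ Finset.range (n + 1) :=
      Finset.range_subset_range.mpr hb
    rw [← Finset.sum_subset hsub]
    · refine Finset.sum_congr rfl fun j hj => ?_
      have hj : j ≤ b := Nat.lt_succ_iff.mp (Finset.mem_range.mp hj)
      rw [coeff_smul, coeff_smul, coeff_coeff_C_X_pow_mul, if_pos hj, coeff_starTermSeries, hZs,
        egf, coeff_mk, coeff_smul, starTerm_smul, smul_comm]
    · intro j _ hj
      have hj : ¬ j ≤ b := fun h => hj (Finset.mem_range.mpr (Nat.lt_succ_iff.mpr h))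
      rw [coeff_smul, coeff_smul, coeff_coeff_C_X_pow_mul, if_neg hj, smul_zero]
  -- Z has constant coefficient 1 and can be cancelled.
  have hmod' : X ^ (n + 1) ∣ coeff n (derivative _ Ws - T) := by
    obtain ⟨u, hu⟩ := hunit
    have h1 : derivative _ Ws - T = ↑u⁻¹ * (Zs * (derivative _ Ws - T)) := by
      rw [← hu, ← mul_assoc, Units.inv_mul, one_mul]
    rw [h1, coeff_mul]
    exact Finset.dvd_sum fun p _ => Dvd.dvd.mul_left (hmod p.2) _
  have hfin := X_pow_dvd_iff.mp hmod' n n.lt_succ_self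
  rw [map_sub, map_sub, sub_eq_zero, hWs, derivative_egf, egf, coeff_mk, coeff_smul] at hfin
  have hlead : HasLeading T (∑ j ∈ Finset.range (n + 1), ((j.factorial : ℝ)⁻¹) •
      (taylorTerm D C (fun k => mapDer (D.d (Sum.inr k)) v) j f * C 1)) :=
    HasLeading.sum _ fun j _ => (HasLeading.conjStarTerm D hWlead j f (by
      simpa using hasLeading_C_C (1 : 𝓕))).smul _
  rw [(hlead n).2] at hfin
  simp only [map_one, mul_one, map_sum, coeff_smul] at hfin
  rw [← hfin]
  simp only [v, egf, coeff_mk, Nat.add_sub_cancel, smul_smul, Nat.factorial_succ]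
  congr 1
  have h1 := Nat.cast_ne_zero (R := ℝ).mpr n.factorial_ne_zero
  push_cast
  field_simp

end HamiltonJacobi

/-! ### The algebra of smooth functions and its directional derivatives. -/

section SmoothFunctions

variable (E : Type*) [NormedAddCommGroup E] [NormedSpace ℝ E]

/-- The algebra of smooth real functions. -/
def smoothFn : Subalgebra ℝ (E → ℝ) where
  carrier := {f | ContDiff ℝ ∞ f}
  mul_mem' {f g} (hf : ContDiff ℝ ∞ f) (hg : ContDiff ℝ ∞ g) := (hf.mul hg :)
  add_mem' {f g} (hf : ContDiff ℝ ∞ f) (hg : ContDiff ℝ ∞ g) := (hf.add hg :)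
  algebraMap_mem' c := (contDiff_const : ContDiff ℝ ∞ fun _ : E => c)

variable {E}

theorem smoothFn.contDiff (f : smoothFn E) : ContDiff ℝ ∞ (f : E → ℝ) := f.2

theorem smoothFn.differentiable (f : smoothFn E) : Differentiable ℝ (f : E → ℝ) :=
  ContDiff.differentiable (n := ∞) f.2 (by simp)

/-- The derivative in a constant direction. -/
def dirDer (v : E) : Derivation ℝ (smoothFn E) (smoothFn E) :=
  Derivation.mk'
    { toFun := fun f => ⟨fun y => fderiv ℝ (f : E → ℝ) y v,
        ((smoothFn.contDiff f).fderiv_right (m := ∞) (by simp)).clm_apply contDiff_const⟩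
      map_add' := fun f g => by
        ext y
        change fderiv ℝ ((f : E → ℝ) + (g : E → ℝ)) y v = _
        rw [fderiv_add (smoothFn.differentiable f y) (smoothFn.differentiable g y)]
        rfl
      map_smul' := fun c f => by
        ext y
        change fderiv ℝ (c • (f : E → ℝ)) y v = _
        rw [fderiv_const_smul (smoothFn.differentiable f y)]
        rfl }
    fun f g => by
      ext y
      change fderiv ℝ ((f : E → ℝ) * (g : E → ℝ)) y v = _
      rw [fderiv_mul (smoothFn.differentiable f y) (smoothFn.differentiable g y)]
      rfl

theorem dirDer_comm (v w : E) (f : smoothFn E) : dirDer v (dirDer w f) = dirDer w (dirDer v f) := by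
  have hdiff : Differentiable ℝ (fderiv ℝ (f : E → ℝ)) :=
    ((smoothFn.contDiff f).fderiv_right (m := ∞) (by simp)).differentiable (by simp)
  have key : ∀ (v w : E) (y : E), (dirDer v (dirDer w f) : E → ℝ) y =
      fderiv ℝ (fderiv ℝ (f : E → ℝ)) y v w := by
    intro v w y
    change fderiv ℝ (fun z => fderiv ℝ (f : E → ℝ) z w) y v = _
    rw [fderiv_clm_apply (hdiff y) (differentiableAt_const w)]
    simp
  ext y
  rw [key, key]
  have hsymm : IsSymmSndFDerivAt ℝ (f : E → ℝ) y :=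
    (contDiff_infty.mp (smoothFn.contDiff f) 2).contDiffAt.isSymmSndFDerivAt (by simp)
  exact hsymm v w

/-- Evaluation at a point. -/
def evalAt (y : E) : smoothFn E →ₐ[ℝ] ℝ where
  toFun f := (f : E → ℝ) y
  map_one' := rfl
  map_mul' _ _ := rfl
  map_zero' := rfl
  map_add' _ _ := rfl
  commutes' _ := rfl

theorem evalAt_apply (y : E) (f : smoothFn E) : evalAt y f = (f : E → ℝ) y := rfl

end SmoothFunctions

/-! ### Smooth functions of T and of the phase space point. -/

section Fields

variable {N : ℕ} {ι : Type*} [Fintype ι]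

/-- The coordinate directions of the phase space. -/
def phaseDir : Fin N ⊕ Fin N → Phase N
  | Sum.inl i => dirP i
  | Sum.inr i => dirQ i

/-- The algebra of smooth functions of `T` and `(p, q)`. -/
abbrev FieldFn (N : ℕ) (ι : Type*) [Fintype ι] : Subalgebra ℝ (((ι → ℝ) × Phase N) → ℝ) :=
  smoothFn ((ι → ℝ) × Phase N)

/-- The coordinate derivatives along the phase space. -/
def phaseDer (N : ℕ) (ι : Type*) [Fintype ι] : CommDer (Fin N ⊕ Fin N) (FieldFn N ι) where
  d j := dirDer (0, phaseDir j)
  comm _ _ f := dirDer_comm _ _ f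

theorem phaseDer_apply (j : Fin N ⊕ Fin N) (f : FieldFn N ι) (T : ι → ℝ) (x : Phase N) :
    ((phaseDer N ι).d j f : _ → ℝ) (T, x) =
      fderiv ℝ (fun z => (f : _ → ℝ) (T, z)) x (phaseDir j) := by
  change fderiv ℝ (f : _ → ℝ) (T, x) (0, phaseDir j) = _
  have h1 : HasFDerivAt (fun z : Phase N => ((T, z) : (ι → ℝ) × Phase N))
      (ContinuousLinearMap.inr ℝ (ι → ℝ) (Phase N)) x := hasFDerivAt_prodMk_right T x
  have h2 := (smoothFn.differentiable f (T, x)).hasFDerivAt.comp x h1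
  have h3 : fderiv ℝ (fun z => (f : _ → ℝ) (T, z)) x = _ := h2.fderiv
  rw [h3]
  rfl

variable {V : Type} [Fintype V]

/-- A product of functions of the fields at the vertices, acted on by the differential operator
with a given symbol. -/
def fieldEv (k : V → FieldFn N ι) (T : ι → ℝ) (x : V → Phase N) :
    MvPolynomial (V × (Fin N ⊕ Fin N)) ℝ →ₗ[ℝ] ℝ :=
  ev fun r m => ((phaseDer N ι).jet (k r) m : _ → ℝ) (T, x r)

theorem fieldEv_const (k : V → FieldFn N ι) (T : ι → ℝ) (x : Phase N)
    (Q : MvPolynomial (V × (Fin N ⊕ Fin N)) ℝ) :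
    fieldEv k T (fun _ => x) Q = (ev (fun r => (phaseDer N ι).jet (k r)) Q : _ → ℝ) (T, x) :=
  (map_ev (evalAt (T, x)) _ Q).symm

/-- The analytic derivative at vertex `r` in a coordinate direction is multiplication of the symbol
by the corresponding variable; this links Fréchet derivatives to the symbol calculus. -/
theorem hasFDerivAt_fieldEv [DecidableEq V] (k : V → FieldFn N ι) (T : ι → ℝ)
    (Q : MvPolynomial (V × (Fin N ⊕ Fin N)) ℝ) (x : V → Phase N) :
    ∃ L : (V → Phase N) →L[ℝ] ℝ, HasFDerivAt (fun x => fieldEv k T x Q) L x ∧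
      ∀ r j, L (Pi.single r (phaseDir j)) = fieldEv k T x (MvPolynomial.X (r, j) * Q) := by
  induction Q using MvPolynomial.induction_on' with
  | add P Q hP hQ =>
    obtain ⟨L, hL, hL'⟩ := hP
    obtain ⟨M, hM, hM'⟩ := hQ
    refine ⟨L + M, ?_, fun r j => ?_⟩
    · simp only [map_add]
      exact hL.add hM
    · rw [add_apply, hL', hM', mul_add, map_add]
  | monomial m a =>
    let g : V → Phase N → ℝ := fun r z => ((phaseDer N ι).jet (k r) (m.curry r) : _ → ℝ) (T, z)
    have hg : ∀ r, HasFDerivAt (fun x : V → Phase N => g r (x r))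
        ((fderiv ℝ (g r) (x r)).comp (ContinuousLinearMap.proj r)) x := by
      intro r
      have h1 : DifferentiableAt ℝ (g r) (x r) :=
        (smoothFn.differentiable _).comp (by fun_prop) (x r)
      exact h1.hasFDerivAt.comp x (ContinuousLinearMap.proj (R := ℝ) r).hasFDerivAt
    have hprod := (HasFDerivAt.finsetProd (u := Finset.univ) fun r _ => hg r).const_smul a
    refine ⟨a • ∑ r, (∏ r' ∈ Finset.univ.erase r, g r' (x r')) •
        ((fderiv ℝ (g r) (x r)).comp (ContinuousLinearMap.proj r)), ?_, ?_⟩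
    · simp only [fieldEv, ev_monomial]
      exact hprod
    · intro r j
      rw [smul_apply, sum_apply,
        Finset.sum_eq_single r]
      · rw [fieldEv, MvPolynomial.X, MvPolynomial.monomial_mul, one_mul, ev_monomial,
          ← Finset.mul_prod_erase _ _ (Finset.mem_univ r), curry_single_add, if_pos rfl,
          CommDer.jet_single_add, phaseDer_apply]
        simp only [smul_apply, ContinuousLinearMap.comp_apply,
          ContinuousLinearMap.proj_apply, Pi.single_eq_same, smul_eq_mul]
        rw [mul_comm (∏ r' ∈ Finset.univ.erase r, g r' (x r'))]
        congr 2
        refine Finset.prod_congr rfl fun r' hr' => ?_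
        rw [curry_single_add, if_neg (Finset.ne_of_mem_erase hr')]
      · intro r' _ hr'
        simp [hr']
      · simp

end Fields

/-! ### Wick contractions as multiplication of symbols. -/

section Contractions

variable {N n : ℕ} {ι : Type*} [Fintype ι]

theorem partialAt_fieldEv (k : Fin n → FieldFn N ι) (T : ι → ℝ) (c : ℂ)
    (Q : MvPolynomial (Fin n × (Fin N ⊕ Fin N)) ℝ) (r : Fin n) (j : Fin N ⊕ Fin N) :
    partialAt r (phaseDir j) (fun x => c * (fieldEv k T x Q : ℂ)) =
      fun x => c * (fieldEv k T x (MvPolynomial.X (r, j) * Q) : ℂ) := by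
  funext x
  obtain ⟨L, hL, hL'⟩ := hasFDerivAt_fieldEv k T Q x
  have h := (Complex.ofRealCLM.hasFDerivAt.comp x hL).const_mul c
  rw [partialAt, ← hL']
  have h2 : fderiv ℝ (fun x => c * (fieldEv k T x Q : ℂ)) x = _ := h.fderiv
  rw [h2]
  simp

theorem differentiable_fieldEv (k : Fin n → FieldFn N ι) (T : ι → ℝ) (c : ℂ)
    (Q : MvPolynomial (Fin n × (Fin N ⊕ Fin N)) ℝ) :
    Differentiable ℝ (fun x => c * (fieldEv k T x Q : ℂ)) := by
  intro x
  obtain ⟨L, hL, -⟩ := hasFDerivAt_fieldEv k T Q x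
  exact ((Complex.ofRealCLM.hasFDerivAt.comp x hL).const_mul c).differentiableAt

theorem partialAt_sum_fieldEv {σ : Type*} (s : Finset σ) (k : σ → Fin n → FieldFn N ι)
    (T : ι → ℝ) (c : σ → ℂ) (Q : σ → MvPolynomial (Fin n × (Fin N ⊕ Fin N)) ℝ) (r : Fin n)
    (j : Fin N ⊕ Fin N) :
    partialAt r (phaseDir j) (fun x => ∑ a ∈ s, c a * (fieldEv (k a) T x (Q a) : ℂ)) =
      fun x => ∑ a ∈ s, c a * (fieldEv (k a) T x (MvPolynomial.X (r, j) * Q a) : ℂ) := by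
  funext x
  rw [partialAt, fderiv_fun_sum fun a _ => differentiable_fieldEv (k a) T (c a) (Q a) x,
    sum_apply]
  exact Finset.sum_congr rfl fun a _ => congrFun (partialAt_fieldEv (k a) T (c a) (Q a) r j) x

theorem edgeOp_sum_fieldEv {σ : Type*} (s : Finset σ) (k : σ → Fin n → FieldFn N ι)
    (T : ι → ℝ) (c : σ → ℂ) (Q : σ → MvPolynomial (Fin n × (Fin N ⊕ Fin N)) ℝ) (r r' : Fin n) :
    edgeOp r r' (fun x => ∑ a ∈ s, c a * (fieldEv (k a) T x (Q a) : ℂ)) =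
      fun x => ∑ a ∈ s, c a * (fieldEv (k a) T x (edge N r r' * Q a) : ℂ) := by
  funext x
  rw [edgeOp]
  have h : ∀ i : Fin N, partialAt r (dirQ i) (partialAt r' (dirP i)
      (fun x => ∑ a ∈ s, c a * (fieldEv (k a) T x (Q a) : ℂ))) x =
      ∑ a ∈ s, c a * (fieldEv (k a) T x (MvPolynomial.X (r, Sum.inr i) *
        (MvPolynomial.X (r', Sum.inl i) * Q a)) : ℂ) := by
    intro i
    have h1 := partialAt_sum_fieldEv s k T c Q r' (Sum.inl i)
    have h2 := partialAt_sum_fieldEv s k T c (fun a => MvPolynomial.X (r', Sum.inl i) * Q a)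
      r (Sum.inr i)
    simp only [phaseDir] at h1 h2
    rw [h1, h2]
  simp only [h]
  rw [Finset.sum_comm]
  refine Finset.sum_congr rfl fun a _ => ?_
  rw [← Finset.mul_sum, edge, Finset.sum_mul, map_sum, Complex.ofReal_sum]
  simp only [mul_assoc]

/-- Finite sums with complex coefficients are carried along because the integrands of the ghost
sector have this form. -/
theorem contraction_sum_fieldEv {σ : Type*} (s : Finset σ) (k : σ → Fin n → FieldFn N ι)
    (T : ι → ℝ) (c : σ → ℂ) (Q : σ → MvPolynomial (Fin n × (Fin N ⊕ Fin N)) ℝ)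
    (t : Fin n → ℝ) :
    contraction t (fun x => ∑ a ∈ s, c a * (fieldEv (k a) T x (Q a) : ℂ)) =
      fun x => ∑ a ∈ s, c a * (fieldEv (k a) T x (timeEdges N t * Q a) : ℂ) := by
  funext x
  simp only [contraction, edgeOp_sum_fieldEv, timeEdges, Finset.sum_mul, map_sum,
    Complex.ofReal_sum, Finset.mul_sum, smul_mul_assoc, map_smul, smul_eq_mul,
    Complex.ofReal_mul]
  rw [Finset.sum_congr rfl fun r _ => Finset.sum_comm, Finset.sum_comm]
  refine Finset.sum_congr rfl fun a _ => Finset.sum_congr rfl fun r _ =>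
    Finset.sum_congr rfl fun r' _ => ?_
  ring

theorem contraction_iterate_fieldEv {σ : Type*} (s : Finset σ) (k : σ → Fin n → FieldFn N ι)
    (T : ι → ℝ) (c : σ → ℂ) (t : Fin n → ℝ) (j : ℕ) :
    (contraction t)^[j] (fun x => ∑ a ∈ s, c a * (∏ r, (k a r : _ → ℝ) (T, x r) : ℝ)) =
      fun x => ∑ a ∈ s, c a * (fieldEv (k a) T x (timeEdges N t ^ j) : ℂ) := by
  induction j with
  | zero =>
    funext x
    simp [fieldEv, ev_one]
  | succ j ih =>
    rw [Function.iterate_succ_apply', ih, contraction_sum_fieldEv]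
    simp only [pow_succ']

theorem foldr_edgeOp_fieldEv (k : Fin n → FieldFn N ι) (T : ι → ℝ)
    (l : List (Fin n × Fin n)) :
    (l.foldr (fun rs F => edgeOp rs.1 rs.2 F)
      (fun x : Fin n → Phase N => (∏ r, (k r : _ → ℝ) (T, x r) : ℝ) : _ → ℂ)) =
      fun x => (fieldEv k T x (l.map fun e => edge N e.1 e.2).prod : ℂ) := by
  induction l with
  | nil => simp [fieldEv, ev_one]
  | cons e l ih =>
    rw [List.foldr_cons, ih, List.map_cons, List.prod_cons]
    have := edgeOp_sum_fieldEv (Finset.univ : Finset Unit) (fun _ => k) T (fun _ => 1)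
      (fun _ => (l.map fun e => edge N e.1 e.2).prod) e.1 e.2
    simpa using this

end Contractions

/-! ### Coefficients of Laurent series in ħ. -/

section LaurentCoefficients

theorem ext_coeffħ {a b : Kħ} (h : ∀ k, coeffħ a k = coeffħ b k) : a = b :=
  HahnSeries.ext (funext h)

/-- The coefficient of `ħ^k` as an additive map. -/
def coeffħHom (k : ℤ) : Kħ →+ ℂ where
  toFun a := coeffħ a k
  map_zero' := rfl
  map_add' _ _ := rfl

theorem coeffħ_sum {σ : Type*} (s : Finset σ) (a : σ → Kħ) (k : ℤ) :
    coeffħ (∑ i ∈ s, a i) k = ∑ i ∈ s, coeffħ (a i) k :=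
  map_sum (coeffħHom k) a s

/-- The underlying Laurent series. -/
def toLaurent : Kħ ≃+* LaurentSeries ℂ := RingEquiv.refl (LaurentSeries ℂ)

theorem toLaurent_cst (z : ℂ) : toLaurent (cst z) = HahnSeries.C z :=
  HahnSeries.ofPowerSeries_C z

theorem coeffħ_cst_mul (z : ℂ) (a : Kħ) (k : ℤ) : coeffħ (cst z * a) k = z * coeffħ a k := by
  change (toLaurent (cst z * a)).coeff k = z * (toLaurent a).coeff k
  rw [map_mul, toLaurent_cst, HahnSeries.C_mul_eq_smul, HahnSeries.coeff_smul, smul_eq_mul]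

theorem laurentMk_coeffħ (a : Kħ) : laurentMk (coeffħ a) = a := by
  have h : BddBelow (Function.support (coeffħ a)) := by
    by_cases ha : toLaurent a = 0
    · refine ⟨0, fun k hk => absurd ?_ hk⟩
      change (toLaurent a).coeff k = 0
      rw [ha]; rfl
    · exact ⟨(toLaurent a).order, fun k hk => HahnSeries.order_le_of_coeff_ne_zero hk⟩
  exact (dif_pos h).trans (ext_coeffħ fun k => rfl)

theorem exists_coeffħ_eq_zero (a : Kħ) : ∃ m : ℤ, ∀ k < m, coeffħ a k = 0 := by
  by_cases ha : toLaurent a = 0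
  · refine ⟨0, fun k _ => ?_⟩
    change (toLaurent a).coeff k = 0
    rw [ha]; rfl
  · exact ⟨(toLaurent a).order, fun k hk => HahnSeries.coeff_eq_zero_of_lt_order hk⟩

/-- A Laurent series is bounded below, so only finitely many powers j can be subtracted; the
`finsum` in `physIntegral` is then an honest sum. -/
theorem finite_support_coeffħ_sub (a : Kħ) (c : ℕ → ℂ) (k : ℤ) :
    (Function.support fun j : ℕ => coeffħ a (k - j) * c j).Finite := by
  obtain ⟨m, hm⟩ := exists_coeffħ_eq_zero a
  refine (Set.finite_Iic (k - m).toNat).subset fun j hj => ?_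
  by_contra h
  rw [Set.mem_Iic, not_le] at h
  refine hj ?_
  simp only
  rw [hm _ (by omega), zero_mul]

theorem coeffħ_mul_ofħ (a : Kħ) (A : PowerSeries ℂ) (k : ℤ) :
    coeffħ (a * ofħ A) k = ∑ᶠ j : ℕ, coeffħ a (k - j) * PowerSeries.coeff j A := by
  have hcoeff : ∀ i : ℤ, coeffħ (ofħ A) i ≠ 0 → 0 ≤ i := by
    intro i hi
    by_contra hneg
    refine hi ?_
    change HahnSeries.coeff (HahnSeries.ofPowerSeries ℤ ℂ A) i = 0
    rw [HahnSeries.ofPowerSeries_apply]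
    refine HahnSeries.embDomain_of_notMem_range ?_
    rintro ⟨j, hj⟩
    simp at hj
    omega
  have hnat : ∀ j : ℕ, coeffħ (ofħ A) j = PowerSeries.coeff j A := fun j =>
    HahnSeries.ofPowerSeries_apply_coeff A j
  rw [finsum_eq_sum_of_support_subset (s := (finite_support_coeffħ_sub a _ k).toFinset) _
    (by rw [Set.Finite.coe_toFinset])]
  change (toLaurent (a * ofħ A)).coeff k = _
  rw [map_mul, HahnSeries.coeff_mul]
  symm
  refine Finset.sum_bij_ne_zero (fun j _ _ => ((k - j, (j : ℤ)) : ℤ × ℤ)) ?_ ?_ ?_ ?_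
  · intro j _ hj
    rw [Finset.mem_antidiagonal]
    refine ⟨left_ne_zero_of_mul hj, ?_, by simp⟩
    change coeffħ (ofħ A) j ≠ 0
    rw [hnat]
    exact right_ne_zero_of_mul hj
  · intro j _ _ j' _ _ h
    simpa using (Prod.ext_iff.mp h).2
  · rintro ⟨i, i'⟩ hi _
    rw [Finset.mem_antidiagonal] at hi
    obtain ⟨h1, h2, h3⟩ := hi
    simp only at h1 h2 h3
    obtain ⟨j, rfl⟩ := Int.eq_ofNat_of_zero_le (hcoeff i' h2)
    have hi : i = k - j := by omega
    subst hi
    have h4 : coeffħ a (k - j) * PowerSeries.coeff j A ≠ 0 := by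
      refine mul_ne_zero h1 ?_
      rw [← hnat]; exact h2
    exact ⟨j, (Set.Finite.mem_toFinset _).mpr h4, h4, rfl⟩
  · intro j _ _
    rw [← hnat]
    rfl

end LaurentCoefficients

/-! ### Bounded measurable functions of the times and null sets in the cube. -/

section BoundedMeasurable

open MeasureTheory

variable {V : Type}

/-- Measurable functions which are bounded on the cube `[ta, tb]^V`. -/
structure BddMeas (ta tb : ℝ) (u : (V → ℝ) → ℝ) : Prop where
  measurable : Measurable u
  bounded : ∃ C, ∀ t ∈ Set.Icc (fun _ : V => ta) (fun _ => tb), |u t| ≤ C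

variable {ta tb : ℝ} {u v : (V → ℝ) → ℝ}

theorem BddMeas.const (c : ℝ) : BddMeas ta tb (fun _ : V → ℝ => c) :=
  ⟨measurable_const, |c|, fun _ _ => le_rfl⟩

theorem BddMeas.mul (hu : BddMeas ta tb u) (hv : BddMeas ta tb v) :
    BddMeas ta tb fun t => u t * v t := by
  obtain ⟨C, hC⟩ := hu.bounded
  obtain ⟨C', hC'⟩ := hv.bounded
  refine ⟨hu.measurable.mul hv.measurable, C * C', fun t ht => ?_⟩
  rw [abs_mul]
  exact mul_le_mul (hC t ht) (hC' t ht) (abs_nonneg _) ((abs_nonneg _).trans (hC t ht))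

theorem BddMeas.add (hu : BddMeas ta tb u) (hv : BddMeas ta tb v) :
    BddMeas ta tb fun t => u t + v t := by
  obtain ⟨C, hC⟩ := hu.bounded
  obtain ⟨C', hC'⟩ := hv.bounded
  exact ⟨hu.measurable.add hv.measurable, C + C', fun t ht =>
    (abs_add_le _ _).trans (add_le_add (hC t ht) (hC' t ht))⟩

theorem BddMeas.sum {σ : Type*} (s : Finset σ) {u : σ → (V → ℝ) → ℝ}
    (h : ∀ i ∈ s, BddMeas ta tb (u i)) : BddMeas ta tb fun t => ∑ i ∈ s, u i t := by
  classical
  induction s using Finset.induction_on with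
  | empty => simpa using BddMeas.const 0
  | insert a s ha ih =>
    simp only [Finset.sum_insert ha]
    exact (h a (Finset.mem_insert_self _ _)).add
      (ih fun i hi => h i (Finset.mem_insert_of_mem hi))

theorem BddMeas.prod {σ : Type*} (s : Finset σ) {u : σ → (V → ℝ) → ℝ}
    (h : ∀ i ∈ s, BddMeas ta tb (u i)) : BddMeas ta tb fun t => ∏ i ∈ s, u i t := by
  classical
  induction s using Finset.induction_on with
  | empty => simpa using BddMeas.const 1
  | insert a s ha ih =>
    simp only [Finset.prod_insert ha]
    exact (h a (Finset.mem_insert_self _ _)).mul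
      (ih fun i hi => h i (Finset.mem_insert_of_mem hi))

theorem measurable_heaviside : Measurable heaviside :=
  Measurable.ite measurableSet_Ioi measurable_const measurable_const

theorem abs_heaviside_le (t : ℝ) : |heaviside t| ≤ 1 := by
  rw [heaviside]; split_ifs <;> simp

theorem BddMeas.heaviside {f : (V → ℝ) → ℝ} (hf : Measurable f) :
    BddMeas ta tb fun t => heaviside (f t) :=
  ⟨measurable_heaviside.comp hf, 1, fun _ _ => abs_heaviside_le _⟩

variable [Fintype V]

theorem isFiniteMeasure_cube : IsFiniteMeasure
    (volume.restrict (Set.Icc (fun _ : V => ta) (fun _ => tb))) :=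
  ⟨by rw [Measure.restrict_apply_univ]; exact isCompact_Icc.measure_lt_top⟩

theorem BddMeas.integrable (hu : BddMeas ta tb u) :
    IntegrableOn u (Set.Icc (fun _ : V => ta) (fun _ => tb)) := by
  obtain ⟨C, hC⟩ := hu.bounded
  have := isFiniteMeasure_cube (V := V) (ta := ta) (tb := tb)
  refine Integrable.of_bound hu.measurable.aestronglyMeasurable C ?_
  filter_upwards [ae_restrict_mem measurableSet_Icc] with t ht
  exact hC t ht

/-- Hyperplanes are null sets. At interior times both Heaviside factors of `sourceMean` equal one.
-/
theorem ae_cube_interior (ta tb : ℝ) :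
    ∀ᵐ t ∂(volume.restrict (Set.Icc (fun _ : V => ta) (fun _ => tb))),
      ∀ r, ta < t r ∧ t r < tb := by
  have h1 : ∀ c : ℝ, ∀ᵐ t ∂(volume : Measure (V → ℝ)), ∀ r, t r ≠ c := by
    intro c
    rw [ae_all_iff]
    intro r
    exact measure_eq_zero_iff_ae_notMem.mp
      (Measure.pi_hyperplane (fun _ : V => (volume : Measure ℝ)) r c)
  filter_upwards [ae_restrict_mem measurableSet_Icc, ae_restrict_of_ae (h1 ta),
    ae_restrict_of_ae (h1 tb)] with t ht h2 h3 r
  exact ⟨lt_of_le_of_ne (ht.1 r) (h2 r).symm, lt_of_le_of_ne (ht.2 r) (h3 r)⟩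

/-- Coincident times lie in finitely many proper subspaces, which are null sets. The value θ(0) is
thus irrelevant for edges between different vertices. -/
theorem ae_cube_injective (ta tb : ℝ) :
    ∀ᵐ t ∂(volume.restrict (Set.Icc (fun _ : V => ta) (fun _ => tb))), Function.Injective t := by
  classical
  refine ae_restrict_of_ae ?_
  have h1 : ∀ r s : V, r ≠ s → ∀ᵐ t ∂(volume : Measure (V → ℝ)), t r ≠ t s := by
    intro r s hrs
    let S : Submodule ℝ (V → ℝ) :=
      LinearMap.ker (LinearMap.proj (R := ℝ) (φ := fun _ : V => ℝ) r - LinearMap.proj s)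
    have hS : S ≠ ⊤ := by
      intro h
      have h2 : (Pi.single r 1 : V → ℝ) ∈ S := h ▸ Submodule.mem_top
      rw [LinearMap.mem_ker] at h2
      simp [hrs.symm] at h2
    have h0 := measure_eq_zero_iff_ae_notMem.mp (Measure.addHaar_submodule volume S hS)
    filter_upwards [h0] with t ht h
    exact ht (by simp [S, LinearMap.mem_ker, h])
  have h2 : ∀ᵐ t ∂(volume : Measure (V → ℝ)), ∀ r s : V, r ≠ s → t r ≠ t s := by
    rw [ae_all_iff]; intro r
    rw [ae_all_iff]; intro s
    by_cases h : r = s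
    · exact Filter.Eventually.of_forall fun _ hne => absurd h hne
    · filter_upwards [h1 r s h] with t ht _
      exact ht
  filter_upwards [h2] with t ht r s h
  by_contra hne
  exact ht r s hne h

theorem volume_cube (hab : ta ≤ tb) :
    (volume : Measure (V → ℝ)).real (Set.Icc (fun _ : V => ta) (fun _ => tb)) =
      (tb - ta) ^ Fintype.card V := by
  rw [Measure.real, Real.volume_Icc_pi, ENNReal.toReal_prod]
  simp [sub_nonneg.mpr hab]

end BoundedMeasurable

/-! ### Gaussian expectation values in the physical sector. -/

section PhysicalIntegral

open MeasureTheory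

variable {N n : ℕ} {ι : Type*} [Fintype ι]

/-- The coefficients of the Gaussian expectation value of a product of functions of the fields
at fixed times. -/
def gaussCoeff {V : Type} [Fintype V] (k : V → FieldFn N ι) (T : ι → ℝ) (x : Phase N)
    (t : V → ℝ) (j : ℕ) : ℝ :=
  PowerSeries.coeff j (mapLin (fieldEv k T fun _ => x) (expX (timeEdges N t)))

theorem gaussCoeff_eq_sum {V : Type} [Fintype V] (k : V → FieldFn N ι) (T : ι → ℝ) (x : Phase N)
    (t : V → ℝ) (j : ℕ) : gaussCoeff k T x t j = ∑ E : Finset (V × V),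
      (∏ e ∈ E, heaviside (t e.1 - t e.2)) *
        fieldEv k T (fun _ => x) (PowerSeries.coeff j (mayer N E)) := by
  simp only [gaussCoeff, expX_timeEdges, map_sum, map_smul, coeff_mapLin, smul_eq_mul]

theorem BddMeas.gaussCoeff {V : Type} [Fintype V] (ta tb : ℝ) (k : V → FieldFn N ι) (T : ι → ℝ)
    (x : Phase N) (j : ℕ) : BddMeas ta tb fun t => gaussCoeff k T x t j := by
  simp only [gaussCoeff_eq_sum]
  exact BddMeas.sum _ fun E _ => (BddMeas.prod _ fun e _ =>
    BddMeas.heaviside (by fun_prop)).mul (BddMeas.const _)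

theorem fieldEv_timeEdges_pow {V : Type} [Fintype V] (k : V → FieldFn N ι) (T : ι → ℝ)
    (x : Phase N) (t : V → ℝ) (j : ℕ) :
    fieldEv k T (fun _ => x) (timeEdges N t ^ j) = j.factorial * gaussCoeff k T x t j := by
  rw [gaussCoeff, coeff_mapLin, coeff_expX, map_smul, smul_eq_mul, ← mul_assoc,
    mul_inv_cancel₀ (Nat.cast_ne_zero.mpr j.factorial_ne_zero), one_mul]

/-- For integrands that are finite sums of (function of times)·(product of field functions)·(Laurent
series), the coefficientwise definition reduces to ordinary integrals of Gaussian coefficients at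
the point (pb, qa). -/
theorem physIntegral_eq {ta tb : ℝ} (qa pb : Fin N → ℝ) {σ : Type*} (s : Finset σ)
    (u : σ → (Fin n → ℝ) → ℝ) (hu : ∀ a ∈ s, BddMeas ta tb (u a)) (k : σ → Fin n → FieldFn N ι)
    (T : ι → ℝ) (K : σ → Kħ) (F : (Fin n → ℝ) → (Fin n → Phase N) → Kħ)
    (hF : ∀ t x, F t x =
      ∑ a ∈ s, cst ((u a t * ∏ r, (k a r : _ → ℝ) (T, x r) : ℝ) : ℂ) * K a) :
    physIntegral ta tb qa pb F = ∑ a ∈ s, K a * ofħ (PowerSeries.mk fun j =>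
      Complex.I ^ j * ((∫ t in Set.Icc (fun _ : Fin n => ta) (fun _ => tb),
        u a t * gaussCoeff (k a) T (pb, qa) t j : ℝ) : ℂ)) := by
  rw [← laurentMk_coeffħ (∑ a ∈ s, _), physIntegral]
  congr 1
  funext l
  have hint : ∀ j : ℕ, (∫ t in Set.Icc (fun _ : Fin n => ta) (fun _ => tb),
      ((contraction t)^[j] fun x => coeffħ (F t x) (l - j)) fun r => sourceMean ta tb qa pb (t r)) =
      ∑ a ∈ s, coeffħ (K a) (l - j) * (j.factorial *
        ((∫ t in Set.Icc (fun _ : Fin n => ta) (fun _ => tb),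
          u a t * gaussCoeff (k a) T (pb, qa) t j : ℝ) : ℂ)) := by
    intro j
    have h1 : ∀ᵐ t ∂(volume.restrict (Set.Icc (fun _ : Fin n => ta) (fun _ => tb))),
        ((contraction t)^[j] fun x => coeffħ (F t x) (l - j))
          (fun r => sourceMean ta tb qa pb (t r)) =
        ∑ a ∈ s, (coeffħ (K a) (l - j) * j.factorial) *
          ((u a t * gaussCoeff (k a) T (pb, qa) t j : ℝ) : ℂ) := by
      filter_upwards [ae_cube_interior ta tb] with t ht
      -- Away from the endpoints the source mean is the constant point (pb, qa).
      have hmean : (fun r => sourceMean ta tb qa pb (t r)) = fun _ => (pb, qa) := by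
        funext r
        rw [sourceMean, heaviside, heaviside, if_pos (sub_pos.mpr (ht r).2),
          if_pos (sub_pos.mpr (ht r).1), one_smul, one_smul]
      have hFt : (fun x => coeffħ (F t x) (l - j)) = fun x => ∑ a ∈ s,
          ((u a t : ℂ) * coeffħ (K a) (l - j)) * ((∏ r, (k a r : _ → ℝ) (T, x r) : ℝ) : ℂ) := by
        funext x
        rw [hF, coeffħ_sum]
        refine Finset.sum_congr rfl fun a _ => ?_
        rw [coeffħ_cst_mul]
        push_cast
        ring
      rw [hmean, hFt, contraction_iterate_fieldEv]
      refine Finset.sum_congr rfl fun a _ => ?_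
      rw [fieldEv_timeEdges_pow]
      push_cast
      ring
    rw [integral_congr_ae h1, integral_finsetSum]
    · refine Finset.sum_congr rfl fun a _ => ?_
      rw [integral_const_mul, integral_complex_ofReal, mul_assoc]
    · intro a ha
      exact (((hu a ha).mul (BddMeas.gaussCoeff ta tb (k a) T (pb, qa) j)).integrable.ofReal
        (𝕜 := ℂ)).const_mul _
  have hterm : ∀ j : ℕ, (Complex.I ^ j / (j.factorial : ℂ)) *
      (∫ t in Set.Icc (fun _ : Fin n => ta) (fun _ => tb),
      ((contraction t)^[j] fun x => coeffħ (F t x) (l - j)) fun r =>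
        sourceMean ta tb qa pb (t r)) =
      ∑ a ∈ s, coeffħ (K a) (l - j) * (Complex.I ^ j *
        ((∫ t in Set.Icc (fun _ : Fin n => ta) (fun _ => tb),
          u a t * gaussCoeff (k a) T (pb, qa) t j : ℝ) : ℂ)) := by
    intro j
    have hj : (j.factorial : ℂ) ≠ 0 := Nat.cast_ne_zero.mpr j.factorial_ne_zero
    rw [hint, Finset.mul_sum]
    refine Finset.sum_congr rfl fun a _ => ?_
    field_simp
  rw [finsum_congr hterm, finsum_sum_comm _ _ fun a _ => finite_support_coeffħ_sub _ _ _,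
    coeffħ_sum]
  refine Finset.sum_congr rfl fun a _ => ?_
  rw [coeffħ_mul_ofħ]
  simp only [PowerSeries.coeff_mk]

end PhysicalIntegral

/-! ### Evaluation at a point and comparison with the star product. -/

section AtPoint

variable {N : ℕ} {ι : Type*} [Fintype ι]

/-- The value at a point of a series in `iħ` with smooth coefficients, as a series in `ħ`. -/
def atPoint (T : ι → ℝ) (x : Phase N) : PowerSeries (FieldFn N ι) →+* PowerSeries ℂ :=
  (PowerSeries.rescale Complex.I).comp
    (PowerSeries.map (Complex.ofRealHom.comp (evalAt (T, x) : FieldFn N ι →+* ℝ)))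

theorem coeff_atPoint (T : ι → ℝ) (x : Phase N) (U : PowerSeries (FieldFn N ι)) (j : ℕ) :
    PowerSeries.coeff j (atPoint T x U) =
      Complex.I ^ j * (((PowerSeries.coeff j U : FieldFn N ι) : _ → ℝ) (T, x) : ℂ) := by
  simp only [atPoint, RingHom.comp_apply, PowerSeries.coeff_rescale, PowerSeries.coeff_map]
  rfl

theorem atPoint_smul (T : ι → ℝ) (x : Phase N) (c : ℝ) (U : PowerSeries (FieldFn N ι)) :
    atPoint T x (c • U) = PowerSeries.C (c : ℂ) * atPoint T x U := by
  ext j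
  rw [coeff_atPoint, PowerSeries.coeff_C_mul, coeff_atPoint, PowerSeries.coeff_smul]
  have : ((c • PowerSeries.coeff j U : FieldFn N ι) : _ → ℝ) (T, x) =
    c * ((PowerSeries.coeff j U : FieldFn N ι) : _ → ℝ) (T, x) := rfl
  rw [this]
  push_cast
  ring

theorem hasFDerivAt_momentum (f : FieldFn N ι) (T : ι → ℝ) (b : Fin N → ℝ) (z : Phase N) :
    ∃ L : Phase N →L[ℝ] ℝ, HasFDerivAt (fun z : Phase N => (f : _ → ℝ) (T, (z.1, b))) L z ∧
      (∀ i, L (dirP i) = ((phaseDer N ι).d (Sum.inl i) f : _ → ℝ) (T, (z.1, b))) ∧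
      ∀ i, L (dirQ i) = 0 := by
  have h1 : HasFDerivAt (fun z : Phase N => ((z.1, b) : Phase N))
      ((ContinuousLinearMap.fst ℝ (Fin N → ℝ) (Fin N → ℝ)).prod 0) z :=
    hasFDerivAt_fst.prodMk (hasFDerivAt_const b z)
  have h2 : DifferentiableAt ℝ (fun y => (f : _ → ℝ) (T, y)) (z.1, b) :=
    (smoothFn.differentiable f).comp (by fun_prop) _
  have h3 := HasFDerivAt.comp (g := fun y => (f : _ → ℝ) (T, y)) z h2.hasFDerivAt h1
  refine ⟨_, h3, fun i => ?_, fun i => ?_⟩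
  · rw [phaseDer_apply]
    have h4 := (((smoothFn.differentiable f) (T, (z.1, b))).hasFDerivAt.comp (z.1, b)
      ((hasFDerivAt_const T (z.1, b)).prodMk (hasFDerivAt_id (z.1, b)))).fderiv
    change fderiv ℝ (fun y => (f : _ → ℝ) (T, y)) (z.1, b) = _ at h4
    rw [h4]
    rfl
  · exact map_zero (fderiv ℝ (fun y => (f : _ → ℝ) (T, y)) (z.1, b))

theorem hasFDerivAt_position (f : FieldFn N ι) (T : ι → ℝ) (a : Fin N → ℝ) (z : Phase N) :
    ∃ L : Phase N →L[ℝ] ℝ, HasFDerivAt (fun z : Phase N => (f : _ → ℝ) (T, (a, z.2))) L z ∧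
      (∀ i, L (dirQ i) = ((phaseDer N ι).d (Sum.inr i) f : _ → ℝ) (T, (a, z.2))) ∧
      ∀ i, L (dirP i) = 0 := by
  have h1 : HasFDerivAt (fun z : Phase N => ((a, z.2) : Phase N))
      ((0 : Phase N →L[ℝ] (Fin N → ℝ)).prod
        (ContinuousLinearMap.snd ℝ (Fin N → ℝ) (Fin N → ℝ))) z :=
    (hasFDerivAt_const a z).prodMk hasFDerivAt_snd
  have h2 : DifferentiableAt ℝ (fun y => (f : _ → ℝ) (T, y)) (a, z.2) :=
    (smoothFn.differentiable f).comp (by fun_prop) _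
  have h3 := HasFDerivAt.comp (g := fun y => (f : _ → ℝ) (T, y)) z h2.hasFDerivAt h1
  refine ⟨_, h3, fun i => ?_, fun i => ?_⟩
  · rw [phaseDer_apply]
    have h4 := (((smoothFn.differentiable f) (T, (a, z.2))).hasFDerivAt.comp (a, z.2)
      ((hasFDerivAt_const T (a, z.2)).prodMk (hasFDerivAt_id (a, z.2)))).fderiv
    change fderiv ℝ (fun y => (f : _ → ℝ) (T, y)) (a, z.2) = _ at h4
    rw [h4]
    rfl
  · exact map_zero (fderiv ℝ (fun y => (f : _ → ℝ) (T, y)) (a, z.2))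

/-- The products of functions of `(p̃, q)` and `(p, q̃)` at fixed `p`, `q`. -/
def splitProd (f U : FieldFn N ι) (T : ι → ℝ) (x z : Phase N) : ℝ :=
  (f : _ → ℝ) (T, (z.1, x.2)) * (U : _ → ℝ) (T, (x.1, z.2))

theorem fderiv_sum_splitProd {σ : Type*} (s : Finset σ) (c : σ → ℂ) (f U : σ → FieldFn N ι)
    (T : ι → ℝ) (x z : Phase N) :
    (∀ i, fderiv ℝ (fun z => ∑ a ∈ s, c a * (splitProd (f a) (U a) T x z : ℂ)) z (dirP i) =
      ∑ a ∈ s, c a * (splitProd ((phaseDer N ι).d (Sum.inl i) (f a)) (U a) T x z : ℂ)) ∧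
    ∀ i, fderiv ℝ (fun z => ∑ a ∈ s, c a * (splitProd (f a) (U a) T x z : ℂ)) z (dirQ i) =
      ∑ a ∈ s, c a * (splitProd (f a) ((phaseDer N ι).d (Sum.inr i) (U a)) T x z : ℂ) := by
  have key : ∀ a, ∃ L : Phase N →L[ℝ] ℂ,
      HasFDerivAt (fun z => c a * (splitProd (f a) (U a) T x z : ℂ)) L z ∧
      (∀ i, L (dirP i) =
        c a * (splitProd ((phaseDer N ι).d (Sum.inl i) (f a)) (U a) T x z : ℂ)) ∧
      ∀ i, L (dirQ i) =
        c a * (splitProd (f a) ((phaseDer N ι).d (Sum.inr i) (U a)) T x z : ℂ) := by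
    intro a
    obtain ⟨L, hL, hL1, hL2⟩ := hasFDerivAt_momentum (f a) T x.2 z
    obtain ⟨M, hM, hM1, hM2⟩ := hasFDerivAt_position (U a) T x.1 z
    refine ⟨_, (Complex.ofRealCLM.hasFDerivAt.comp z (hL.mul hM)).const_mul (c a),
      fun i => ?_, fun i => ?_⟩
    · simp only [smul_apply, ContinuousLinearMap.comp_apply, add_apply, hL1, hM2, splitProd,
        smul_eq_mul, mul_zero, zero_add, Complex.ofRealCLM_apply]
      push_cast
      ring
    · simp only [smul_apply, ContinuousLinearMap.comp_apply, add_apply, hM1, hL2, splitProd,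
        smul_eq_mul, mul_zero, add_zero, Complex.ofRealCLM_apply]
  choose L hL hL1 hL2 using key
  have h : fderiv ℝ (fun z => ∑ a ∈ s, c a * (splitProd (f a) (U a) T x z : ℂ)) z =
      ∑ a ∈ s, L a := (HasFDerivAt.fun_sum fun a _ => hL a).fderiv
  rw [h]
  refine ⟨fun i => ?_, fun i => ?_⟩
  · rw [sum_apply]
    exact Finset.sum_congr rfl fun a _ => hL1 a i
  · rw [sum_apply]
    exact Finset.sum_congr rfl fun a _ => hL2 a i

theorem starOp_sum_splitProd {σ : Type*} (s : Finset σ) (c : σ → ℂ) (f U : σ → FieldFn N ι)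
    (T : ι → ℝ) (x : Phase N) :
    starOp (fun z => ∑ a ∈ s, c a * (splitProd (f a) (U a) T x z : ℂ)) =
      fun z => ∑ b ∈ s ×ˢ (Finset.univ : Finset (Fin N)), c b.1 *
        (splitProd ((phaseDer N ι).d (Sum.inl b.2) (f b.1))
          ((phaseDer N ι).d (Sum.inr b.2) (U b.1)) T x z : ℂ) := by
  funext z
  rw [starOp, Finset.sum_product, Finset.sum_comm]
  refine Finset.sum_congr rfl fun i _ => ?_
  have h1 : (fun z => fderiv ℝ
      (fun z => ∑ a ∈ s, c a * (splitProd (f a) (U a) T x z : ℂ)) z (dirP i)) =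
      fun z => ∑ a ∈ s, c a *
        (splitProd ((phaseDer N ι).d (Sum.inl i) (f a)) (U a) T x z : ℂ) :=
    funext fun z => (fderiv_sum_splitProd s c f U T x z).1 i
  rw [h1, (fderiv_sum_splitProd s c (fun a => (phaseDer N ι).d (Sum.inl i) (f a)) U T x z).2 i]

/-- On a function of (p̃, q) times a function of (p, q̃), the momentum derivative sees only the
first factor and the position derivative only the second. Each step enlarges the index set by a
factor `Fin N`, hence the induction over all finite sums. -/
theorem starOp_iterate_splitProd {σ : Type*} (s : Finset σ) (c : σ → ℂ) (f U : σ → FieldFn N ι)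
    (T : ι → ℝ) (x : Phase N) (j : ℕ) :
    starOp^[j] (fun z => ∑ a ∈ s, c a * (splitProd (f a) (U a) T x z : ℂ)) x =
      ∑ a ∈ s, c a * (((starTerm (phaseDer N ι) j (f a) (U a) : FieldFn N ι) : _ → ℝ) (T, x) : ℂ) := by
  induction j generalizing σ with
  | zero => rfl
  | succ j ih =>
    rw [Function.iterate_succ_apply, starOp_sum_splitProd, ih _ (fun b : σ × Fin N => c b.1)
      (fun b => (phaseDer N ι).d (Sum.inl b.2) (f b.1))
      (fun b => (phaseDer N ι).d (Sum.inr b.2) (U b.1)), Finset.sum_product]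
    refine Finset.sum_congr rfl fun a _ => ?_
    dsimp only
    rw [starTerm, ← Finset.mul_sum]
    congr 1
    rw [← evalAt_apply, map_sum, Complex.ofReal_sum]
    rfl

/-- The function `⟨H, T⟩` of `T` and `(p, q)`. -/
def hamFn (H : ι → Phase N → ℝ) (hH : ∀ α, ContDiff ℝ ∞ (H α)) : FieldFn N ι :=
  ⟨fun y => pairHT H y.1 y.2, ContDiff.sum fun α _ =>
    ((contDiff_apply ℝ ℝ α).comp contDiff_fst).mul ((hH α).comp contDiff_snd)⟩

/-- The algebraic star power has the variable X where the analytic one has iħ; the rescaling by i in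
`atPoint` accounts for the difference. -/
theorem starPow_eq_atPoint (H : ι → Phase N → ℝ) (hH : ∀ α, ContDiff ℝ ∞ (H α)) (T : ι → ℝ)
    (n : ℕ) (x : Phase N) :
    starPow (pairHT H T) n x = atPoint T x (starPower (phaseDer N ι) (hamFn H hH) n) := by
  induction n generalizing x with
  | zero => rw [starPow, starPower, map_one]
  | succ n ih =>
    rw [starPow, starProd, starPower]
    ext k
    rw [PowerSeries.coeff_mk, coeff_atPoint, starMul, PowerSeries.coeff_mk, ← evalAt_apply,
      map_sum, Complex.ofReal_sum, Finset.mul_sum]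
    refine Finset.sum_congr rfl fun p hp => ?_
    rw [Finset.HasAntidiagonal.mem_antidiagonal] at hp
    have hF : (fun y : Phase N => PowerSeries.coeff p.2
        (PowerSeries.C (pairHT H T (y.1, x.2) : ℂ) * starPow (pairHT H T) n (x.1, y.2))) =
        fun y => ∑ a ∈ (Finset.univ : Finset Unit), Complex.I ^ p.2 *
          (splitProd (hamFn H hH) (PowerSeries.coeff p.2
            (starPower (phaseDer N ι) (hamFn H hH) n)) T x y : ℂ) := by
      funext y
      rw [PowerSeries.coeff_C_mul, ih, coeff_atPoint, Finset.sum_const, Finset.card_univ,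
        Fintype.card_unit, one_smul, splitProd]
      push_cast
      change _ = _ * ((pairHT H T (y.1, x.2) : ℂ) * _)
      ring
    rw [hF, starOp_iterate_splitProd _ (fun _ => Complex.I ^ p.2) (fun _ => hamFn H hH)
      (fun _ => PowerSeries.coeff p.2 (starPower (phaseDer N ι) (hamFn H hH) n)), Finset.sum_const,
      Finset.card_univ, Fintype.card_unit, one_smul, map_smul, evalAt_apply, smul_eq_mul, ← hp,
      pow_add]
    push_cast
    ring

end AtPoint

/-! ### The sum of all diagrams is a star power. -/

section StarIntegral

open MeasureTheory

variable {N : ℕ} {ι : Type*} [Fintype ι]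

theorem gaussCoeff_const {V : Type} [Fintype V] (k : FieldFn N ι) (T : ι → ℝ) (x : Phase N)
    (t : V → ℝ) (j : ℕ) : gaussCoeff (fun _ => k) T x t j =
      ((PowerSeries.coeff j (mapLin (ev fun _ : V => (phaseDer N ι).jet k)
        (expX (timeEdges N t))) : FieldFn N ι) : _ → ℝ) (T, x) := by
  rw [gaussCoeff, coeff_mapLin, coeff_mapLin, fieldEv_const]

/-- The Mayer expansion is integrated term by term; only the Heaviside factors depend on the times.
-/
theorem integral_gaussCoeff_eq_graphSum (ta tb : ℝ) (n : ℕ) (k : FieldFn N ι) (T : ι → ℝ)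
    (x : Phase N) (j : ℕ) :
    ∫ t in Set.Icc (fun _ : Fin n => ta) (fun _ => tb), gaussCoeff (fun _ => k) T x t j =
      ((PowerSeries.coeff j (graphSum ta tb ((phaseDer N ι).jet k) (Fin n)) : FieldFn N ι) : _ → ℝ) (T, x) := by
  simp only [gaussCoeff_eq_sum]
  rw [integral_finsetSum]
  · rw [graphSum, map_sum, ← evalAt_apply, map_sum]
    refine Finset.sum_congr rfl fun E _ => ?_
    rw [integral_mul_const, graphWeight, PowerSeries.coeff_smul, map_smul, coeff_mapLin,
      fieldEv_const]
    rfl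
  · intro E _
    exact ((BddMeas.prod _ fun e _ => BddMeas.heaviside (by fun_prop)).mul
      (BddMeas.const _)).integrable

/-- At distinct times the integrand is a star power independent of the times; the volume (tb - ta)^n
is absorbed into the function. -/
theorem integral_gaussCoeff_eq_starPower {ta tb : ℝ} (hab : ta ≤ tb) (n : ℕ) (k : FieldFn N ι)
    (T : ι → ℝ) (x : Phase N) (j : ℕ) :
    ∫ t in Set.Icc (fun _ : Fin n => ta) (fun _ => tb), gaussCoeff (fun _ => k) T x t j =
      ((PowerSeries.coeff j (starPower (phaseDer N ι) ((tb - ta) • k) n) : FieldFn N ι) : _ → ℝ) (T, x) := by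
  have h : ∀ᵐ t ∂(volume.restrict (Set.Icc (fun _ : Fin n => ta) (fun _ => tb))),
      gaussCoeff (fun _ => k) T x t j =
        ((PowerSeries.coeff j (starPower (phaseDer N ι) k n) : FieldFn N ι) : _ → ℝ) (T, x) := by
    filter_upwards [ae_cube_injective ta tb] with t ht
    rw [gaussCoeff_const, mapLin_ev_expX_of_injective _ _ _ ht]
  rw [integral_congr_ae h, setIntegral_const, volume_cube hab, Fintype.card_fin,
    starPower_smul, PowerSeries.coeff_smul]
  rfl

theorem graphSum_eq_starPower {ta tb : ℝ} (hab : ta ≤ tb) (n : ℕ) (k : FieldFn N ι) :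
    graphSum ta tb ((phaseDer N ι).jet k) (Fin n) =
      starPower (phaseDer N ι) ((tb - ta) • k) n := by
  ext j : 1
  refine Subtype.ext (funext fun y => ?_)
  rw [← integral_gaussCoeff_eq_starPower hab, integral_gaussCoeff_eq_graphSum]

end StarIntegral

/-! ### The physical partition function and its star-exponential form. -/

section PhysicalPart

variable {N : ℕ} {ι : Type*} [Fintype ι]

theorem ghostWick_algebraMap [DecidableEq ι] (ta tb : ℝ) (a : Kħ) :
    ghostWick ta tb (algebraMap Kħ (GrField ι) a) = algebraMap Kħ (GrParam ι) a := by
  rw [ghostWick, LinearMap.comp_apply, CliffordAlgebra.changeForm_algebraMap]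
  exact AlgHom.commutes _ a

theorem grCoeff_algebraMap [DecidableEq ι] (S : Finset (ParamGen ι)) (a : Kħ) :
    grCoeff S (algebraMap Kħ (GrParam ι) a) = if S = ∅ then a else 0 := by
  rw [grCoeff]
  rcases hl : S.toList with _ | ⟨s, l⟩
  · rw [Finset.toList_eq_nil] at hl
    rw [if_pos hl, List.foldl_nil, ExteriorAlgebra.algebraMap_leftInverse]
  · have hS : S ≠ ∅ := by
      rintro rfl
      simp at hl
    have h0 : CliffordAlgebra.contractLeft (Q := (0 : QuadraticForm Kħ (ParamGen ι →₀ Kħ)))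
        (Finsupp.lapply s) (algebraMap Kħ (GrParam ι) a) = 0 :=
      CliffordAlgebra.contractLeft_algebraMap _ _ a
    have hz : ∀ l : List (ParamGen ι), l.foldl (fun (y : GrParam ι) s =>
        CliffordAlgebra.contractLeft (Finsupp.lapply s) y) 0 = 0 := by
      intro l
      induction l with
      | nil => rfl
      | cons s l ih => rw [List.foldl_cons, map_zero, ih]
    rw [if_neg hS, List.foldl_cons, h0, hz, map_zero]

theorem prod_ofFn_algebraMap {n : ℕ} (g : Fin n → Kħ) :
    (List.ofFn fun r => algebraMap Kħ (GrField ι) (g r)).prod =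
      algebraMap Kħ (GrField ι) (∏ r, g r) := by
  rw [← List.prod_ofFn, map_list_prod, List.map_ofFn]
  rfl

theorem grExp_zero : grExp (0 : GrField ι) = 1 := by
  have h : nilpotencyClass (0 : GrField ι) = 1 := nilpotencyClass_zero
  rw [grExp, h]
  simp [cst]

theorem bvDensity_phys (f : ι → ι → ι → ℝ) (H : ι → Phase N → ℝ) (x : Phase N) (e : ι → ℝ) :
    bvDensity f H x e 0 0 0 0 0 =
      algebraMap Kħ (GrField ι) (cst ((-∑ α, e α * H α x : ℝ) : ℂ)) := by
  rw [bvDensity]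
  simp only [Pi.zero_apply, smul_zero, mul_zero, Finset.sum_const_zero, add_zero,
    sub_zero]
  rw [← Finset.sum_smul, ← Algebra.algebraMap_eq_smul_one, ← map_neg]
  congr 1
  simp only [cst, Complex.ofReal_neg, Complex.ofReal_sum, map_neg, map_sum]

/-- The function `-⟨H, T⟩/(tb - ta)` of `T` and `(p, q)`. -/
def densFn (ta tb : ℝ) (H : ι → Phase N → ℝ) (hH : ∀ α, ContDiff ℝ ∞ (H α)) : FieldFn N ι :=
  (-(tb - ta)⁻¹) • hamFn H hH

theorem densFn_apply (ta tb : ℝ) (H : ι → Phase N → ℝ) (hH : ∀ α, ContDiff ℝ ∞ (H α))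
    (T : ι → ℝ) (x : Phase N) :
    (densFn ta tb H hH : _ → ℝ) (T, x) = -∑ α, T α / (tb - ta) * H α x := by
  change -(tb - ta)⁻¹ * ∑ α, T α * H α x = _
  rw [neg_mul, Finset.mul_sum]
  congr 1
  refine Finset.sum_congr rfl fun α _ => ?_
  ring

theorem grMonomial_empty : grMonomial (∅ : Finset (ParamGen ι)) = 1 := by
  simp [grMonomial]

/-- The coefficients of the physical partition function. -/
theorem ZIphys_eq [DecidableEq ι] {ta tb : ℝ} (f : ι → ι → ι → ℝ) (H : ι → Phase N → ℝ)
    (hH : ∀ α, ContDiff ℝ ∞ (H α)) (qa pb : Fin N → ℝ) (T : ι → ℝ) :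
    ZIphys ta tb f H qa pb T = AddMonoidAlgebra.single (sourceWeight ta tb qa pb)
      (scalarState (PowerSeries.mk fun n => cst (1 / (n.factorial : ℂ)) * iOverHbar ^ n *
        ofħ (atPoint T (pb, qa)
          (graphSum ta tb ((phaseDer N ι).jet (densFn ta tb H hH)) (Fin n))))) := by
  rw [ZIphys, feynmanIntegral]
  congr 1
  ext n
  rw [PowerSeries.coeff_mk, scalarState, PowerSeries.coeff_map, PowerSeries.coeff_mk,
    Finset.sum_eq_single ∅]
  · have hF : physIntegral ta tb qa pb (n := n) (fun t x => grCoeff ∅ (ghostWick ta tb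
        (grExp (iOverHbar • (0 : GrField ι)) * (List.ofFn fun r =>
          bvDensity f H (x r) (fun α => T α / (tb - ta)) 0 0 0 0 0).prod))) =
        ofħ (atPoint T (pb, qa)
          (graphSum ta tb ((phaseDer N ι).jet (densFn ta tb H hH)) (Fin n))) := by
      -- One term suffices: time factor 1, and the same density at every vertex.
      rw [physIntegral_eq qa pb (Finset.univ : Finset Unit) (fun _ _ => 1)
        (fun _ _ => BddMeas.const 1) (fun _ _ => densFn ta tb H hH) T (fun _ => 1)]
      · rw [Finset.sum_const, Finset.card_univ, Fintype.card_unit, one_smul, one_mul]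
        congr 1
        ext j
        rw [PowerSeries.coeff_mk, coeff_atPoint, ← integral_gaussCoeff_eq_graphSum]
        simp only [one_mul]
      · intro t x
        rw [smul_zero, grExp_zero, one_mul, Finset.sum_const, Finset.card_univ,
          Fintype.card_unit, one_smul, mul_one, one_mul]
        simp only [bvDensity_phys, densFn_apply]
        rw [prod_ofFn_algebraMap, ghostWick_algebraMap, grCoeff_algebraMap, if_pos rfl]
        simp only [cst, Complex.ofReal_prod, map_prod]
    rw [hF, grMonomial_empty, Algebra.algebraMap_eq_smul_one]
  · intro S _ hS
    have hF : physIntegral ta tb qa pb (n := n) (fun t x => grCoeff S (ghostWick ta tb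
        (grExp (iOverHbar • (0 : GrField ι)) * (List.ofFn fun r =>
          bvDensity f H (x r) (fun α => T α / (tb - ta)) 0 0 0 0 0).prod))) = 0 := by
      -- Without odd parameters the coefficient of a nonempty monomial vanishes, so the integrand is
      -- the empty sum.
      rw [physIntegral_eq qa pb (∅ : Finset Unit) (fun _ _ => 1)
        (fun _ _ => BddMeas.const 1) (fun _ _ => densFn ta tb H hH) T (fun _ => 1)]
      · simp
      · intro t x
        rw [smul_zero, grExp_zero, one_mul]
        simp only [bvDensity_phys]
        rw [prod_ofFn_algebraMap, ghostWick_algebraMap, grCoeff_algebraMap, if_neg hS,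
          Finset.sum_empty]
    rw [hF, mul_zero, zero_smul]
  · intro h
    exact absurd (Finset.mem_univ _) h

theorem sourceWeight_eq {ta tb : ℝ} (hab : ta < tb) (qa pb : Fin N → ℝ) :
    sourceWeight ta tb qa pb = -Complex.I * ((∑ i, pb i * qa i : ℝ) : ℂ) := by
  rw [sourceWeight, heaviside, if_pos (sub_pos.mpr hab), one_mul, Complex.I_sq]
  ring

/-- The factor 1/(tb - ta) of the density cancels the length of the time interval. -/
theorem graphSum_densFn {ta tb : ℝ} (hab : ta < tb) (H : ι → Phase N → ℝ)
    (hH : ∀ α, ContDiff ℝ ∞ (H α)) (n : ℕ) :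
    graphSum ta tb ((phaseDer N ι).jet (densFn ta tb H hH)) (Fin n) =
      starPower (phaseDer N ι) (-hamFn H hH) n := by
  rw [graphSum_eq_starPower hab.le, densFn, smul_smul, mul_neg,
    mul_inv_cancel₀ (sub_pos.mpr hab).ne', neg_smul, one_smul]

/-- The star-exponential form of the physical partition function. -/
theorem ZIphys_eq_starExp [DecidableEq ι] {ta tb : ℝ} (hab : ta < tb) (f : ι → ι → ι → ℝ)
    (H : ι → Phase N → ℝ) (hH : ∀ α, ContDiff ℝ ∞ (H α)) (qa pb : Fin N → ℝ) (T : ι → ℝ) :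
    ZIphys ta tb f H qa pb T =
      AddMonoidAlgebra.single (-Complex.I * ((∑ i, pb i * qa i : ℝ) : ℂ))
        (scalarState (starExp (pairHT H T) (pb, qa))) := by
  rw [ZIphys_eq f H hH, sourceWeight_eq hab]
  congr 2
  ext n
  rw [PowerSeries.coeff_mk, starExp, PowerSeries.coeff_mk, starPow_eq_atPoint H hH,
    graphSum_densFn hab, ← neg_one_smul ℝ (hamFn H hH), starPower_smul, atPoint_smul, map_mul,
    neg_pow iOverHbar]
  simp only [Complex.ofReal_pow, Complex.ofReal_neg, Complex.ofReal_one, map_pow, map_neg, map_one]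
  ring

end PhysicalPart

/-! ### The exponential formula. -/

section FormalExponential

open PowerSeries

/-- Complex constants in `ℂ((ħ))`, as a ring homomorphism. -/
def cstHom : ℂ →+* Kħ := ofħ.comp PowerSeries.C

theorem cstHom_apply (z : ℂ) : cstHom z = cst z := rfl

/-- `ℂ((ħ))` as a real algebra. -/
abbrev realAlgebraKħ : Algebra ℝ Kħ := (cstHom.comp Complex.ofRealHom).toAlgebra

theorem derivative_expSeries {W : PowerSeries Kħ} (h0 : constantCoeff W = 0) :
    derivative Kħ (expSeries W) = derivative Kħ W * expSeries W := by
  have hX : ∀ m, X ^ m ∣ W ^ m := fun m => pow_dvd_pow_of_dvd (X_dvd_iff.mpr h0) m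
  ext n
  have h1 : coeff n (derivative Kħ (expSeries W)) = ∑ m ∈ Finset.range (n + 2),
      cst (1 / (m.factorial : ℂ)) * coeff n (derivative Kħ (W ^ m)) := by
    rw [coeff_derivative, expSeries, coeff_mk, Finset.sum_mul]
    refine Finset.sum_congr rfl fun m _ => ?_
    rw [coeff_derivative, mul_assoc]
  have h2 : ∀ m : ℕ, cst (1 / ((m + 1).factorial : ℂ)) * coeff n (derivative Kħ (W ^ (m + 1))) =
      cst (1 / (m.factorial : ℂ)) * coeff n (derivative Kħ W * W ^ m) := by
    intro m
    have h3 : derivative Kħ (W ^ (m + 1)) =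
        PowerSeries.C (cstHom ((m : ℂ) + 1)) * (derivative Kħ W * W ^ m) := by
      rw [Derivation.leibniz_pow, smul_eq_mul, nsmul_eq_mul, Nat.add_sub_cancel, map_add, map_one,
        map_natCast, map_add, map_natCast, map_one]
      push_cast
      ring
    rw [h3, coeff_C_mul, ← mul_assoc, ← cstHom_apply, ← cstHom_apply, ← map_mul]
    congr 2
    rw [Nat.factorial_succ]
    have h4 : (m.factorial : ℂ) ≠ 0 := Nat.cast_ne_zero.mpr m.factorial_ne_zero
    have h5 : (m : ℂ) + 1 ≠ 0 := Nat.cast_add_one_ne_zero m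
    push_cast
    field_simp
  have hone : derivative Kħ (W ^ 0) = 0 := by
    rw [pow_zero, Derivation.map_one_eq_zero]
  rw [h1, Finset.sum_range_succ', hone, map_zero, mul_zero, add_zero,
    Finset.sum_congr rfl fun m _ => h2 m, coeff_mul]
  simp only [coeff_mul, Finset.mul_sum]
  rw [Finset.sum_comm]
  refine Finset.sum_congr rfl fun p hp => ?_
  rw [Finset.HasAntidiagonal.mem_antidiagonal] at hp
  rw [expSeries, coeff_mk, Finset.mul_sum]
  -- `W ^ m` starts in degree m, so the truncation in `expSeries` may be enlarged to a common range.
  have hsub : Finset.range (p.2 + 1) ⊆ Finset.range (n + 1) :=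
    Finset.range_subset_range.mpr (by omega)
  rw [← Finset.sum_subset hsub]
  · refine Finset.sum_congr rfl fun m _ => ?_
    ring
  · intro m _ hm
    rw [Finset.mem_range, not_lt] at hm
    rw [X_pow_dvd_iff.mp (hX m) p.2 (by omega), mul_zero, mul_zero]

theorem expSeries_eq_of_derivative {W Y : PowerSeries Kħ} (h0 : constantCoeff W = 0)
    (hY : derivative Kħ Y = derivative Kħ W * Y) (hY0 : constantCoeff Y = 1) :
    expSeries W = Y := by
  let := realAlgebraKħ
  rw [← sub_eq_zero]
  refine eq_zero_of_derivative_eq_mul (G := derivative Kħ W) ?_ ?_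
  · rw [map_sub, derivative_expSeries h0, hY]
    ring
  · rw [map_sub, hY0, ← coeff_zero_eq_constantCoeff_apply, expSeries, coeff_mk]
    simp [← cstHom_apply]

/-- The exponential formula. -/
theorem expSeries_egf {Z W : ℕ → Kħ} (hZ0 : Z 0 = 1) (hW0 : W 0 = 0)
    (h : ∀ n, Z (n + 1) = ∑ k ∈ Finset.range (n + 1), n.choose k • (W (k + 1) * Z (n - k))) :
    expSeries (PowerSeries.mk fun n => cst (1 / (n.factorial : ℂ)) * W n) =
      PowerSeries.mk fun n => cst (1 / (n.factorial : ℂ)) * Z n := by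
  let := realAlgebraKħ
  have hegf : ∀ Z : ℕ → Kħ, (PowerSeries.mk fun n => cst (1 / (n.factorial : ℂ)) * Z n) =
      egf Z := by
    intro Z
    ext n
    rw [coeff_mk, egf, coeff_mk, Algebra.smul_def]
    congr 1
    change _ = cstHom (((n.factorial : ℝ)⁻¹ : ℝ) : ℂ)
    rw [cstHom_apply, one_div]
    push_cast
    rfl
  rw [hegf, hegf]
  refine expSeries_eq_of_derivative ?_ ?_ ?_
  · rw [← coeff_zero_eq_constantCoeff_apply, egf, coeff_mk, hW0, smul_zero]
  · rw [derivative_egf, derivative_egf, egf_mul]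
    congr 1
    funext n
    exact h n
  · rw [← coeff_zero_eq_constantCoeff_apply, egf, coeff_mk, hZ0]
    simp

theorem iOverHbar_mul_ofħ_X : iOverHbar * ofħ PowerSeries.X = cst Complex.I := by
  have hX : ofħ PowerSeries.X = (HahnSeries.single (1 : ℤ) (1 : ℂ) : LaurentSeries ℂ) :=
    HahnSeries.ofPowerSeries_X
  have hC : cst Complex.I = (HahnSeries.C Complex.I : LaurentSeries ℂ) :=
    HahnSeries.ofPowerSeries_C Complex.I
  rw [hX, hC, iOverHbar]
  exact (HahnSeries.single_mul_single (R := ℂ) (a := (-1 : ℤ)) (b := 1)).trans (by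
    rw [mul_one]
    rfl)

end FormalExponential

/-! ### Formal action, tree diagrams and the Hamilton-Jacobi equation. -/

section SemiclassicalExpansion

open PowerSeries MeasureTheory

variable {N : ℕ} {ι : Type*} [Fintype ι]

/-- The connected parts of the physical partition function. -/
def connectedPart (ta tb : ℝ) (H : ι → Phase N → ℝ) (hH : ∀ α, ContDiff ℝ ∞ (H α)) :
    ℕ → PowerSeries (FieldFn N ι)
  | 0 => 0
  | n + 1 => connectedSum ta tb ((phaseDer N ι).jet (densFn ta tb H hH)) (Fin (n + 1))

/-- The formal action. -/
def formalAction (ta tb : ℝ) (H : ι → Phase N → ℝ) (hH : ∀ α, ContDiff ℝ ∞ (H α))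
    (x : Phase N) (T : ι → ℝ) : PowerSeries (PowerSeries ℂ) :=
  PowerSeries.mk fun n => PowerSeries.C (Complex.I ^ (n - 1) / (n.factorial : ℂ)) *
    PowerSeries.mk fun j => PowerSeries.coeff (j + (n - 1)) (atPoint T x (connectedPart ta tb H hH n))

/-- The leading terms of the formal action. -/
def leadingAction (ta tb : ℝ) (H : ι → Phase N → ℝ) (hH : ∀ α, ContDiff ℝ ∞ (H α)) (n : ℕ) :
    FieldFn N ι :=
  ((-1) ^ (n - 1) / (n.factorial : ℝ)) • coeff (n - 1) (connectedPart ta tb H hH n)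

variable {ta tb : ℝ} (H : ι → Phase N → ℝ) (hH : ∀ α, ContDiff ℝ ∞ (H α))

theorem X_pow_dvd_connectedPart (n : ℕ) : X ^ (n - 1) ∣ connectedPart ta tb H hH n := by
  rcases n with _ | n
  · exact dvd_zero _
  · exact X_pow_dvd_connectedSum _ _ _ _

/-- The shift in `formalAction` is a true division by ħ^(n-1), as the connected part is divisible by
that power. -/
theorem X_pow_mul_shift (x : Phase N) (T : ι → ℝ) (n : ℕ) :
    X ^ (n - 1) * (PowerSeries.mk fun j => PowerSeries.coeff (j + (n - 1))
      (atPoint T x (connectedPart ta tb H hH n))) = atPoint T x (connectedPart ta tb H hH n) := by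
  ext j
  rw [coeff_X_pow_mul']
  split_ifs with h
  · rw [coeff_mk, Nat.sub_add_cancel h]
  · rw [coeff_atPoint, X_pow_dvd_iff.mp (X_pow_dvd_connectedPart H hH n) j (by omega)]
    simp

theorem constantCoeff_formalAction (x : Phase N) (T : ι → ℝ) :
    constantCoeff (formalAction ta tb H hH x T) = 0 := by
  rw [← coeff_zero_eq_constantCoeff_apply, formalAction, coeff_mk, connectedPart, map_zero]
  simp only [map_zero]
  exact mul_zero _

/-- The sign (-1)^(n-1) is a product of two factors i^(n-1): one from `formalAction`, one from
replacing the formal variable by iħ. -/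
theorem leading_formalAction (x : Phase N) (T : ι → ℝ) (n : ℕ) :
    constantCoeff (coeff n (formalAction ta tb H hH x T)) =
      ((leadingAction ta tb H hH n : _ → ℝ) (T, x) : ℂ) := by
  rw [formalAction, coeff_mk, map_mul, ← coeff_zero_eq_constantCoeff_apply (PowerSeries.mk _),
    coeff_mk, coeff_atPoint, zero_add]
  change _ = (((-1) ^ (n - 1) / (n.factorial : ℝ) * ((coeff (n - 1)
    (connectedPart ta tb H hH n) : FieldFn N ι) : _ → ℝ) (T, x) : ℝ) : ℂ)
  rw [constantCoeff_C]
  push_cast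
  rw [← Complex.I_sq]
  ring

/-- The linked cluster recursion, with the sums of all diagrams rewritten as star powers. -/
theorem connectedPart_recursion (hab : ta < tb) (n : ℕ) :
    starPower (phaseDer N ι) (-hamFn H hH) (n + 1) = ∑ k ∈ Finset.range (n + 1),
      n.choose k • (connectedPart ta tb H hH (k + 1) *
        starPower (phaseDer N ι) (-hamFn H hH) (n - k)) := by
  rw [← graphSum_densFn hab, graphSum_succ]
  simp only [graphSum_densFn hab]
  rfl

/-- Multiplying the linked cluster recursion by powers of i/ħ gives the recursion of the exponential
formula. -/
theorem ZIphys_eq_expAction [DecidableEq ι] (hab : ta < tb) (f : ι → ι → ι → ℝ)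
    (qa pb : Fin N → ℝ) (T : ι → ℝ) :
    ZIphys ta tb f H qa pb T = expAction (-((∑ i, pb i * qa i : ℝ) : ℂ))
      (formalAction ta tb H hH (pb, qa) T) := by
  have hZ := expSeries_egf
    (Z := fun n => iOverHbar ^ n * ofħ (atPoint T (pb, qa)
      (graphSum ta tb ((phaseDer N ι).jet (densFn ta tb H hH)) (Fin n))))
    (W := fun n => iOverHbar ^ n * ofħ (atPoint T (pb, qa) (connectedPart ta tb H hH n)))
    (by simp only [graphSum_densFn hab, starPower, map_one, pow_zero, mul_one])
    (by simp only [connectedPart, map_zero, mul_zero])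
    (fun n => by
      simp only [graphSum_densFn hab]
      rw [connectedPart_recursion H hH hab, map_sum, map_sum, Finset.mul_sum]
      refine Finset.sum_congr rfl fun k hk => ?_
      have hk : n + 1 = (k + 1) + (n - k) := by
        have := Finset.mem_range.mp hk
        omega
      rw [map_nsmul, map_nsmul, map_mul, map_mul, mul_smul_comm]
      congr 1
      rw [hk, pow_add]
      have : k + 1 + (n - k) - 1 - k = n - k := by omega
      ring)
  rw [ZIphys_eq f H hH, sourceWeight_eq hab, expAction, neg_mul, mul_neg]
  congr 2
  have h2 : (PowerSeries.C iOverHbar * PowerSeries.map ofħ (formalAction ta tb H hH (pb, qa) T)) =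
      PowerSeries.mk fun n => cst (1 / (n.factorial : ℂ)) *
        (iOverHbar ^ n * ofħ (atPoint T (pb, qa) (connectedPart ta tb H hH n))) := by
    ext n
    rw [coeff_C_mul, coeff_map, formalAction, coeff_mk, coeff_mk]
    rcases n with _ | n
    · simp only [connectedPart, map_zero, mul_zero]
      have : (PowerSeries.mk fun _ => (0 : ℂ)) = 0 := rfl
      rw [this]
      simp
    · conv_rhs => rw [← X_pow_mul_shift H hH, map_mul, map_pow]
      rw [map_mul, Nat.add_sub_cancel,
        div_eq_mul_one_div, map_mul, map_mul, map_pow, map_pow]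
      change iOverHbar * (cst Complex.I ^ n * cst _ * _) = _
      -- With i = (i/ħ)·ħ, the factor i^(n-1) and the shift by ħ^(n-1) recombine to (i/ħ)^n times
      -- the connected part.
      rw [← iOverHbar_mul_ofħ_X]
      ring
  rw [h2, hZ]
  congr 1
  funext n
  rw [mul_assoc]

theorem leadingAction_eq_treeAction (qa pb : Fin N → ℝ) (T : ι → ℝ) (n : ℕ) :
    ((leadingAction ta tb H hH n : _ → ℝ) (T, (pb, qa)) : ℂ) =
      treeAction H ta tb qa pb n T := by
  change (((-1) ^ (n - 1) / (n.factorial : ℝ) * ((coeff (n - 1)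
    (connectedPart ta tb H hH n) : FieldFn N ι) : _ → ℝ) (T, (pb, qa)) : ℝ) : ℂ) = _
  rw [treeAction, Complex.ofReal_mul]
  congr 1
  · push_cast
    rfl
  rcases n with _ | n
  -- There is no tree without vertices; this matches the vanishing connected part in degree 0.
  · have h0 : orientedTrees 0 = ∅ := by
      refine Finset.eq_empty_of_forall_notMem fun E hE => ?_
      have := (mem_orientedTrees.mp hE).2
      omega
    rw [h0, Finset.sum_empty, connectedPart, map_zero]
    simp
  · rw [connectedPart, Nat.add_sub_cancel, coeff_connectedSum, ← evalAt_apply, map_sum,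
      Complex.ofReal_sum]
    refine Finset.sum_congr rfl fun E _ => ?_
    rw [map_smul, smul_eq_mul, Complex.ofReal_mul]
    congr 1
    · rw [timeWeight, ← integral_complex_ofReal]
      simp only [Complex.ofReal_prod]
    · have h1 : (fun x : Fin (n + 1) → Phase N => ∏ r, (-(pairHT H T (x r) / (tb - ta)) : ℂ)) =
          fun x => ((∏ r, (densFn ta tb H hH : _ → ℝ) (T, x r) : ℝ) : ℂ) := by
        funext x
        rw [Complex.ofReal_prod]
        refine Finset.prod_congr rfl fun r _ => ?_
        change _ = ((-(tb - ta)⁻¹ * pairHT H T (x r) : ℝ) : ℂ)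
        push_cast
        ring
      rw [h1, foldr_edgeOp_fieldEv (fun _ => densFn ta tb H hH), Finset.prod_map_toList]
      exact congrArg _ (fieldEv_const _ _ _ _).symm

/-- The generating series of the leading terms. -/
def leadingSeries (ta tb : ℝ) (H : ι → Phase N → ℝ) (hH : ∀ α, ContDiff ℝ ∞ (H α)) :
    PowerSeries (FieldFn N ι) := PowerSeries.mk (leadingAction ta tb H hH)

theorem map_taylorTerm {𝓕 𝓑 𝓒 : Type*} [CommRing 𝓕] [Algebra ℝ 𝓕] [CommRing 𝓑] [CommRing 𝓒]
    (D : CommDer (Fin N ⊕ Fin N) 𝓕) (ψ : 𝓑 →+* 𝓒) (φ : 𝓕 → 𝓑) (c : Fin N → 𝓑) (j : ℕ) (f : 𝓕) :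
    ψ (taylorTerm D φ c j f) = taylorTerm D (fun f => ψ (φ f)) (fun k => ψ (c k)) j f := by
  induction j generalizing f with
  | zero => rfl
  | succ j ih => simp only [taylorTerm, map_sum, map_mul, ih]

/-- The leading terms of the formal action satisfy the Hamilton–Jacobi equation. -/
theorem hamiltonJacobi_leadingAction (hab : ta < tb) (n : ℕ) :
    ((n : ℝ) + 1) • leadingAction ta tb H hH (n + 1) =
      ∑ j ∈ Finset.range (n + 1), ((j.factorial : ℝ)⁻¹) •
        coeff n (taylorTerm (phaseDer N ι) PowerSeries.C
          (fun k => -mapDer ((phaseDer N ι).d (Sum.inr k)) (leadingSeries ta tb H hH)) j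
          (-hamFn H hH)) := by
  have h := hamiltonJacobi_leading (phaseDer N ι) (-hamFn H hH) (connectedPart ta tb H hH) rfl
    (fun n => X_pow_dvd_connectedPart H hH (n + 1)) (connectedPart_recursion H hH hab) n
  simp only at h
  set v : PowerSeries (FieldFn N ι) := egf fun n => coeff (n - 1) (connectedPart ta tb H hH n)
    with hv
  have hresc : ∀ (F : PowerSeries (FieldFn N ι)) (m : ℕ),
      coeff m (rescale (-1 : FieldFn N ι) F) = ((-1 : ℝ) ^ m) • coeff m F := by
    intro F m
    rw [coeff_rescale, Algebra.smul_def, map_pow, map_neg, map_one]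
  have hlead : ∀ m, leadingAction ta tb H hH (m + 1) = ((-1 : ℝ) ^ m) • coeff (m + 1) v := by
    intro m
    rw [hv, egf, coeff_mk, leadingAction, div_eq_mul_inv, mul_smul, Nat.add_sub_cancel]
  -- S(ε) = -v(-ε), which turns v' = f(p + ∂v, q) with f = -⟨H,T⟩ into S' = -⟨H,T⟩(p - ∂S, q).
  have hs : leadingSeries ta tb H hH = -rescale (-1 : FieldFn N ι) v := by
    ext1 m
    rw [leadingSeries, coeff_mk, map_neg, hresc]
    rcases m with _ | m
    · simp [leadingAction, hv, egf, connectedPart]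
    · rw [hlead, pow_succ, mul_neg_one, neg_smul, neg_neg]
  rw [hlead, smul_comm, h, Finset.smul_sum]
  refine Finset.sum_congr rfl fun j _ => ?_
  rw [smul_comm, ← hresc, map_taylorTerm]
  congr 3
  · funext g
    ext1 m
    rw [hresc, coeff_C]
    split_ifs with hm
    · rw [hm, pow_zero, one_smul]
    · rw [smul_zero]
  · funext k
    ext1 m
    rw [hs, hresc, map_neg, map_neg, map_neg, neg_neg, coeff_mapDer, coeff_mapDer, hresc, Derivation.map_smul]

end SemiclassicalExpansion

/-! ### Expansion of products of commuting vertices. -/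

section CommutingElements

universe u v w

variable {R : Type u} {A : Type v} {τ : Type w} [CommRing R] [Ring A] [Algebra R A]

/-- Pairwise commuting elements lie in the image of a commutative algebra. -/
theorem exists_commRing_of_commute (g : τ → A) (hg : ∀ s t, Commute (g s) (g t)) :
    ∃ (C : Type v) (_ : CommRing C) (_ : Algebra R C) (ψ : C →ₐ[R] A) (c : τ → C),
      ∀ t, ψ (c t) = g t := by
  have hcomm : ∀ a ∈ Set.range g, ∀ b ∈ Set.range g, a * b = b * a := by
    rintro _ ⟨s, rfl⟩ _ ⟨t, rfl⟩
    exact hg s t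
  have := Algebra.isMulCommutative_adjoin R hcomm
  exact ⟨↥(Algebra.adjoin R (Set.range g)),
    { (inferInstance : Ring ↥(Algebra.adjoin R (Set.range g))) with
      mul_comm := fun a b => mul_comm' a b },
    inferInstanceAs (Algebra R ↥(Algebra.adjoin R (Set.range g))),
    (Algebra.adjoin R (Set.range g)).val,
    fun t => ⟨g t, Algebra.subset_adjoin ⟨t, rfl⟩⟩, fun t => rfl⟩

theorem exists_sum_equiv {n : ℕ} (B : Finset (Fin n)) :
    ∃ e : Fin B.card ⊕ Fin (n - B.card) ≃ Fin n,
      (∀ i, e (Sum.inl i) ∈ B) ∧ ∀ i, e (Sum.inr i) ∉ B := by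
  classical
  have h2 : Fintype.card {x // x ∉ B} = n - B.card := by
    rw [Fintype.card_subtype_compl, Fintype.card_coe, Fintype.card_fin]
  let e2 := Fintype.equivFinOfCardEq h2
  refine ⟨(Equiv.sumCongr B.equivFin.symm e2.symm).trans (Equiv.sumCompl (· ∈ B)), ?_, ?_⟩
  · intro i
    exact (B.equivFin.symm i).2
  · intro i
    exact (e2.symm i).2

/-- The first group of vertices and its complement. -/
def splitEquiv {n : ℕ} (B : Finset (Fin n)) : Fin B.card ⊕ Fin (n - B.card) ≃ Fin n :=
  (exists_sum_equiv B).choose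

theorem splitEquiv_inl {n : ℕ} (B : Finset (Fin n)) (i : Fin B.card) :
    splitEquiv B (Sum.inl i) ∈ B := (exists_sum_equiv B).choose_spec.1 i

theorem splitEquiv_inr {n : ℕ} (B : Finset (Fin n)) (i : Fin (n - B.card)) :
    splitEquiv B (Sum.inr i) ∉ B := (exists_sum_equiv B).choose_spec.2 i

theorem prod_compl_eq {C : Type*} [CommMonoid C] {n : ℕ} (B : Finset (Fin n)) (c : Fin n → C) :
    ∏ r ∈ Finset.univ \ B, c r = ∏ i, c (splitEquiv B (Sum.inr i)) := by
  classical
  have h : ∏ r ∈ Finset.univ \ B, c r = ∏ r, if r ∈ B then 1 else c r := by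
    rw [Finset.prod_ite, Finset.prod_const_one, one_mul]
    refine Finset.prod_congr ?_ fun _ _ => rfl
    ext r
    simp
  rw [h, ← (splitEquiv B).prod_comp, Fintype.prod_sum_type]
  simp [splitEquiv_inl, splitEquiv_inr]

/-- The elements `g t` commute, so the list product can be computed in a commutative algebra, where
the product of sums expands over subsets. -/
theorem list_prod_add (g : τ → A) (hg : ∀ s t, Commute (g s) (g t)) {n : ℕ} (a : Fin n → R)
    (t : Fin n → τ) :
    (List.ofFn fun r => algebraMap R A (a r) + g (t r)).prod =
      ∑ B : Finset (Fin n), (∏ r ∈ B, a r) •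
        (List.ofFn fun i => g (t (splitEquiv B (Sum.inr i)))).prod := by
  classical
  obtain ⟨C, _, _, ψ, c, hc⟩ := exists_commRing_of_commute (R := R) g hg
  have h1 : ∀ {m : ℕ} (b : Fin m → C), (List.ofFn fun r => ψ (b r)).prod = ψ (∏ r, b r) := by
    intro m b
    rw [← List.prod_ofFn, map_list_prod, List.map_ofFn]
    rfl
  have h2 : (List.ofFn fun r => algebraMap R A (a r) + g (t r)).prod =
      ψ (∏ r, (algebraMap R C (a r) + c (t r))) := by
    rw [← h1]
    simp only [map_add, AlgHom.commutes, hc]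
  rw [h2, Finset.prod_add, map_sum, ← Finset.powerset_univ]
  refine Finset.sum_congr rfl fun B _ => ?_
  rw [prod_compl_eq, ← map_prod, ← Algebra.smul_def, map_smul, ← h1]
  simp only [hc]

end CommutingElements

/-! ### Vertices with a constant function drop out. -/

section Reduction

variable {N : ℕ} {ι : Type*} [Fintype ι] {V κ₁ κ₂ : Type} [Fintype V] [Fintype κ₁] [Fintype κ₂]

theorem CommDer.jet_one {J : Type} {𝓕 : Type*} [CommRing 𝓕] [Algebra ℝ 𝓕] (D : CommDer J 𝓕)
    (j : J) (m : J →₀ ℕ) : D.jet 1 (Finsupp.single j 1 + m) = 0 := by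
  have : LeftCommutative (fun (j : J) (g : 𝓕) => D.d j g) := ⟨fun i j g => D.comm i j g⟩
  rw [CommDer.jet_single_add, ← CommDer.d_jet, Derivation.map_one_eq_zero, CommDer.jet]
  generalize Finsupp.toMultiset m = s
  induction s using Multiset.induction_on with
  | empty => simp
  | cons a s ih => rw [Multiset.foldr_cons, ih, map_zero]

theorem fieldEv_X_mul_eq_zero (k : V → FieldFn N ι) (T : ι → ℝ) (x : V → Phase N) {r : V}
    (hr : k r = 1) (j : Fin N ⊕ Fin N) (P : MvPolynomial (V × (Fin N ⊕ Fin N)) ℝ) :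
    fieldEv k T x (MvPolynomial.X (r, j) * P) = 0 := by
  classical
  rw [fieldEv, ev_X_mul]
  induction P using MvPolynomial.induction_on' with
  | add p q hp hq => rw [map_add, hp, hq, add_zero]
  | monomial m a =>
    rw [ev_monomial, Finset.prod_eq_zero (Finset.mem_univ r), smul_zero]
    rw [Function.update_self, hr, CommDer.jet_one]
    rfl

/-- A derivative of the constant 1 vanishes, so a contraction that touches a vertex of the second
group contributes nothing. -/
theorem gaussCoeff_split (e : κ₁ ⊕ κ₂ ≃ V) (k : V → FieldFn N ι)
    (hk : ∀ i, k (e (Sum.inr i)) = 1) (T : ι → ℝ) (x : Phase N) (t : V → ℝ) (j : ℕ) :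
    gaussCoeff k T x t j = gaussCoeff (fun i => k (e (Sum.inl i))) T x (t ∘ e ∘ Sum.inl) j := by
  classical
  have hfac : (j.factorial : ℝ) ≠ 0 := Nat.cast_ne_zero.mpr j.factorial_ne_zero
  refine mul_left_cancel₀ hfac ?_
  rw [← fieldEv_timeEdges_pow, ← fieldEv_timeEdges_pow]
  -- Modulo the ideal of the derivatives at the second group, the exponent equals that of the first
  -- group alone, and `fieldEv` annihilates the ideal.
  let I : Ideal (MvPolynomial (V × (Fin N ⊕ Fin N)) ℝ) :=
    Ideal.span {P | ∃ i l, P = MvPolynomial.X (e (Sum.inr i), l)}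
  have hI' : ∀ Q ∈ I, ∀ P, fieldEv k T (fun _ => x) (Q * P) = 0 := by
    intro Q hQ
    induction hQ using Submodule.span_induction with
    | mem P hP =>
      obtain ⟨i, l, rfl⟩ := hP
      exact fun P => fieldEv_X_mul_eq_zero _ _ _ (hk i) _ _
    | zero => simp
    | add P Q _ _ hP hQ =>
      intro R
      rw [add_mul, map_add, hP, hQ, add_zero]
    | smul a P _ hP =>
      intro R
      rw [smul_eq_mul, mul_comm a, mul_assoc, hP]
  have hI : ∀ Q ∈ I, fieldEv k T (fun _ => x) Q = 0 := fun Q hQ => by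
    simpa using hI' Q hQ 1
  have hX : ∀ i l, (MvPolynomial.X (e (Sum.inr i), l) : MvPolynomial (V × (Fin N ⊕ Fin N)) ℝ) ∈ I :=
    fun i l => Ideal.subset_span ⟨i, l, rfl⟩
  have hdiff : timeEdges N t - MvPolynomial.rename (Prod.map (e ∘ Sum.inl) id)
      (timeEdges N (t ∘ e ∘ Sum.inl)) ∈ I := by
    have hedge1 : ∀ i s, edge N (e (Sum.inr i)) s ∈ I := fun i s =>
      Ideal.sum_mem _ fun l _ => I.mul_mem_right _ (hX i _)
    have hedge2 : ∀ i s, edge N s (e (Sum.inr i)) ∈ I := fun i s =>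
      Ideal.sum_mem _ fun l _ => I.mul_mem_left _ (hX i _)
    have h1 : timeEdges N t = ∑ r : κ₁ ⊕ κ₂, ∑ s : κ₁ ⊕ κ₂,
        heaviside (t (e r) - t (e s)) • edge N (e r) (e s) := by
      rw [timeEdges, ← e.sum_comp]
      exact Finset.sum_congr rfl fun r _ => (e.sum_comp _).symm
    have h2 : MvPolynomial.rename (Prod.map (e ∘ Sum.inl) id) (timeEdges N (t ∘ e ∘ Sum.inl)) =
        ∑ r : κ₁, ∑ s : κ₁, heaviside (t (e (Sum.inl r)) - t (e (Sum.inl s))) •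
          edge N (e (Sum.inl r)) (e (Sum.inl s)) := by
      simp only [timeEdges, map_sum, map_smul, rename_edge]
      rfl
    rw [h1, h2, Fintype.sum_sum_type]
    simp only [Fintype.sum_sum_type, Finset.sum_add_distrib]
    rw [add_assoc, add_sub_cancel_left]
    refine I.add_mem (Ideal.sum_mem _ fun r _ => Ideal.sum_mem _ fun s _ =>
      Submodule.smul_of_tower_mem I _ (hedge2 _ _)) (I.add_mem ?_ ?_) <;>
    exact Ideal.sum_mem _ fun r _ => Ideal.sum_mem _ fun s _ =>
      Submodule.smul_of_tower_mem I _ (hedge1 _ _)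
  have hpow : timeEdges N t ^ j - MvPolynomial.rename (Prod.map (e ∘ Sum.inl) id)
      (timeEdges N (t ∘ e ∘ Sum.inl)) ^ j ∈ I :=
    I.mem_of_dvd (sub_dvd_pow_sub_pow _ _ j) hdiff
  have h3 := hI _ hpow
  rw [map_sub, sub_eq_zero] at h3
  rw [h3, ← map_pow]
  have h4 := ev_rename_mul (fun r m => ((phaseDer N ι).jet (k r) m : _ → ℝ) (T, x)) e
    (timeEdges N (t ∘ e ∘ Sum.inl) ^ j) 1
  rw [map_one, mul_one, ev_one] at h4
  simp only [hk, CommDer.jet_zero] at h4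
  exact h4.trans ((congrArg _ (Finset.prod_eq_one fun _ _ => rfl)).trans (mul_one _))

end Reduction

/-! ### Dependence of the ghost Wick coefficients on the times. -/

section AdmissibleFunctions

variable {V : Type} {ta tb : ℝ} {ι : Type*}

/-- The functions of the times which are combinations of bounded measurable functions with
coefficients in `ℂ((ħ))`. -/
def timeAlg (ta tb : ℝ) (V : Type) : Subalgebra Kħ ((V → ℝ) → Kħ) :=
  Algebra.adjoin Kħ {F | ∃ u : (V → ℝ) → ℝ, BddMeas ta tb u ∧ F = fun t => cst (u t : ℂ)}

theorem timeAlg_cst {u : (V → ℝ) → ℝ} (hu : BddMeas ta tb u) :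
    (fun t => cst (u t : ℂ)) ∈ timeAlg ta tb V := Algebra.subset_adjoin ⟨u, hu, rfl⟩

theorem timeAlg_const (K : Kħ) : (fun _ => K) ∈ timeAlg ta tb V :=
  (timeAlg ta tb V).algebraMap_mem K

/-- The generators are closed under multiplication, so the algebra they generate is their linear
span. -/
theorem exists_sum_of_mem_timeAlg {F : (V → ℝ) → Kħ} (hF : F ∈ timeAlg ta tb V) :
    ∃ (m : ℕ) (u : Fin m → (V → ℝ) → ℝ) (K : Fin m → Kħ), (∀ a, BddMeas ta tb (u a)) ∧
      ∀ t, F t = ∑ a, cst (u a t : ℂ) * K a := by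
  have hcl : (Submonoid.closure {F : (V → ℝ) → Kħ | ∃ u : (V → ℝ) → ℝ, BddMeas ta tb u ∧
      F = fun t => cst (u t : ℂ)} : Set ((V → ℝ) → Kħ)) =
      {F | ∃ u : (V → ℝ) → ℝ, BddMeas ta tb u ∧ F = fun t => cst (u t : ℂ)} := by
    refine subset_antisymm (fun F hF => ?_) Submonoid.subset_closure
    induction hF using Submonoid.closure_induction with
    | mem F hF => exact hF
    | one =>
      refine ⟨fun _ => 1, BddMeas.const 1, ?_⟩
      funext t
      simp [← cstHom_apply]
    | mul F G _ _ hF hG =>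
      obtain ⟨u, hu, rfl⟩ := hF
      obtain ⟨v, hv, rfl⟩ := hG
      refine ⟨fun t => u t * v t, hu.mul hv, ?_⟩
      funext t
      simp [← cstHom_apply]
  rw [timeAlg, ← Subalgebra.mem_toSubmodule, Algebra.adjoin_eq_span, hcl,
    Submodule.mem_span_set'] at hF
  obtain ⟨m, K, g, rfl⟩ := hF
  choose u hu hg using fun a => (g a).2
  refine ⟨m, u, K, hu, fun t => ?_⟩
  rw [Finset.sum_apply]
  refine Finset.sum_congr rfl fun a _ => ?_
  rw [Pi.smul_apply, hg, smul_eq_mul, mul_comm]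

/-- The labels of odd generators at times depending on parameters. -/
abbrev GenFn (ta tb : ℝ) (V : Type) (ι : Type*) : Type _ :=
  ParamGen ι ⊕ ({τ : (V → ℝ) → ℝ // BddMeas ta tb τ} × ι) ⊕
    ({τ : (V → ℝ) → ℝ // BddMeas ta tb τ} × ι)

/-- The value of a label. -/
def GenFn.eval : GenFn ta tb V ι → (V → ℝ) → FieldGen ι
  | Sum.inl p, _ => Sum.inl p
  | Sum.inr (Sum.inl (τ, α)), t => Sum.inr (Sum.inl (τ.1 t, α))
  | Sum.inr (Sum.inr (τ, α)), t => Sum.inr (Sum.inr (τ.1 t, α))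

theorem bddMeas_ghostPropagator {τ τ' : (V → ℝ) → ℝ} (h : BddMeas ta tb τ)
    (h' : BddMeas ta tb τ') :
    BddMeas ta tb fun t => heaviside (τ t - τ' t) - phi ta tb (τ t) := by
  have h1 : BddMeas ta tb fun t => heaviside (τ t - τ' t) :=
    BddMeas.heaviside (h.measurable.sub h'.measurable)
  convert h1.add ((h.add (BddMeas.const (-ta))).mul (BddMeas.const (-(tb - ta)⁻¹))) using 2
  rw [phi]
  ring

theorem ghostProp_mem [DecidableEq ι] (a b : GenFn ta tb V ι) :
    (fun t => ghostProp ta tb (a.eval t) (b.eval t)) ∈ timeAlg ta tb V := by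
  have key : ∀ (τ τ' : {τ : (V → ℝ) → ℝ // BddMeas ta tb τ}) (α β : ι),
      (fun t => if α = β then iHbar *
        cst ((heaviside (τ.1 t - τ'.1 t) - phi ta tb (τ.1 t) : ℝ) : ℂ) else 0) ∈
        timeAlg ta tb V := by
    intro τ τ' α β
    split_ifs
    · exact (timeAlg ta tb V).mul_mem (timeAlg_const iHbar)
        (timeAlg_cst (bddMeas_ghostPropagator τ.2 τ'.2))
    · exact timeAlg_const 0
  rcases a with a | ⟨τ, α⟩ | ⟨τ, α⟩ <;> rcases b with b | ⟨τ', β⟩ | ⟨τ', β⟩ <;>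
    simp only [GenFn.eval, ghostProp]
  case inr.inl.inr.inr => exact key τ τ' α β
  case inr.inr.inr.inl =>
    have h := (timeAlg ta tb V).neg_mem (key τ' τ β α)
    convert h using 1
    funext t
    by_cases hαβ : β = α <;> simp [hαβ]
  all_goals exact timeAlg_const 0

/-- Combinations of products of odd generators at varying times. -/
inductive AdmField (ta tb : ℝ) (V : Type) (ι : Type*) : ((V → ℝ) → GrField ι) → Prop
  | one : AdmField ta tb V ι fun _ => 1
  | add {Φ Ψ} : AdmField ta tb V ι Φ → AdmField ta tb V ι Ψ →
      AdmField ta tb V ι fun t => Φ t + Ψ t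
  | smul {c Φ} : c ∈ timeAlg ta tb V → AdmField ta tb V ι Φ →
      AdmField ta tb V ι fun t => c t • Φ t
  | mul (a : GenFn ta tb V ι) {Φ} : AdmField ta tb V ι Φ →
      AdmField ta tb V ι fun t => odd (a.eval t) * Φ t

theorem AdmField.neg {Φ : (V → ℝ) → GrField ι} (h : AdmField ta tb V ι Φ) :
    AdmField ta tb V ι fun t => -Φ t := by
  simpa using AdmField.smul (timeAlg_const (-1)) h

theorem AdmField.zero : AdmField ta tb V ι fun _ => 0 := by
  simpa using AdmField.smul (timeAlg_const 0) AdmField.one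

theorem AdmField.sum {σ : Type*} (s : Finset σ) {Φ : σ → (V → ℝ) → GrField ι}
    (h : ∀ i ∈ s, AdmField ta tb V ι (Φ i)) : AdmField ta tb V ι fun t => ∑ i ∈ s, Φ i t := by
  classical
  induction s using Finset.induction_on with
  | empty => simpa using AdmField.zero
  | insert a s ha ih =>
    simp only [Finset.sum_insert ha]
    exact (h a (Finset.mem_insert_self _ _)).add
      (ih fun i hi => h i (Finset.mem_insert_of_mem hi))

/-- A constant label. -/
def GenFn.const : FieldGen ι → GenFn ta tb V ι
  | Sum.inl p => Sum.inl p
  | Sum.inr (Sum.inl (t, α)) => Sum.inr (Sum.inl (⟨fun _ => t, BddMeas.const t⟩, α))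
  | Sum.inr (Sum.inr (t, α)) => Sum.inr (Sum.inr (⟨fun _ => t, BddMeas.const t⟩, α))

theorem GenFn.eval_const (a : FieldGen ι) (t : V → ℝ) :
    (GenFn.const a : GenFn ta tb V ι).eval t = a := by
  rcases a with a | ⟨τ, α⟩ | ⟨τ, α⟩ <;> rfl

theorem AdmField.const_mul (X : GrField ι) {Φ : (V → ℝ) → GrField ι}
    (h : AdmField ta tb V ι Φ) : AdmField ta tb V ι fun t => X * Φ t := by
  induction X using ExteriorAlgebra.induction generalizing Φ with
  | algebraMap r =>
    simp only [← Algebra.smul_def]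
    exact AdmField.smul (timeAlg_const r) h
  | ι m =>
    have hm : ExteriorAlgebra.ι Kħ m = ∑ a ∈ m.support, m a • odd a := by
      conv_lhs => rw [← Finsupp.sum_single m, Finsupp.sum, map_sum]
      refine Finset.sum_congr rfl fun a _ => ?_
      rw [odd, ← map_smul, Finsupp.smul_single, smul_eq_mul, mul_one]
    simp only [hm, Finset.sum_mul, smul_mul_assoc]
    refine AdmField.sum _ fun a _ => AdmField.smul (timeAlg_const (m a)) ?_
    have h1 := AdmField.mul (GenFn.const a) h
    simp only [GenFn.eval_const] at h1
    exact h1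
  | mul a b ha hb =>
    simp only [mul_assoc]
    exact ha (hb h)
  | add a b ha hb =>
    simp only [add_mul]
    exact (ha h).add (hb h)

/-- A contraction is an antiderivation, so on a product of generators it only produces values of the
form `d` and shorter products. -/
theorem AdmField.contractLeft {d : (V → ℝ) → Module.Dual Kħ (FieldGen ι →₀ Kħ)}
    (hd : ∀ b : GenFn ta tb V ι, (fun t => d t (Finsupp.single (b.eval t) 1)) ∈ timeAlg ta tb V)
    {Φ : (V → ℝ) → GrField ι} (h : AdmField ta tb V ι Φ) :
    AdmField ta tb V ι fun t =>
      CliffordAlgebra.contractLeft (Q := (0 : QuadraticForm Kħ (FieldGen ι →₀ Kħ))) (d t) (Φ t) := by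
  induction h with
  | one =>
    simp only [CliffordAlgebra.contractLeft_one]
    exact AdmField.zero
  | add _ _ h1 h2 =>
    simp only [map_add]
    exact h1.add h2
  | smul hc _ h1 =>
    simp only [map_smul]
    exact AdmField.smul hc h1
  | mul a h0 h1 =>
    have h2 := (AdmField.smul (hd a) h0).add (AdmField.mul a h1).neg
    convert h2 using 2 with t
    rw [odd]
    exact (CliffordAlgebra.contractLeft_ι_mul _ _ _).trans (sub_eq_add_neg _ _)

theorem ghostForm_single [DecidableEq ι] (a b : FieldGen ι) :
    ghostForm ta tb (Finsupp.single a 1) (Finsupp.single b 1) = ghostProp ta tb a b := by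
  simp [ghostForm]

/-- Wick's theorem moves generators out one at a time: each is left alone or contracted with the
rest, and the propagators between generators at varying times lie in `timeAlg`. -/
theorem AdmField.changeForm [DecidableEq ι] {Φ : (V → ℝ) → GrField ι}
    (h : AdmField ta tb V ι Φ) : AdmField ta tb V ι fun t =>
      CliffordAlgebra.changeForm (ghostForm_quadratic ta tb) (Φ t) := by
  induction h with
  | one =>
    simp only [CliffordAlgebra.changeForm_one]
    exact AdmField.one
  | add _ _ h1 h2 =>
    simp only [map_add]
    exact h1.add h2
  | smul hc _ h1 =>
    simp only [map_smul]
    exact AdmField.smul hc h1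
  | @mul a Φ h0 h1 =>
    have h3 : AdmField ta tb V ι fun t =>
        CliffordAlgebra.contractLeft (Q := (0 : QuadraticForm Kħ (FieldGen ι →₀ Kħ)))
          (ghostForm ta tb (Finsupp.single (a.eval t) 1))
          (CliffordAlgebra.changeForm (ghostForm_quadratic ta tb) (Φ t)) := by
      refine AdmField.contractLeft (fun b => ?_) h1
      simp only [ghostForm_single]
      exact ghostProp_mem a b
    convert (AdmField.mul a h1).add h3 using 2 with t
    rw [odd]
    refine (CliffordAlgebra.changeForm_ι_mul _ _ _).trans ?_
    rw [LinearMap.neg_apply, map_neg, LinearMap.neg_apply, sub_neg_eq_add]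

theorem AdmField.apply_killFields {Φ : (V → ℝ) → GrField ι} (h : AdmField ta tb V ι Φ)
    (μ : GrParam ι →ₗ[Kħ] Kħ) :
    (fun t => μ (ExteriorAlgebra.map killFields (Φ t))) ∈ timeAlg ta tb V := by
  induction h generalizing μ with
  | one =>
    simp only [map_one]
    exact timeAlg_const _
  | add _ _ h1 h2 =>
    simp only [map_add]
    exact (timeAlg ta tb V).add_mem (h1 μ) (h2 μ)
  | smul hc _ h1 =>
    simp only [map_smul, smul_eq_mul]
    exact (timeAlg ta tb V).mul_mem hc (h1 μ)
  | @mul a Φ h0 h1 =>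
    rcases a with p | a | a
    · have h2 := h1 (μ ∘ₗ LinearMap.mulLeft Kħ (ExteriorAlgebra.ι Kħ (Finsupp.single p 1)))
      convert h2 using 2 with t
      simp [odd, GenFn.eval, killFields]
    · convert timeAlg_const (0 : Kħ) using 2 with t
      simp [odd, GenFn.eval, killFields]
    · convert timeAlg_const (0 : Kħ) using 2 with t
      simp [odd, GenFn.eval, killFields]

/-- `grCoeff` as a linear map. -/
theorem exists_grCoeff_linear (S : Finset (ParamGen ι)) :
    ∃ μ : GrParam ι →ₗ[Kħ] Kħ, ∀ x, μ x = grCoeff S x := by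
  have h : ∀ l : List (ParamGen ι), ∃ μ : GrParam ι →ₗ[Kħ] GrParam ι, ∀ x, μ x =
      l.foldl (fun (y : GrParam ι) s => CliffordAlgebra.contractLeft (Finsupp.lapply s) y) x := by
    intro l
    induction l with
    | nil => exact ⟨LinearMap.id, fun _ => rfl⟩
    | cons s l ih =>
      obtain ⟨μ, hμ⟩ := ih
      exact ⟨μ ∘ₗ CliffordAlgebra.contractLeft (Finsupp.lapply s), fun x => hμ _⟩
  obtain ⟨μ, hμ⟩ := h S.toList
  exact ⟨ExteriorAlgebra.algebraMapInv.toLinearMap ∘ₗ μ, fun x => by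
    rw [LinearMap.comp_apply, hμ]
    rfl⟩

end AdmissibleFunctions

/-! ### Ghost vertices. -/

section GhostDensity

variable {ι : Type*} [Fintype ι]

/-- The terms of the bulk density which contain ghosts. -/
def ghostDensity (ta tb : ℝ) (f : ι → ι → ι → ℝ) (T : ι → ℝ) (t : ℝ) : GrField ι :=
  ∑ α, ∑ β, ∑ γ, cst ((f α β γ * (T β / (tb - ta)) : ℝ) : ℂ) •
    ((Tplus γ + hatEplus t γ) * hatC t α)

theorem bulkDensity_eq {N : ℕ} (ta tb : ℝ) (f : ι → ι → ι → ℝ) (H : ι → Phase N → ℝ) (T : ι → ℝ)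
    (t : ℝ) (x : Phase N) : bulkDensity ta tb f H T t x =
      algebraMap Kħ (GrField ι) (cst ((-∑ α, T α / (tb - ta) * H α x : ℝ) : ℂ)) +
        ghostDensity ta tb f T t := by
  have h0 : cst 0 = 0 := map_zero cstHom
  rw [← bvDensity_phys f H x, bulkDensity, bvDensity, bvDensity, ghostDensity]
  simp [h0]

/-- Products of two odd elements are even, hence commute. -/
theorem ι_mul_ι_comm {R M : Type*} [CommRing R] [AddCommGroup M] [Module R M] (a b c d : M) :
    Commute (ExteriorAlgebra.ι R a * ExteriorAlgebra.ι R b)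
      (ExteriorAlgebra.ι R c * ExteriorAlgebra.ι R d) := by
  have h : ∀ x y : M, ExteriorAlgebra.ι R x * ExteriorAlgebra.ι R y =
      -(ExteriorAlgebra.ι R y * ExteriorAlgebra.ι R x) := fun x y =>
    eq_neg_of_add_eq_zero_left (ExteriorAlgebra.ι_add_mul_swap x y)
  have h1 : ∀ x : M, Commute (ExteriorAlgebra.ι R a * ExteriorAlgebra.ι R b)
      (ExteriorAlgebra.ι R x) := by
    intro x
    rw [commute_iff_eq, mul_assoc, h b x, mul_neg, ← mul_assoc, h a x, neg_mul, neg_neg, mul_assoc]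
  exact (h1 c).mul_right (h1 d)

theorem ghostDensity_commute (ta tb : ℝ) (f : ι → ι → ι → ℝ) (T : ι → ℝ) (s t : ℝ) :
    Commute (ghostDensity ta tb f T s) (ghostDensity ta tb f T t) := by
  refine Commute.sum_left _ _ _ fun α _ => Commute.sum_left _ _ _ fun β _ =>
    Commute.sum_left _ _ _ fun γ _ => Commute.sum_right _ _ _ fun α' _ =>
    Commute.sum_right _ _ _ fun β' _ => Commute.sum_right _ _ _ fun γ' _ =>
    Commute.smul_left (Commute.smul_right ?_ _) _
  simp only [Tplus, hatEplus, hatC, odd, ← map_add]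
  exact ι_mul_ι_comm _ _ _ _

variable {V : Type} {ta tb : ℝ}

theorem AdmField.ghostDensity_mul (f : ι → ι → ι → ℝ) (T : ι → ℝ)
    {τ : (V → ℝ) → ℝ} (hτ : BddMeas ta tb τ) {Φ : (V → ℝ) → GrField ι}
    (h : AdmField ta tb V ι Φ) :
    AdmField ta tb V ι fun t => ghostDensity ta tb f T (τ t) * Φ t := by
  simp only [ghostDensity, Finset.sum_mul, smul_mul_assoc, mul_assoc, add_mul]
  refine AdmField.sum _ fun α _ => AdmField.sum _ fun β _ => AdmField.sum _ fun γ _ =>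
    AdmField.smul (timeAlg_const _) ?_
  have h1 : AdmField ta tb V ι fun t => hatC (τ t) α * Φ t :=
    AdmField.mul (Sum.inr (Sum.inl (⟨τ, hτ⟩, α))) h
  exact (AdmField.mul (Sum.inl (Sum.inr (Sum.inr γ))) h1).add
    (AdmField.mul (Sum.inr (Sum.inr (⟨τ, hτ⟩, γ))) h1)

theorem AdmField.list_prod_ghostDensity (f : ι → ι → ι → ℝ) (T : ι → ℝ) {n : ℕ}
    (τ : Fin n → (V → ℝ) → ℝ) (hτ : ∀ r, BddMeas ta tb (τ r)) :
    AdmField ta tb V ι fun t => (List.ofFn fun r => ghostDensity ta tb f T (τ r t)).prod := by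
  induction n with
  | zero => simpa using AdmField.one
  | succ n ih =>
    simp only [List.ofFn_succ, List.prod_cons]
    exact AdmField.ghostDensity_mul f T (hτ 0) (ih (fun r => τ r.succ) fun r => hτ r.succ)

/-- The coefficients of the ghost vertices as functions of the times. -/
def ghostCoeff [DecidableEq ι] (ta tb : ℝ) (f : ι → ι → ι → ℝ) (T : ι → ℝ)
    (S : Finset (ParamGen ι)) {n : ℕ} (t : Fin n → ℝ) : Kħ :=
  grCoeff S (ghostWick ta tb (grExp (iOverHbar • ghostSource ta tb) *
    (List.ofFn fun r => ghostDensity ta tb f T (t r)).prod))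

theorem BddMeas.coordinate {n : ℕ} (r : Fin n) :
    BddMeas ta tb fun t : Fin n → ℝ => t r :=
  ⟨measurable_pi_apply r, max |ta| |tb|, fun _ ht => abs_le_max_abs_abs (ht.1 r) (ht.2 r)⟩

/-- The separated form makes the ghost part accessible to `physIntegral_eq` and to Fubini. -/
theorem exists_ghostCoeff_eq [DecidableEq ι] (f : ι → ι → ι → ℝ) (T : ι → ℝ)
    (S : Finset (ParamGen ι)) (n : ℕ) :
    ∃ (m : ℕ) (u : Fin m → (Fin n → ℝ) → ℝ) (K : Fin m → Kħ), (∀ a, BddMeas ta tb (u a)) ∧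
      ∀ t, ghostCoeff ta tb f T S t = ∑ a, cst (u a t : ℂ) * K a := by
  obtain ⟨μ, hμ⟩ := exists_grCoeff_linear S
  have h := (((AdmField.list_prod_ghostDensity f T _ BddMeas.coordinate).const_mul
    (grExp (iOverHbar • ghostSource ta tb))).changeForm).apply_killFields
      (V := Fin n) (ta := ta) (tb := tb) μ
  refine exists_sum_of_mem_timeAlg ?_
  convert h using 2 with t
  rw [hμ]
  rfl

end GhostDensity

/-! ### Factorization into physical and ghost parts. -/

section Factorization

open MeasureTheory

variable {ι : Type*} [Fintype ι] {ta tb : ℝ}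

theorem BddMeas.comp_equiv {V W : Type} {u : (W → ℝ) → ℝ} (hu : BddMeas ta tb u) (e : W → V) :
    BddMeas ta tb fun t : V → ℝ => u (t ∘ e) := by
  obtain ⟨C, hC⟩ := hu.bounded
  exact ⟨hu.measurable.comp (measurable_pi_lambda _ fun w => measurable_pi_apply (e w)), C,
    fun t ht => hC _ ⟨fun w => ht.1 (e w), fun w => ht.2 (e w)⟩⟩

/-- `B` is the set of vertices where the physical term is chosen. The ghost vertices carry the
constant function 1 of the physical fields. -/
theorem grCoeff_bulk_eq [DecidableEq ι] {N n : ℕ} (f : ι → ι → ι → ℝ) (H : ι → Phase N → ℝ)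
    (hH : ∀ α, ContDiff ℝ ∞ (H α)) (T : ι → ℝ) (S : Finset (ParamGen ι)) (t : Fin n → ℝ)
    (x : Fin n → Phase N) :
    grCoeff S (ghostWick ta tb (grExp (iOverHbar • ghostSource ta tb) *
      (List.ofFn fun r => bulkDensity ta tb f H T (t r) (x r)).prod)) =
    ∑ B : Finset (Fin n), cst ((∏ r, ((if r ∈ B then densFn ta tb H hH else 1 : FieldFn N ι) :
      _ → ℝ) (T, x r) : ℝ) : ℂ) * ghostCoeff ta tb f T S (t ∘ splitEquiv B ∘ Sum.inr) := by
  classical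
  obtain ⟨μ, hμ⟩ := exists_grCoeff_linear S
  simp only [bulkDensity_eq]
  rw [list_prod_add _ (ghostDensity_commute ta tb f T) (fun r => cst _), Finset.mul_sum, map_sum,
    ← hμ, map_sum]
  refine Finset.sum_congr rfl fun B _ => ?_
  rw [mul_smul_comm, map_smul, map_smul, hμ, smul_eq_mul]
  congr 1
  simp only [← cstHom_apply]
  rw [← map_prod, ← Complex.ofReal_prod]
  congr 2
  rw [← Finset.prod_subset (Finset.subset_univ B)]
  · refine Finset.prod_congr rfl fun r hr => ?_
    rw [if_pos hr, densFn_apply]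
  · intro r _ hr
    rw [if_neg hr]
    rfl

/-- The quantifier order matters: the ghost integrals `q` are chosen before N, H, qa and pb. The
same numbers therefore occur in the full partition function and in the ghost partition function. -/
theorem exists_physIntegral_bulk_eq [DecidableEq ι] (f : ι → ι → ι → ℝ) (T : ι → ℝ)
    (S : Finset (ParamGen ι)) :
    ∃ q : ℕ → Kħ, ∀ (N : ℕ) (H : ι → Phase N → ℝ) (hH : ∀ α, ContDiff ℝ ∞ (H α))
      (qa pb : Fin N → ℝ) (n : ℕ),
      physIntegral ta tb qa pb (n := n) (fun t x => grCoeff S (ghostWick ta tb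
        (grExp (iOverHbar • ghostSource ta tb) *
          (List.ofFn fun r => bulkDensity ta tb f H T (t r) (x r)).prod))) =
      ∑ B : Finset (Fin n), ofħ (atPoint T (pb, qa)
        (graphSum ta tb ((phaseDer N ι).jet (densFn ta tb H hH)) (Fin B.card))) *
          q (n - B.card) := by
  classical
  choose m u K hu hG using fun n => exists_ghostCoeff_eq (ta := ta) (tb := tb) f T S n
  refine ⟨fun n => ∑ a, K n a *
    -- `q n` is the integral of the ghost coefficient over its own n times.
    cst ((∫ t in Set.Icc (fun _ : Fin n => ta) (fun _ => tb), u n a t : ℝ) : ℂ), ?_⟩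
  intro N H hH qa pb n
  rw [physIntegral_eq qa pb (Finset.univ : Finset (Σ B : Finset (Fin n), Fin (m (n - B.card))))
    (fun b t => u _ b.2 (t ∘ splitEquiv b.1 ∘ Sum.inr))
    (fun b _ => (hu _ b.2).comp_equiv _)
    (fun b r => if r ∈ b.1 then densFn ta tb H hH else 1) T (fun b => K _ b.2)]
  · rw [← Finset.univ_sigma_univ, Finset.sum_sigma]
    refine Finset.sum_congr rfl fun B _ => ?_
    rw [Finset.mul_sum]
    refine Finset.sum_congr rfl fun a _ => ?_
    rw [mul_left_comm, cst, ← map_mul]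
    congr 2
    ext j
    rw [PowerSeries.coeff_mk, PowerSeries.coeff_mul_C, coeff_atPoint, mul_assoc]
    congr 1
    rw [← Complex.ofReal_mul, ← integral_gaussCoeff_eq_graphSum, ← cube_integral_mul ta tb
      (splitEquiv B)]
    congr 2
    funext t
    rw [gaussCoeff_split (splitEquiv B) _ fun i => if_neg (splitEquiv_inr B i), mul_comm]
    simp only [splitEquiv_inl, if_true]
  · intro t x
    rw [grCoeff_bulk_eq f H hH, ← Finset.univ_sigma_univ, Finset.sum_sigma]
    refine Finset.sum_congr rfl fun B _ => ?_
    rw [hG, Finset.mul_sum]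
    refine Finset.sum_congr rfl fun a _ => ?_
    rw [← mul_assoc, ← cstHom_apply, ← cstHom_apply, ← cstHom_apply, ← map_mul, Complex.ofReal_mul,
      mul_comm (u _ _ _ : ℂ)]

theorem graphSum_densFn_zero {N : ℕ} (hab : ta < tb) (n : ℕ) :
    graphSum ta tb ((phaseDer N ι).jet (densFn ta tb (0 : ι → Phase N → ℝ)
      fun _ => contDiff_const)) (Fin n) = if n = 0 then 1 else 0 := by
  rw [graphSum_densFn hab]
  have h0 : -hamFn (0 : ι → Phase N → ℝ) (fun _ => contDiff_const) =
      (0 : ℝ) • (0 : FieldFn N ι) := by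
    refine Subtype.ext (funext fun y => ?_)
    change -∑ α, y.1 α * (0 : ℝ) = _
    simp
  rw [h0, starPower_smul]
  split_ifs with hn
  · subst hn
    simp [starPower]
  · rw [zero_pow hn, zero_smul]

/-- The factorization of the partition function. -/
theorem ZI_eq_mul [DecidableEq ι] {N : ℕ} (hab : ta < tb) (f : ι → ι → ι → ℝ)
    (H : ι → Phase N → ℝ) (hH : ∀ α, ContDiff ℝ ∞ (H α)) (qa pb : Fin N → ℝ) (T : ι → ℝ) :
    ZI ta tb f H qa pb T = ZIphys ta tb f H qa pb T * ZIgh ta tb f T := by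
  classical
  choose q hq using exists_physIntegral_bulk_eq (ta := ta) (tb := tb) f T
  rw [ZIphys_eq f H hH, ZI, ZIgh, feynmanIntegral, feynmanIntegral,
    AddMonoidAlgebra.single_mul_single]
  have hw : sourceWeight (N := 0) ta tb 0 0 = 0 := by simp [sourceWeight]
  rw [hw, add_zero]
  congr 1
  ext n
  -- For N = 0 and H = 0 only the empty set of physical vertices contributes, which identifies `q`
  -- with the integrals in `ZIgh`.
  have hgh : ∀ (S : Finset (ParamGen ι)) (m : ℕ),
      physIntegral (N := 0) ta tb 0 0 (n := m) (fun t x => grCoeff S (ghostWick ta tb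
        (grExp (iOverHbar • ghostSource ta tb) *
          (List.ofFn fun r => bulkDensity ta tb f (0 : ι → Phase 0 → ℝ) T (t r) (x r)).prod))) =
        q S m := by
    intro S m
    rw [hq S 0 0 (fun _ => contDiff_const), Finset.sum_eq_single ∅]
    · rw [graphSum_densFn_zero hab, Finset.card_empty, if_pos rfl, map_one, map_one, one_mul,
        Nat.sub_zero]
    · intro B _ hB
      rw [graphSum_densFn_zero hab, if_neg (Finset.card_ne_zero.mpr
        (Finset.nonempty_iff_ne_empty.mpr hB)), map_zero, map_zero, zero_mul]
    · intro h
      exact absurd (Finset.mem_univ _) h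
  simp only [hgh]
  rw [PowerSeries.coeff_mk, PowerSeries.coeff_mul]
  simp only [scalarState, PowerSeries.coeff_map, PowerSeries.coeff_mk, Finset.mul_sum]
  rw [Finset.sum_comm]
  refine Finset.sum_congr rfl fun S _ => ?_
  simp only [← Algebra.smul_def, smul_smul]
  rw [← Finset.sum_smul]
  congr 1
  rw [hq S N H hH, ← Finset.powerset_univ, Finset.sum_powerset_apply_card (fun k =>
    ofħ (atPoint T (pb, qa) (graphSum ta tb ((phaseDer N ι).jet (densFn ta tb H hH)) (Fin k))) *
      q S (n - k)), Finset.card_univ, Fintype.card_fin,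
    Finset.Nat.sum_antidiagonal_eq_sum_range_succ_mk, Finset.mul_sum]
  refine Finset.sum_congr rfl fun k hk => ?_
  have hk : k ≤ n := Nat.lt_succ_iff.mp (Finset.mem_range.mp hk)
  -- The number of subsets of size k converts 1/n! into 1/k! times 1/(n-k)!, as the Cauchy product
  -- requires.
  have hc : cst (1 / (n.factorial : ℂ)) * (n.choose k : Kħ) =
      cst (1 / (k.factorial : ℂ)) * cst (1 / ((n - k).factorial : ℂ)) := by
    have h1 : (n.factorial : ℂ) ≠ 0 := Nat.cast_ne_zero.mpr n.factorial_ne_zero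
    have h2 : (k.factorial : ℂ) ≠ 0 := Nat.cast_ne_zero.mpr k.factorial_ne_zero
    have h3 : ((n - k).factorial : ℂ) ≠ 0 := Nat.cast_ne_zero.mpr (n - k).factorial_ne_zero
    rw [← map_natCast cstHom, ← cstHom_apply, ← cstHom_apply, ← cstHom_apply, ← map_mul, ← map_mul]
    congr 1
    rw [Nat.cast_choose ℂ hk]
    field_simp
  have hp : iOverHbar ^ n = iOverHbar ^ k * iOverHbar ^ (n - k) := by
    rw [← pow_add, Nat.add_sub_cancel' hk]
  rw [nsmul_eq_mul, hp]
  linear_combination (iOverHbar ^ k * iOverHbar ^ (n - k) * (ofħ (atPoint T (pb, qa)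
    (graphSum ta tb ((phaseDer N ι).jet (densFn ta tb H hH)) (Fin k))) * q S (n - k))) * hc

end Factorization

/-! ### Homogeneity in T and uniform bounds. -/

section Homogeneous

variable {N : ℕ} {ι : Type*} [Fintype ι]

/-- Homogeneity in `T`. -/
def IsHomog (d : ℕ) (f : FieldFn N ι) : Prop :=
  ∀ (c : ℝ) (T : ι → ℝ) (x : Phase N), (f : _ → ℝ) (c • T, x) = c ^ d * (f : _ → ℝ) (T, x)

theorem IsHomog.phaseDer {d : ℕ} {f : FieldFn N ι} (hf : IsHomog d f) (j : Fin N ⊕ Fin N) :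
    IsHomog d ((phaseDer N ι).d j f) := by
  intro c T x
  have h : (fun z => (f : _ → ℝ) (c • T, z)) = fun z => c ^ d • (f : _ → ℝ) (T, z) :=
    funext fun z => hf c T z
  have hdiff : DifferentiableAt ℝ (fun z => (f : _ → ℝ) (T, z)) x :=
    (smoothFn.differentiable f).comp (by fun_prop) _
  rw [phaseDer_apply, phaseDer_apply, h, fderiv_fun_const_smul hdiff]
  rfl

theorem isHomog_hamFn (H : ι → Phase N → ℝ) (hH : ∀ α, ContDiff ℝ ∞ (H α)) :
    IsHomog 1 (hamFn H hH) := by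
  intro c T x
  change ∑ α, (c • T) α * H α x = c ^ 1 * ∑ α, T α * H α x
  rw [Finset.mul_sum]
  refine Finset.sum_congr rfl fun α _ => ?_
  rw [Pi.smul_apply, smul_eq_mul]
  ring

/-- Compactness for ‖T‖ ≤ 1, extended to all T by scaling. -/
theorem IsHomog.exists_bound {d : ℕ} {f : FieldFn N ι} (hf : IsHomog d f) (c : Phase N) (ρ : ℝ) :
    ∃ C, 0 ≤ C ∧ ∀ (T : ι → ℝ), ∀ x ∈ Metric.closedBall c ρ,
      |(f : _ → ℝ) (T, x)| ≤ C * ‖T‖ ^ d := by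
  obtain ⟨C, hC⟩ := ((isCompact_closedBall (0 : ι → ℝ) 1).prod
    (isCompact_closedBall c ρ)).exists_bound_of_continuousOn
      (smoothFn.contDiff f).continuous.continuousOn
  refine ⟨max C 0, le_max_right _ _, fun T x hx => ?_⟩
  have hT : T = ‖T‖ • (‖T‖⁻¹ • T) := by
    rcases eq_or_ne T 0 with rfl | hT
    · simp
    · rw [smul_smul, mul_inv_cancel₀ (norm_ne_zero_iff.mpr hT), one_smul]
  have hnorm : ‖T‖⁻¹ • T ∈ Metric.closedBall (0 : ι → ℝ) 1 := by
    rw [mem_closedBall_zero_iff, norm_smul, norm_inv, norm_norm]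
    exact inv_mul_le_one
  rw [hT, hf, ← hT, abs_mul, abs_of_nonneg (by positivity), mul_comm]
  gcongr
  exact (hC (_, x) ⟨hnorm, hx⟩).trans (le_max_left _ _)

theorem hasDerivWithinAt_fieldFn (f : FieldFn N ι) (T : ι → ℝ) {y : ℝ → Phase N} {y' : Phase N}
    {s : Set ℝ} {t : ℝ} (hy : HasDerivWithinAt y y' s t) :
    HasDerivWithinAt (fun t => (f : _ → ℝ) (T, y t))
      (∑ k, y'.1 k * ((phaseDer N ι).d (Sum.inl k) f : _ → ℝ) (T, y t) +
        ∑ k, y'.2 k * ((phaseDer N ι).d (Sum.inr k) f : _ → ℝ) (T, y t)) s t := by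
  have hdiff : DifferentiableAt ℝ (fun z => (f : _ → ℝ) (T, z)) (y t) :=
    (smoothFn.differentiable f).comp (by fun_prop) _
  have h := HasFDerivAt.comp_hasDerivWithinAt (l := fun z => (f : _ → ℝ) (T, z)) t
    hdiff.hasFDerivAt hy
  refine h.congr_deriv ?_
  have hy' : y' = ∑ k, y'.1 k • (phaseDir (Sum.inl k) : Phase N) +
      ∑ k, y'.2 k • (phaseDir (Sum.inr k) : Phase N) := by
    ext i
    · simp [phaseDir, dirP, dirQ, Prod.fst_sum, Finset.sum_apply, Pi.single_apply]
    · simp [phaseDir, dirP, dirQ, Prod.snd_sum, Finset.sum_apply, Pi.single_apply]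
  conv_lhs => rw [hy']
  simp only [map_add, map_sum, map_smul, smul_eq_mul]
  exact congrArg₂ (· + ·)
    (Finset.sum_congr rfl fun k _ => congrArg _ (phaseDer_apply (Sum.inl k) f T (y t)).symm)
    (Finset.sum_congr rfl fun k _ => congrArg _ (phaseDer_apply (Sum.inr k) f T (y t)).symm)

/-- The mean value inequality along a segment in the convex ball; the phase space derivatives have
the same degree in T. -/
theorem IsHomog.exists_lipschitz {d : ℕ} {f : FieldFn N ι} (hf : IsHomog d f) (c : Phase N)
    (ρ : ℝ) : ∃ C, 0 ≤ C ∧ ∀ (T : ι → ℝ), ∀ x ∈ Metric.closedBall c ρ,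
      ∀ y ∈ Metric.closedBall c ρ,
      |(f : _ → ℝ) (T, y) - (f : _ → ℝ) (T, x)| ≤ C * ‖T‖ ^ d * ‖y - x‖ := by
  choose C hC0 hC using fun j => (hf.phaseDer j).exists_bound c ρ
  refine ⟨∑ k, C (Sum.inl k) + ∑ k, C (Sum.inr k), add_nonneg
    (Finset.sum_nonneg fun k _ => hC0 _) (Finset.sum_nonneg fun k _ => hC0 _), ?_⟩
  intro T x hx y hy
  have hline : ∀ s ∈ Set.Icc (0 : ℝ) 1, HasDerivWithinAt (fun s : ℝ => x + s • (y - x)) (y - x)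
      (Set.Icc 0 1) s := by
    intro s _
    simpa using (((hasDerivAt_id s).smul_const (y - x)).const_add x).hasDerivWithinAt
  have hmem : ∀ s ∈ Set.Icc (0 : ℝ) 1, x + s • (y - x) ∈ Metric.closedBall c ρ := fun s hs =>
    (convex_closedBall c ρ).add_smul_sub_mem hx hy hs
  have hb : ∀ (z : Fin N → ℝ) (g : Fin N → ℝ) (D : Fin N → ℝ), (∀ k, |g k| ≤ D k * ‖T‖ ^ d) →
      ‖z‖ ≤ ‖y - x‖ → |∑ k, z k * g k| ≤ (∑ k, D k) * ‖T‖ ^ d * ‖y - x‖ := by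
    intro z g D hg hz
    rw [Finset.sum_mul, Finset.sum_mul]
    refine (Finset.abs_sum_le_sum_abs _ _).trans (Finset.sum_le_sum fun k _ => ?_)
    rw [abs_mul, mul_comm]
    exact mul_le_mul (hg k) ((norm_le_pi_norm z k).trans hz) (abs_nonneg _)
      ((abs_nonneg _).trans (hg k))
  have h := Convex.norm_image_sub_le_of_norm_hasDerivWithin_le
    (C := (∑ k, C (Sum.inl k) + ∑ k, C (Sum.inr k)) * ‖T‖ ^ d * ‖y - x‖)
    (fun s hs => hasDerivWithinAt_fieldFn f T (hline s hs)) ?_ (convex_Icc 0 1)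
    (Set.left_mem_Icc.mpr zero_le_one) (Set.right_mem_Icc.mpr zero_le_one)
  · simpa using h
  · intro s hs
    rw [add_mul, add_mul]
    refine (norm_add_le _ _).trans (add_le_add ?_ ?_)
    · exact hb _ _ _ (fun k => hC _ T _ (hmem s hs)) (norm_fst_le _)
    · exact hb _ _ _ (fun k => hC _ T _ (hmem s hs)) (norm_snd_le _)

end Homogeneous

/-! ### The boundary value problem for small T. -/

section Evolution

variable {N : ℕ} {ι : Type*} [Fintype ι] {ta tb : ℝ}

/-- A solution of a linear differential inequality with zero boundary values is small. -/
theorem norm_le_of_boundary_zero (hab : ta ≤ tb) {E F : Type*} [NormedAddCommGroup E]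
    [NormedSpace ℝ E] [NormedAddCommGroup F] [NormedSpace ℝ F] {δ δ' : ℝ → E × F} {L ε : ℝ}
    (hL : 0 ≤ L) (hL' : L * (tb - ta) ≤ 1 / 2)
    (hδ : ∀ t ∈ Set.Icc ta tb, HasDerivWithinAt δ (δ' t) (Set.Icc ta tb) t)
    (h1 : (δ tb).1 = 0) (h2 : (δ ta).2 = 0)
    (hb : ∀ t ∈ Set.Icc ta tb, ‖δ' t‖ ≤ L * ‖δ t‖ + ε) :
    ∀ t ∈ Set.Icc ta tb, ‖δ t‖ ≤ 2 * (tb - ta) * ε := by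
  have hcont : ContinuousOn (fun t => ‖δ t‖) (Set.Icc ta tb) :=
    ContinuousOn.norm fun t ht => (hδ t ht).continuousWithinAt
  -- At a maximum point of the norm each component is controlled from the endpoint where it
  -- vanishes. The bound (L‖δ(t₀)‖ + ε)(tb - ta) is at most ‖δ(t₀)‖/2 + ε(tb - ta).
  obtain ⟨t₀, ht₀, hmax⟩ := isCompact_Icc.exists_isMaxOn (Set.nonempty_Icc.mpr hab) hcont
  have hmax' : ∀ t ∈ Set.Icc ta tb, ‖δ t‖ ≤ ‖δ t₀‖ := fun t ht => hmax ht
  have hb' : ∀ t ∈ Set.Icc ta tb, ‖δ' t‖ ≤ L * ‖δ t₀‖ + ε := fun t ht =>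
    (hb t ht).trans (by gcongr; exact hmax' t ht)
  have hnn : 0 ≤ L * ‖δ t₀‖ + ε := (norm_nonneg _).trans (hb' t₀ ht₀)
  have htb := Set.right_mem_Icc.mpr hab
  have hta := Set.left_mem_Icc.mpr hab
  have hfst : ‖(δ t₀).1‖ ≤ (L * ‖δ t₀‖ + ε) * (tb - ta) := by
    have h := Convex.norm_image_sub_le_of_norm_hasDerivWithin_le (f := fun t => (δ t).1)
      (f' := fun t => (δ' t).1) (C := L * ‖δ t₀‖ + ε)
      (fun t ht => (hδ t ht).fst) (fun t ht => (norm_fst_le _).trans (hb' t ht))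
      (convex_Icc ta tb) htb ht₀
    rw [h1, sub_zero] at h
    refine h.trans (mul_le_mul_of_nonneg_left ?_ hnn)
    rw [Real.norm_eq_abs, abs_le]
    constructor <;> linarith [ht₀.1, ht₀.2]
  have hsnd : ‖(δ t₀).2‖ ≤ (L * ‖δ t₀‖ + ε) * (tb - ta) := by
    have h := Convex.norm_image_sub_le_of_norm_hasDerivWithin_le (f := fun t => (δ t).2)
      (f' := fun t => (δ' t).2) (C := L * ‖δ t₀‖ + ε)
      (fun t ht => (hδ t ht).snd) (fun t ht => (norm_snd_le _).trans (hb' t ht))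
      (convex_Icc ta tb) hta ht₀
    rw [h2, sub_zero] at h
    refine h.trans (mul_le_mul_of_nonneg_left ?_ hnn)
    rw [Real.norm_eq_abs, abs_le]
    constructor <;> linarith [ht₀.1, ht₀.2]
  have htot : ‖δ t₀‖ ≤ (L * ‖δ t₀‖ + ε) * (tb - ta) := by
    rw [Prod.norm_def]
    exact max_le hfst hsnd
  intro t ht
  refine (hmax' t ht).trans ?_
  have h3 : L * (tb - ta) * ‖δ t₀‖ ≤ 1 / 2 * ‖δ t₀‖ :=
    mul_le_mul_of_nonneg_right hL' (norm_nonneg _)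
  linarith

/-- The hamiltonian vector field of `⟨H, T⟩/(tb - ta)`. -/
def hamField (ta tb : ℝ) (H : ι → Phase N → ℝ) (hH : ∀ α, ContDiff ℝ ∞ (H α)) (T : ι → ℝ)
    (x : Phase N) : Phase N :=
  (fun i => -((tb - ta)⁻¹ * ((phaseDer N ι).d (Sum.inr i) (hamFn H hH) : _ → ℝ) (T, x)),
    fun i => (tb - ta)⁻¹ * ((phaseDer N ι).d (Sum.inl i) (hamFn H hH) : _ → ℝ) (T, x))

variable (H : ι → Phase N → ℝ) (hH : ∀ α, ContDiff ℝ ∞ (H α))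

theorem phaseDer_hamFn (T : ι → ℝ) (x : Phase N) (j : Fin N ⊕ Fin N) :
    ((phaseDer N ι).d j (hamFn H hH) : _ → ℝ) (T, x) =
      ∑ α, T α * fderiv ℝ (H α) x (phaseDir j) := by
  rw [phaseDer_apply]
  have h : HasFDerivAt (fun z => (hamFn H hH : _ → ℝ) (T, z))
      (∑ α, T α • fderiv ℝ (H α) x) x := by
    refine HasFDerivAt.fun_sum fun α _ => ?_
    exact (((hH α).differentiable (by simp)) x).hasFDerivAt.const_mul (T α)
  rw [h.fderiv, sum_apply]
  rfl

theorem hamField_eq (T : ι → ℝ) (t : ℝ) (x : Phase N) :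
    hamField ta tb H hH T x =
      ((fun i => -∑ α, constConnection ta tb T t α * partialQ (H α) i x),
        fun i => ∑ α, constConnection ta tb T t α * partialP (H α) i x) := by
  rw [hamField]
  simp only [phaseDer_hamFn, Finset.mul_sum, constConnection, partialQ, partialP, phaseDir]
  congr 1 <;> funext i
  · congr 1
    refine Finset.sum_congr rfl fun α _ => ?_
    ring
  · refine Finset.sum_congr rfl fun α _ => ?_
    ring

theorem isBranch_iff {qa pb : Fin N → ℝ} {r : ℝ} {T : ι → ℝ} {x : ℝ → Phase N} :
    IsBranch H ta tb qa pb r T x ↔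
      (∀ t ∈ Set.Icc ta tb,
        HasDerivWithinAt x (hamField ta tb H hH T (x t)) (Set.Icc ta tb) t) ∧
      (x ta).2 = qa ∧ (x tb).1 = pb ∧ ∀ t ∈ Set.Icc ta tb, dist (x t) (pb, qa) < r := by
  constructor
  · rintro ⟨⟨h1, h2, h3⟩, h4⟩
    refine ⟨fun t ht => ?_, h2, h3, h4⟩
    rw [hamField_eq H hH T t]
    exact h1 t ht
  · rintro ⟨h1, h2, h3, h4⟩
    refine ⟨⟨fun t ht => ?_, h2, h3⟩, h4⟩
    have := h1 t ht
    rwa [hamField_eq H hH T t] at this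

theorem exists_hamField_bounds (hab : ta < tb) (c : Phase N) (ρ : ℝ) :
    ∃ C, 0 ≤ C ∧ ∀ (T : ι → ℝ), ∀ x ∈ Metric.closedBall c ρ,
      ‖hamField ta tb H hH T x‖ ≤ C * ‖T‖ ∧ ∀ y ∈ Metric.closedBall c ρ,
      ‖hamField ta tb H hH T y - hamField ta tb H hH T x‖ ≤ C * ‖T‖ * ‖y - x‖ := by
  have hinv : 0 ≤ (tb - ta)⁻¹ := inv_nonneg.mpr (sub_nonneg.mpr hab.le)
  choose B hB0 hB using fun j => ((isHomog_hamFn H hH).phaseDer j).exists_bound c ρ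
  choose L hL0 hL using fun j => ((isHomog_hamFn H hH).phaseDer j).exists_lipschitz c ρ
  set C := ∑ j, (B j + L j) with hC
  have hle : ∀ j, B j + L j ≤ C := fun j =>
    Finset.single_le_sum (f := fun j => B j + L j) (fun j _ => add_nonneg (hB0 j) (hL0 j))
      (Finset.mem_univ j)
  have hC0 : 0 ≤ C := Finset.sum_nonneg fun j _ => add_nonneg (hB0 j) (hL0 j)
  refine ⟨(tb - ta)⁻¹ * C, mul_nonneg hinv hC0, fun T x hx => ⟨?_, fun y hy => ?_⟩⟩
  · have key : ∀ j, ‖(tb - ta)⁻¹ * ((phaseDer N ι).d j (hamFn H hH) : _ → ℝ) (T, x)‖ ≤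
        (tb - ta)⁻¹ * C * ‖T‖ := by
      intro j
      rw [norm_mul, Real.norm_of_nonneg hinv, mul_assoc]
      refine mul_le_mul_of_nonneg_left ((hB j T x hx).trans ?_) hinv
      rw [pow_one]
      exact mul_le_mul_of_nonneg_right (by linarith [hle j, hL0 j]) (norm_nonneg _)
    rw [hamField, Prod.norm_def]
    refine max_le ((pi_norm_le_iff_of_nonneg (by positivity)).mpr fun i => ?_)
      ((pi_norm_le_iff_of_nonneg (by positivity)).mpr fun i => ?_)
    · rw [norm_neg]
      exact key _
    · exact key _
  · have key : ∀ j, ‖(tb - ta)⁻¹ * ((phaseDer N ι).d j (hamFn H hH) : _ → ℝ) (T, y) -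
        (tb - ta)⁻¹ * ((phaseDer N ι).d j (hamFn H hH) : _ → ℝ) (T, x)‖ ≤
        (tb - ta)⁻¹ * C * ‖T‖ * ‖y - x‖ := by
      intro j
      rw [← mul_sub, norm_mul, Real.norm_of_nonneg hinv, mul_assoc, mul_assoc]
      refine mul_le_mul_of_nonneg_left ((hL j T x hx y hy).trans ?_) hinv
      rw [pow_one, mul_assoc]
      exact mul_le_mul_of_nonneg_right (by linarith [hle j, hB0 j]) (by positivity)
    rw [hamField, hamField, Prod.mk_sub_mk, Prod.norm_def]
    refine max_le ((pi_norm_le_iff_of_nonneg (by positivity)).mpr fun i => ?_)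
      ((pi_norm_le_iff_of_nonneg (by positivity)).mpr fun i => ?_)
    · exact le_trans (le_of_eq ((congrArg norm (neg_sub'
        ((tb - ta)⁻¹ * ((phaseDer N ι).d (Sum.inr i) (hamFn H hH) : _ → ℝ) (T, y))
        ((tb - ta)⁻¹ * ((phaseDer N ι).d (Sum.inr i) (hamFn H hH) : _ → ℝ) (T, x))).symm).trans
          (norm_neg _))) (key (Sum.inr i))
    · exact key _

theorem continuous_hamField (T : ι → ℝ) : Continuous (hamField ta tb H hH T) := by
  have h : ∀ j, Continuous fun x : Phase N =>
      (((phaseDer N ι).d j (hamFn H hH) : FieldFn N ι) : _ → ℝ) (T, x) := fun j =>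
    (smoothFn.contDiff ((phaseDer N ι).d j (hamFn H hH))).continuous.comp
      (Continuous.prodMk_right T)
  exact (continuous_pi fun i => (continuous_const.mul (h _)).neg).prodMk
    (continuous_pi fun i => continuous_const.mul (h _))

/-- The difference of two branches has zero mixed boundary values and satisfies the linear
inequality with ε = 0. -/
theorem IsBranch.unique {H : ι → Phase N → ℝ} (hH : ∀ α, ContDiff ℝ ∞ (H α))
    (hab : ta < tb) (qa pb : Fin N → ℝ) (r : ℝ) :
    ∀ᶠ T in 𝓝 (0 : ι → ℝ), ∀ x y, IsBranch H ta tb qa pb r T x →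
      IsBranch H ta tb qa pb r T y → Set.EqOn y x (Set.Icc ta tb) := by
  obtain ⟨C, hC0, hC⟩ := exists_hamField_bounds H hH hab (pb, qa) r
  have hsmall : ∀ᶠ T in 𝓝 (0 : ι → ℝ), C * ‖T‖ * (tb - ta) < 1 / 2 := by
    have hcont : Continuous fun T : ι → ℝ => C * ‖T‖ * (tb - ta) := by fun_prop
    refine hcont.continuousAt.eventually_lt continuousAt_const ?_
    simp
  filter_upwards [hsmall] with T hT x y hx hy
  rw [isBranch_iff H hH] at hx hy
  obtain ⟨hx1, hx2, hx3, hx4⟩ := hx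
  obtain ⟨hy1, hy2, hy3, hy4⟩ := hy
  have h := norm_le_of_boundary_zero hab.le (δ := fun t => y t - x t) (L := C * ‖T‖) (ε := 0)
    (by positivity) hT.le (fun t ht => (hy1 t ht).sub (hx1 t ht))
    (by rw [Prod.fst_sub, hx3, hy3, sub_self]) (by rw [Prod.snd_sub, hx2, hy2, sub_self])
    (fun t ht => by
      rw [add_zero]
      exact (hC T _ (hx4 t ht).le).2 _ (hy4 t ht).le)
  intro t ht
  have h1 := h t ht
  rw [mul_zero] at h1
  exact sub_eq_zero.mp (norm_le_zero_iff.mp h1)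

/-- The integral operator whose fixed points are the solutions of the boundary value problem. -/
def picard (hab : ta < tb) (T : ι → ℝ) (qa pb : Fin N → ℝ) (x : C(Set.Icc ta tb, Phase N)) :
    C(Set.Icc ta tb, Phase N) where
  toFun t :=
    (pb + ∫ s in tb..t, (hamField ta tb H hH T (Set.IccExtend hab.le x s)).1,
      qa + ∫ s in ta..t, (hamField ta tb H hH T (Set.IccExtend hab.le x s)).2)
  continuous_toFun := by
    have h : Continuous fun s => hamField ta tb H hH T (Set.IccExtend hab.le x s) :=
      (continuous_hamField H hH T).comp x.continuous.Icc_extend'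
    have h1 := intervalIntegral.continuous_primitive
      (fun a b => h.fst.intervalIntegrable (μ := MeasureTheory.volume) a b) tb
    have h2 := intervalIntegral.continuous_primitive
      (fun a b => h.snd.intervalIntegrable (μ := MeasureTheory.volume) a b) ta
    exact (continuous_const.add (h1.comp continuous_subtype_val)).prodMk
      (continuous_const.add (h2.comp continuous_subtype_val))

theorem picard_apply (hab : ta < tb) (T : ι → ℝ) (qa pb : Fin N → ℝ)
    (x : C(Set.Icc ta tb, Phase N)) (t : Set.Icc ta tb) : picard H hH hab T qa pb x t =
      (pb + ∫ s in tb..t, (hamField ta tb H hH T (Set.IccExtend hab.le x s)).1,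
        qa + ∫ s in ta..t, (hamField ta tb H hH T (Set.IccExtend hab.le x s)).2) := rfl

/-- For small T the integral operator is a contraction with factor 1/2 of the paths in the closed
ball of radius r/2; the smaller radius gives the strict inequality in `IsBranch`. -/
theorem exists_isBranch {H : ι → Phase N → ℝ} (hH : ∀ α, ContDiff ℝ ∞ (H α))
    (hab : ta < tb) (qa pb : Fin N → ℝ) {r : ℝ} (hr : 0 < r) :
    ∀ᶠ T in 𝓝 (0 : ι → ℝ), ∃ x, IsBranch H ta tb qa pb r T x := by
  obtain ⟨C, hC0, hC⟩ := exists_hamField_bounds H hH hab (pb, qa) (r / 2)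
  have hcont : Continuous fun T : ι → ℝ => C * ‖T‖ * (tb - ta) := by fun_prop
  have hsmall : ∀ᶠ T in 𝓝 (0 : ι → ℝ), C * ‖T‖ * (tb - ta) < 1 / 2 :=
    hcont.continuousAt.eventually_lt continuousAt_const (by simp)
  have hsmall' : ∀ᶠ T in 𝓝 (0 : ι → ℝ), C * ‖T‖ * (tb - ta) < r / 2 :=
    hcont.continuousAt.eventually_lt continuousAt_const (by simpa using hr)
  filter_upwards [hsmall, hsmall'] with T hT hT'
  set s : Set C(Set.Icc ta tb, Phase N) := {x | ∀ t, x t ∈ Metric.closedBall (pb, qa) (r / 2)}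
    with hs
  have hsub : ∀ (t₀ : ℝ), t₀ ∈ Set.Icc ta tb → ∀ t ∈ Set.Icc ta tb, |t - t₀| ≤ tb - ta := by
    intro t₀ h₀ t ht
    rw [abs_le]
    constructor <;> linarith [h₀.1, h₀.2, ht.1, ht.2]
  have hta := Set.left_mem_Icc.mpr hab.le
  have htb := Set.right_mem_Icc.mpr hab.le
  have hmaps : Set.MapsTo (picard H hH hab T qa pb) s s := by
    intro x hx t
    have hb : ∀ u, ‖hamField ta tb H hH T (Set.IccExtend hab.le x u)‖ ≤ C * ‖T‖ :=
      fun u => (hC T _ (hx _)).1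
    rw [Metric.mem_closedBall, dist_eq_norm, picard_apply, Prod.mk_sub_mk,
      add_sub_cancel_left, add_sub_cancel_left, Prod.norm_def]
    refine (max_le ?_ ?_).trans hT'.le
    · exact (intervalIntegral.norm_integral_le_of_norm_le_const
        fun u _ => (norm_fst_le _).trans (hb u)).trans
        (mul_le_mul_of_nonneg_left (hsub _ htb _ t.2) (by positivity))
    · exact (intervalIntegral.norm_integral_le_of_norm_le_const
        fun u _ => (norm_snd_le _).trans (hb u)).trans
        (mul_le_mul_of_nonneg_left (hsub _ hta _ t.2) (by positivity))
  have hclosed : IsClosed s := by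
    have : s = ⋂ t, {x : C(Set.Icc ta tb, Phase N) | x t ∈ Metric.closedBall (pb, qa) (r / 2)} := by
      ext x
      simp [hs]
    rw [this]
    exact isClosed_iInter fun t =>
      Metric.isClosed_closedBall.preimage (continuous_eval_const t)
  have hcontr : ∀ x ∈ s, ∀ y ∈ s,
      dist (picard H hH hab T qa pb x) (picard H hH hab T qa pb y) ≤
        (1 / 2 : NNReal) * dist x y := by
    intro x hx y hy
    rw [ContinuousMap.dist_le (by positivity)]
    intro t
    have hint : ∀ (z : C(Set.Icc ta tb, Phase N)),
        Continuous fun u => hamField ta tb H hH T (Set.IccExtend hab.le z u) := fun z =>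
      (continuous_hamField H hH T).comp z.continuous.Icc_extend'
    have hb : ∀ u, ‖hamField ta tb H hH T (Set.IccExtend hab.le x u) -
        hamField ta tb H hH T (Set.IccExtend hab.le y u)‖ ≤ C * ‖T‖ * dist x y := by
      intro u
      refine ((hC T _ (hy _)).2 _ (hx _)).trans ?_
      rw [← dist_eq_norm]
      gcongr
      exact ContinuousMap.dist_apply_le_dist _
    have hfin : C * ‖T‖ * dist x y * (tb - ta) ≤ (1 / 2 : NNReal) * dist x y := by
      have := mul_le_mul_of_nonneg_right hT.le (dist_nonneg (x := x) (y := y))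
      push_cast
      linarith
    rw [dist_eq_norm, picard_apply, picard_apply, Prod.mk_sub_mk,
      add_sub_add_left_eq_sub, add_sub_add_left_eq_sub,
      ← intervalIntegral.integral_sub ((hint x).fst.intervalIntegrable _ _)
        ((hint y).fst.intervalIntegrable _ _),
      ← intervalIntegral.integral_sub ((hint x).snd.intervalIntegrable _ _)
        ((hint y).snd.intervalIntegrable _ _), Prod.norm_def]
    refine (max_le ?_ ?_).trans hfin
    · exact (intervalIntegral.norm_integral_le_of_norm_le_const
        fun u _ => (norm_fst_le (_ - _)).trans (hb u)).trans
        (mul_le_mul_of_nonneg_left (hsub _ htb _ t.2) (by positivity))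
    · exact (intervalIntegral.norm_integral_le_of_norm_le_const
        fun u _ => (norm_snd_le (_ - _)).trans (hb u)).trans
        (mul_le_mul_of_nonneg_left (hsub _ hta _ t.2) (by positivity))
  have hc : ContractingWith (1 / 2 : NNReal) (hmaps.restrict _ s s) := by
    refine ⟨by norm_num, LipschitzWith.of_dist_le_mul fun x y => ?_⟩
    exact hcontr x x.2 y y.2
  have h0 : ContinuousMap.const (Set.Icc ta tb) ((pb, qa) : Phase N) ∈ s := fun t =>
    Metric.mem_closedBall_self (by positivity)
  obtain ⟨x, hxs, hfix, -⟩ := ContractingWith.exists_fixedPoint' hclosed.isComplete hmaps hc h0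
    (edist_ne_top _ _)
  have hg : Continuous fun u => hamField ta tb H hH T (Set.IccExtend hab.le x u) :=
    (continuous_hamField H hH T).comp x.continuous.Icc_extend'
  have hx : ∀ t, (ht : t ∈ Set.Icc ta tb) → Set.IccExtend hab.le x t =
      (pb + ∫ s in tb..t, (hamField ta tb H hH T (Set.IccExtend hab.le x s)).1,
        qa + ∫ s in ta..t, (hamField ta tb H hH T (Set.IccExtend hab.le x s)).2) := by
    intro t ht
    rw [Set.IccExtend_of_mem _ _ ht]
    conv_lhs => rw [← hfix]
    rfl
  refine ⟨Set.IccExtend hab.le x, (isBranch_iff H hH).mpr ⟨fun t ht => ?_, ?_, ?_, fun t _ => ?_⟩⟩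
  · refine HasDerivWithinAt.congr ?_ hx (hx t ht)
    have h1 := (hg.fst.integral_hasStrictDerivAt tb t).hasDerivAt.const_add pb
    have h2 := (hg.snd.integral_hasStrictDerivAt ta t).hasDerivAt.const_add qa
    exact (h1.prodMk h2).hasDerivWithinAt
  · rw [hx ta hta]
    simp
  · rw [hx tb htb]
    simp
  · exact lt_of_le_of_lt (hxs _) (by linarith)

end Evolution

/-! ### Formal Taylor expansion in the momenta. -/

section TaylorPolynomial

open PowerSeries

variable {N : ℕ} {𝓕 𝓑 : Type*} [CommRing 𝓕] [Algebra ℝ 𝓕] [CommRing 𝓑] [Algebra ℝ 𝓑]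

/-- The Taylor polynomial in the momenta, with increments `c`. -/
def taylorPoly (D : CommDer (Fin N ⊕ Fin N) 𝓕) (φ : 𝓕 → 𝓑) (c : Fin N → 𝓑) (M : ℕ) (f : 𝓕) : 𝓑 :=
  ∑ j ∈ Finset.range M, ((j.factorial : ℝ)⁻¹) • taylorTerm D φ c j f

/-- The chain rule. Because the phase space derivations commute, the j places where an increment can
be differentiated contribute equally. -/
theorem derivation_taylorTerm (D : CommDer (Fin N ⊕ Fin N) 𝓕) {φ : 𝓕 → 𝓑} {Δ : Derivation ℝ 𝓑 𝓑}
    {i : Fin N ⊕ Fin N} (hφ : ∀ f, Δ (φ f) = φ (D.d i f)) (c : Fin N → 𝓑) (j : ℕ) (f : 𝓕) :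
    Δ (taylorTerm D φ c j f) = taylorTerm D φ c j (D.d i f) +
      j * ∑ l, Δ (c l) * taylorTerm D φ c (j - 1) (D.d (Sum.inl l) f) := by
  induction j generalizing f with
  | zero => simp [taylorTerm, hφ]
  | succ j ih =>
    have h1 : ∀ k, (j : 𝓑) * (c k * ∑ l, Δ (c l) *
        taylorTerm D φ c (j - 1) (D.d (Sum.inl l) (D.d (Sum.inl k) f))) =
        j * ∑ l, Δ (c l) *
          (c k * taylorTerm D φ c (j - 1) (D.d (Sum.inl k) (D.d (Sum.inl l) f))) := by
      intro k
      congr 1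
      rw [Finset.mul_sum]
      refine Finset.sum_congr rfl fun l _ => ?_
      rw [D.comm (Sum.inl l) (Sum.inl k)]
      ring
    have h2 : (j : 𝓑) * ∑ l, Δ (c l) * taylorTerm D φ c j (D.d (Sum.inl l) f) =
        ∑ k, (j : 𝓑) * ∑ l, Δ (c l) *
          (c k * taylorTerm D φ c (j - 1) (D.d (Sum.inl k) (D.d (Sum.inl l) f))) := by
      rcases j with _ | j
      · simp
      · rw [← Finset.mul_sum, Finset.sum_comm]
        congr 1
        refine Finset.sum_congr rfl fun l _ => ?_
        rw [taylorTerm, Finset.mul_sum]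
        rfl
    rw [taylorTerm, map_sum, taylorTerm, Nat.add_sub_cancel, Nat.cast_succ, add_mul, one_mul, h2,
      add_comm (∑ k, (j : 𝓑) * _), ← add_assoc, ← Finset.sum_add_distrib, ← Finset.sum_add_distrib]
    refine Finset.sum_congr rfl fun k _ => ?_
    rw [Derivation.leibniz, smul_eq_mul, smul_eq_mul, ih, mul_add, ← h1, D.comm i]
    ring

/-- The chain rule for the Taylor polynomial; differentiating an increment lowers the length by one.
-/
theorem derivation_taylorPoly (D : CommDer (Fin N ⊕ Fin N) 𝓕) {φ : 𝓕 → 𝓑}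
    {Δ : Derivation ℝ 𝓑 𝓑} {i : Fin N ⊕ Fin N} (hφ : ∀ f, Δ (φ f) = φ (D.d i f))
    (c : Fin N → 𝓑) (M : ℕ) (f : 𝓕) :
    Δ (taylorPoly D φ c (M + 1) f) = taylorPoly D φ c (M + 1) (D.d i f) +
      ∑ l, Δ (c l) * taylorPoly D φ c M (D.d (Sum.inl l) f) := by
  have h : ∀ j : ℕ, ((((j + 1).factorial : ℝ)⁻¹) • (((j + 1 : ℕ) : 𝓑) *
      ∑ l, Δ (c l) * taylorTerm D φ c j (D.d (Sum.inl l) f))) =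
      ∑ l, Δ (c l) * (((j.factorial : ℝ)⁻¹) • taylorTerm D φ c j (D.d (Sum.inl l) f)) := by
    intro j
    rw [← nsmul_eq_mul, ← Nat.cast_smul_eq_nsmul ℝ, smul_smul, Finset.smul_sum]
    refine Finset.sum_congr rfl fun l _ => ?_
    rw [mul_smul_comm]
    congr 1
    have h1 := Nat.cast_ne_zero (R := ℝ).mpr j.factorial_ne_zero
    rw [Nat.factorial_succ]
    push_cast
    field_simp
  simp only [taylorPoly, map_sum, Derivation.map_smul, derivation_taylorTerm D hφ, smul_add,
    Finset.sum_add_distrib]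
  congr 1
  rw [Finset.sum_range_succ', Nat.cast_zero, zero_mul, smul_zero, add_zero]
  simp only [Nat.add_sub_cancel, h]
  rw [Finset.sum_comm]
  exact Finset.sum_congr rfl fun l _ => (Finset.mul_sum _ _ _).symm

theorem X_pow_dvd_taylorTerm (D : CommDer (Fin N ⊕ Fin N) 𝓕) (φ : 𝓕 → 𝓕⟦X⟧) {c : Fin N → 𝓕⟦X⟧}
    (hc : ∀ k, X ∣ c k) (j : ℕ) (f : 𝓕) : X ^ j ∣ taylorTerm D φ c j f := by
  induction j generalizing f with
  | zero => simp
  | succ j ih =>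
    rw [taylorTerm, pow_succ']
    exact Finset.dvd_sum fun k _ => mul_dvd_mul (hc k) (ih _)

/-- Increments without constant term make the j-th Taylor term start in degree j, so longer
polynomials have the same low coefficients. -/
theorem coeff_taylorPoly_of_lt (D : CommDer (Fin N ⊕ Fin N) 𝓕) (φ : 𝓕 → 𝓕⟦X⟧)
    {c : Fin N → 𝓕⟦X⟧} (hc : ∀ k, X ∣ c k) {n M : ℕ} (hn : n < M) (f : 𝓕) :
    coeff n (taylorPoly D φ c M f) = coeff n (taylorPoly D φ c (n + 1) f) := by
  rw [taylorPoly, taylorPoly, map_sum, map_sum]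
  symm
  refine Finset.sum_subset (Finset.range_subset_range.mpr hn) fun j _ hj => ?_
  rw [Finset.mem_range, not_lt] at hj
  rw [coeff_smul, X_pow_dvd_iff.mp (X_pow_dvd_taylorTerm D φ hc j f) n (by omega), smul_zero]

end TaylorPolynomial

/-! ### The series S and the momentum increments -∂S/∂q. -/

section LeadingSeries

open PowerSeries

variable {N : ℕ} {ι : Type*} [Fintype ι] {ta tb : ℝ} (H : ι → Phase N → ℝ)
  (hH : ∀ α, ContDiff ℝ ∞ (H α))

theorem leadingAction_zero : leadingAction ta tb H hH 0 = 0 := by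
  simp [leadingAction, connectedPart]

/-- The increments of the momenta. -/
def momentumSeries (ta tb : ℝ) (H : ι → Phase N → ℝ) (hH : ∀ α, ContDiff ℝ ∞ (H α)) (k : Fin N) :
    PowerSeries (FieldFn N ι) := -mapDer ((phaseDer N ι).d (Sum.inr k)) (leadingSeries ta tb H hH)

theorem coeff_momentumSeries (k : Fin N) (n : ℕ) : coeff n (momentumSeries ta tb H hH k) =
    -(phaseDer N ι).d (Sum.inr k) (leadingAction ta tb H hH n) := by
  rw [momentumSeries, map_neg, coeff_mapDer, leadingSeries, coeff_mk]

theorem X_dvd_momentumSeries (k : Fin N) : X ∣ momentumSeries ta tb H hH k := by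
  rw [X_dvd_iff, ← coeff_zero_eq_constantCoeff_apply, coeff_momentumSeries, leadingAction_zero,
    map_zero, neg_zero]

/-- The increments are the components of a gradient, so their derivative matrix is symmetric. -/
theorem mapDer_momentumSeries_comm (k l : Fin N) :
    mapDer ((phaseDer N ι).d (Sum.inr l)) (momentumSeries ta tb H hH k) =
      mapDer ((phaseDer N ι).d (Sum.inr k)) (momentumSeries ta tb H hH l) := by
  ext1 n
  rw [coeff_mapDer, coeff_mapDer, coeff_momentumSeries, coeff_momentumSeries, map_neg, map_neg,
    (phaseDer N ι).comm]

theorem hamiltonJacobi_coeff (hab : ta < tb) {n M : ℕ} (hn : n < M) :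
    ((n : ℝ) + 1) • leadingAction ta tb H hH (n + 1) = coeff n (taylorPoly (phaseDer N ι)
      PowerSeries.C (momentumSeries ta tb H hH) M (-hamFn H hH)) := by
  rw [coeff_taylorPoly_of_lt _ _ (X_dvd_momentumSeries H hH) hn,
    hamiltonJacobi_leadingAction H hH hab, taylorPoly, map_sum]
  rfl

/-- The q^k-derivative of the Hamilton-Jacobi equation: a transport equation for the momentum
increments, which will be compared with the equation of motion for p. -/
theorem hamiltonJacobi_derivative_coeff (hab : ta < tb) {n M : ℕ} (hn : n < M) (k : Fin N) :
    ((n : ℝ) + 1) • (phaseDer N ι).d (Sum.inr k) (leadingAction ta tb H hH (n + 1)) =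
      coeff n (taylorPoly (phaseDer N ι) PowerSeries.C (momentumSeries ta tb H hH) M
        (-(phaseDer N ι).d (Sum.inr k) (hamFn H hH)) +
        ∑ l, mapDer ((phaseDer N ι).d (Sum.inr k)) (momentumSeries ta tb H hH l) *
          taylorPoly (phaseDer N ι) PowerSeries.C (momentumSeries ta tb H hH) M
            (-(phaseDer N ι).d (Sum.inl l) (hamFn H hH))) := by
  have hX : ∀ l, X ∣ mapDer ((phaseDer N ι).d (Sum.inr k)) (momentumSeries ta tb H hH l) := by
    intro l
    have := X_pow_dvd_mapDer (n := 1) ((phaseDer N ι).d (Sum.inr k))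
      (by simpa using X_dvd_momentumSeries (ta := ta) (tb := tb) H hH l)
    simpa using this
  have hC : ∀ f : FieldFn N ι, mapDer ((phaseDer N ι).d (Sum.inr k)) (PowerSeries.C f) =
      PowerSeries.C ((phaseDer N ι).d (Sum.inr k) f) := by
    intro f
    ext1 m
    rw [coeff_mapDer, coeff_C, coeff_C]
    split_ifs
    · rfl
    · exact map_zero _
  have h := congrArg ((phaseDer N ι).d (Sum.inr k))
    (hamiltonJacobi_coeff H hH hab (Nat.lt_succ_of_lt hn))
  rw [Derivation.map_smul, ← coeff_mapDer, derivation_taylorPoly _ hC] at h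
  rw [h, map_add, map_add, coeff_taylorPoly_of_lt _ _ (X_dvd_momentumSeries H hH)
    (Nat.lt_succ_of_lt hn), coeff_taylorPoly_of_lt _ _ (X_dvd_momentumSeries H hH) hn]
  simp only [map_neg]

theorem isHomog_ev {V : Type} [Fintype V] {f : FieldFn N ι} (hf : IsHomog 1 f)
    (P : MvPolynomial (V × (Fin N ⊕ Fin N)) ℝ) :
    IsHomog (Fintype.card V) (ev (fun _ => (phaseDer N ι).jet f) P) := by
  have hjet : ∀ m, IsHomog 1 ((phaseDer N ι).jet f m) := by
    intro m
    have : LeftCommutative (fun (j : Fin N ⊕ Fin N) (g : FieldFn N ι) => (phaseDer N ι).d j g) :=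
      ⟨fun i j g => (phaseDer N ι).comm i j g⟩
    rw [CommDer.jet]
    generalize Finsupp.toMultiset m = s
    induction s using Multiset.induction_on with
    | empty => simpa using hf
    | cons a s ih => simpa using ih.phaseDer a
  intro c T x
  induction P using MvPolynomial.induction_on' with
  | add p q hp hq =>
    rw [map_add]
    change _ + _ = c ^ _ * (_ + _)
    rw [hp, hq, mul_add]
  | monomial m a =>
    rw [ev_monomial, ← evalAt_apply, ← evalAt_apply, map_smul, map_smul, map_prod, map_prod,
      smul_eq_mul, smul_eq_mul, mul_left_comm]
    congr 1
    rw [← Finset.card_univ, ← Finset.prod_const, ← Finset.prod_mul_distrib]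
    refine Finset.prod_congr rfl fun r _ => ?_
    rw [evalAt_apply, evalAt_apply, hjet, pow_one]

theorem IsHomog.zero (d : ℕ) : IsHomog d (0 : FieldFn N ι) := by
  intro c T x
  change (0 : ℝ) = c ^ d * 0
  rw [mul_zero]

theorem IsHomog.add {d : ℕ} {f g : FieldFn N ι} (hf : IsHomog d f) (hg : IsHomog d g) :
    IsHomog d (f + g) := by
  intro c T x
  change _ + _ = c ^ d * (_ + _)
  rw [hf, hg, mul_add]

theorem IsHomog.sum {σ : Type*} (s : Finset σ) {d : ℕ} {f : σ → FieldFn N ι}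
    (h : ∀ i ∈ s, IsHomog d (f i)) : IsHomog d (∑ i ∈ s, f i) := by
  classical
  induction s using Finset.induction_on with
  | empty => exact IsHomog.zero d
  | insert a s ha ih =>
    rw [Finset.sum_insert ha]
    exact (h a (Finset.mem_insert_self _ _)).add
      (ih fun i hi => h i (Finset.mem_insert_of_mem hi))

theorem IsHomog.smul {d : ℕ} {f : FieldFn N ι} (a : ℝ) (hf : IsHomog d f) :
    IsHomog d (a • f) := by
  intro c T x
  change a * _ = c ^ d * (a * _)
  rw [hf]
  ring

theorem IsHomog.neg {d : ℕ} {f : FieldFn N ι} (hf : IsHomog d f) : IsHomog d (-f) := by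
  simpa using hf.smul (-1)

theorem IsHomog.mul {d e : ℕ} {f g : FieldFn N ι} (hf : IsHomog d f) (hg : IsHomog e g) :
    IsHomog (d + e) (f * g) := by
  intro c T x
  change _ * _ = c ^ (d + e) * (_ * _)
  rw [hf, hg]
  ring

/-- A tree with n vertices has n factors linear in T. -/
theorem isHomog_leadingAction (n : ℕ) : IsHomog n (leadingAction ta tb H hH n) := by
  rcases n with _ | n
  · rw [leadingAction_zero]
    exact IsHomog.zero 0
  · rw [leadingAction, connectedPart, Nat.add_sub_cancel, coeff_connectedSum]
    refine IsHomog.smul _ (IsHomog.sum _ fun E _ => IsHomog.smul _ ?_)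
    have h := isHomog_ev (V := Fin (n + 1)) (f := densFn ta tb H hH)
      ((isHomog_hamFn H hH).smul _) (∏ e ∈ E, edge N e.1 e.2)
    rwa [Fintype.card_fin] at h

end LeadingSeries

/-! ### Uniform asymptotic expansions in T. -/

section Expansions

open PowerSeries Asymptotics Filter

variable {N : ℕ} {ι : Type*} [Fintype ι]

/-- The domain of the parameters `T`, `τ`, `q` of the asymptotic expansions. -/
def expDomain (ι : Type*) [Fintype ι] (qa : Fin N → ℝ) (r : ℝ) :
    Set ((ι → ℝ) × ℝ × (Fin N → ℝ)) :=
  {ζ | ‖ζ.1‖ ≤ 1 ∧ ζ.2.1 ∈ Set.Icc 0 1 ∧ ζ.2.2 ∈ Metric.closedBall qa r}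

/-- The partial sums of a series with coefficients depending on `T` and `q`. -/
def partialSum (pb : Fin N → ℝ) (A : PowerSeries (FieldFn N ι)) (M : ℕ)
    (ζ : (ι → ℝ) × ℝ × (Fin N → ℝ)) : ℝ :=
  ∑ n ∈ Finset.range M, ζ.2.1 ^ n * ((coeff n A : FieldFn N ι) : _ → ℝ) (ζ.1, (pb, ζ.2.2))

/-- `A` is, up to order `M`, the expansion of the function `a` of weight `d`. -/
structure IsExp (qa pb : Fin N → ℝ) (r : ℝ) (M d : ℕ) (A : PowerSeries (FieldFn N ι))
    (a : (ι → ℝ) × ℝ × (Fin N → ℝ) → ℝ) : Prop where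
  homog : ∀ n, IsHomog (n + d) (coeff n A)
  approx : (fun ζ => a ζ - partialSum pb A M ζ) =O[𝓟 (expDomain ι qa r)] fun ζ => ‖ζ.1‖ ^ (M + d)

variable {qa pb : Fin N → ℝ} {r : ℝ}

theorem IsHomog.isBigO {d : ℕ} {f : FieldFn N ι} (hf : IsHomog d f) (qa pb : Fin N → ℝ) (r : ℝ) :
    (fun ζ : (ι → ℝ) × ℝ × (Fin N → ℝ) => (f : _ → ℝ) (ζ.1, (pb, ζ.2.2)))
      =O[𝓟 (expDomain ι qa r)] fun ζ => ‖ζ.1‖ ^ d := by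
  obtain ⟨C, -, hC⟩ := hf.exists_bound (pb, qa) r
  refine isBigO_principal.mpr ⟨C, fun ζ hζ => ?_⟩
  rw [Real.norm_eq_abs, norm_pow, norm_norm]
  refine hC _ _ ?_
  rw [Metric.mem_closedBall, Prod.dist_eq, dist_self]
  exact max_le (dist_nonneg.trans hζ.2.2) hζ.2.2

theorem isBigO_norm_pow {k l : ℕ} (h : k ≤ l) :
    (fun ζ : (ι → ℝ) × ℝ × (Fin N → ℝ) => ‖ζ.1‖ ^ l) =O[𝓟 (expDomain ι qa r)]
      fun ζ => ‖ζ.1‖ ^ k := by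
  refine isBigO_principal.mpr ⟨1, fun ζ hζ => ?_⟩
  rw [one_mul, norm_pow, norm_pow, norm_norm]
  exact pow_le_pow_of_le_one (norm_nonneg _) hζ.1 h

theorem isBigO_pow_one (n : ℕ) :
    (fun ζ : (ι → ℝ) × ℝ × (Fin N → ℝ) => ζ.2.1 ^ n) =O[𝓟 (expDomain ι qa r)]
      fun _ => (1 : ℝ) := by
  refine isBigO_principal.mpr ⟨1, fun ζ hζ => ?_⟩
  rw [norm_pow, norm_one, mul_one, Real.norm_of_nonneg hζ.2.1.1]
  exact pow_le_one₀ hζ.2.1.1 hζ.2.1.2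

theorem isBigO_term {k : ℕ} {f : FieldFn N ι} (hf : IsHomog k f) (n : ℕ) :
    (fun ζ : (ι → ℝ) × ℝ × (Fin N → ℝ) => ζ.2.1 ^ n * (f : _ → ℝ) (ζ.1, (pb, ζ.2.2)))
      =O[𝓟 (expDomain ι qa r)] fun ζ => ‖ζ.1‖ ^ k := by
  simpa using (isBigO_pow_one (qa := qa) (r := r) n).mul (hf.isBigO qa pb r)

theorem isBigO_partialSum {d : ℕ} {A : PowerSeries (FieldFn N ι)}
    (hA : ∀ n, IsHomog (n + d) (coeff n A)) (M : ℕ) :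
    partialSum pb A M =O[𝓟 (expDomain ι qa r)] fun ζ => ‖ζ.1‖ ^ d := by
  refine IsBigO.fun_sum fun n _ => ?_
  exact (isBigO_term (hA n) n).trans (isBigO_norm_pow (Nat.le_add_left d n))

theorem IsExp.isBigO {M d : ℕ} {A : PowerSeries (FieldFn N ι)}
    {a : (ι → ℝ) × ℝ × (Fin N → ℝ) → ℝ} (h : IsExp qa pb r M d A a) :
    a =O[𝓟 (expDomain ι qa r)] fun ζ => ‖ζ.1‖ ^ d := by
  have h1 := (h.approx.trans (isBigO_norm_pow (Nat.le_add_left d M))).add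
    (isBigO_partialSum (pb := pb) (qa := qa) (r := r) h.homog M)
  simpa using h1

theorem IsExp.add {M d : ℕ} {A B : PowerSeries (FieldFn N ι)}
    {a b : (ι → ℝ) × ℝ × (Fin N → ℝ) → ℝ} (hA : IsExp qa pb r M d A a)
    (hB : IsExp qa pb r M d B b) : IsExp qa pb r M d (A + B) fun ζ => a ζ + b ζ := by
  refine ⟨fun n => ?_, ?_⟩
  · rw [map_add]
    exact (hA.homog n).add (hB.homog n)
  · refine (hA.approx.add hB.approx).congr_left fun ζ => ?_
    have h : partialSum pb (A + B) M ζ = partialSum pb A M ζ + partialSum pb B M ζ := by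
      rw [partialSum, partialSum, partialSum, ← Finset.sum_add_distrib]
      refine Finset.sum_congr rfl fun n _ => ?_
      rw [map_add, ← mul_add]
      rfl
    rw [h]
    ring

theorem IsExp.smul {M d : ℕ} {A : PowerSeries (FieldFn N ι)}
    {a : (ι → ℝ) × ℝ × (Fin N → ℝ) → ℝ} (c : ℝ) (hA : IsExp qa pb r M d A a) :
    IsExp qa pb r M d (c • A) fun ζ => c * a ζ := by
  refine ⟨fun n => ?_, ?_⟩
  · rw [PowerSeries.coeff_smul]
    exact (hA.homog n).smul c
  · refine (hA.approx.const_mul_left c).congr_left fun ζ => ?_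
    have h : partialSum pb (c • A) M ζ = c * partialSum pb A M ζ := by
      rw [partialSum, partialSum, Finset.mul_sum]
      refine Finset.sum_congr rfl fun n _ => ?_
      rw [PowerSeries.coeff_smul, mul_left_comm]
      rfl
    rw [h]
    ring

theorem IsExp.zero (M d : ℕ) : IsExp qa pb r M d (0 : PowerSeries (FieldFn N ι)) fun _ => 0 := by
  refine ⟨fun n => ?_, ?_⟩
  · rw [map_zero]
    exact IsHomog.zero _
  · refine (isBigO_zero _ _).congr_left fun ζ => ?_
    rw [partialSum, Finset.sum_eq_zero, sub_zero]
    intro n _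
    rw [map_zero]
    exact mul_zero _

theorem IsExp.sum {σ : Type*} (s : Finset σ) {M d : ℕ} {A : σ → PowerSeries (FieldFn N ι)}
    {a : σ → (ι → ℝ) × ℝ × (Fin N → ℝ) → ℝ} (h : ∀ i ∈ s, IsExp qa pb r M d (A i) (a i)) :
    IsExp qa pb r M d (∑ i ∈ s, A i) fun ζ => ∑ i ∈ s, a i ζ := by
  classical
  induction s using Finset.induction_on with
  | empty => simpa using IsExp.zero M d
  | insert i s hi ih =>
    simp only [Finset.sum_insert hi]
    exact (h i (Finset.mem_insert_self _ _)).add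
      (ih fun j hj => h j (Finset.mem_insert_of_mem hj))

/-- The difference consists of the products of total order at least M. -/
theorem isBigO_partialSum_mul {d e : ℕ} {A B : PowerSeries (FieldFn N ι)}
    (hA : ∀ n, IsHomog (n + d) (coeff n A)) (hB : ∀ n, IsHomog (n + e) (coeff n B)) (M : ℕ) :
    (fun ζ => partialSum pb A M ζ * partialSum pb B M ζ - partialSum pb (A * B) M ζ)
      =O[𝓟 (expDomain ι qa r)] fun ζ => ‖ζ.1‖ ^ (M + (d + e)) := by
  classical
  set P := Finset.range M ×ˢ Finset.range M with hP
  let g : ℕ × ℕ → (ι → ℝ) × ℝ × (Fin N → ℝ) → ℝ := fun p ζ =>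
    ζ.2.1 ^ (p.1 + p.2) * ((coeff p.1 A * coeff p.2 B : FieldFn N ι) : _ → ℝ) (ζ.1, (pb, ζ.2.2))
  have h1 : ∀ ζ, partialSum pb A M ζ * partialSum pb B M ζ = ∑ p ∈ P, g p ζ := by
    intro ζ
    rw [partialSum, partialSum, Finset.sum_mul_sum, ← Finset.sum_product']
    refine Finset.sum_congr rfl fun p _ => ?_
    change _ = ζ.2.1 ^ (p.1 + p.2) * (_ * _)
    rw [pow_add]
    ring
  have h2 : ∀ ζ, partialSum pb (A * B) M ζ = ∑ p ∈ P with p.1 + p.2 < M, g p ζ := by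
    intro ζ
    have hmaps : ∀ p ∈ P.filter fun p => p.1 + p.2 < M, p.1 + p.2 ∈ Finset.range M := by
      intro p hp
      exact Finset.mem_range.mpr (Finset.mem_filter.mp hp).2
    rw [partialSum, ← Finset.sum_fiberwise_of_maps_to hmaps]
    refine Finset.sum_congr rfl fun n hn => ?_
    have hn : n < M := Finset.mem_range.mp hn
    have hset : (P.filter fun p => p.1 + p.2 < M).filter (fun p => p.1 + p.2 = n) =
        Finset.HasAntidiagonal.antidiagonal n := by
      ext p
      simp only [hP, Finset.mem_filter, Finset.mem_product, Finset.mem_range,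
        Finset.HasAntidiagonal.mem_antidiagonal]
      omega
    rw [hset, coeff_mul, ← evalAt_apply, map_sum, Finset.mul_sum]
    refine Finset.sum_congr rfl fun p hp => ?_
    rw [Finset.HasAntidiagonal.mem_antidiagonal] at hp
    rw [← hp, evalAt_apply]
  have h3 : ∀ ζ, partialSum pb A M ζ * partialSum pb B M ζ - partialSum pb (A * B) M ζ =
      ∑ p ∈ P with ¬ p.1 + p.2 < M, g p ζ := by
    intro ζ
    rw [h1, h2, ← Finset.sum_filter_add_sum_filter_not P (fun p => p.1 + p.2 < M),
      add_sub_cancel_left]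
  simp only [h3]
  refine IsBigO.fun_sum fun p hp => ?_
  have hle : M ≤ p.1 + p.2 := not_lt.mp (Finset.mem_filter.mp hp).2
  exact (isBigO_term ((hA p.1).mul (hB p.2)) _).trans (isBigO_norm_pow (by omega))

theorem IsExp.mul {M d e : ℕ} {A B : PowerSeries (FieldFn N ι)}
    {a b : (ι → ℝ) × ℝ × (Fin N → ℝ) → ℝ} (hA : IsExp qa pb r M d A a)
    (hB : IsExp qa pb r M e B b) : IsExp qa pb r M (d + e) (A * B) fun ζ => a ζ * b ζ := by
  refine ⟨fun n => ?_, ?_⟩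
  · rw [coeff_mul]
    refine IsHomog.sum _ fun p hp => ?_
    rw [Finset.HasAntidiagonal.mem_antidiagonal] at hp
    have h := (hA.homog p.1).mul (hB.homog p.2)
    have he : p.1 + d + (p.2 + e) = n + (d + e) := by omega
    rwa [he] at h
  · have h1 := hA.approx.mul hB.isBigO
    have h2 := (isBigO_partialSum (pb := pb) (qa := qa) (r := r) hA.homog M).mul hB.approx
    have h3 := isBigO_partialSum_mul (pb := pb) (qa := qa) (r := r) hA.homog hB.homog M
    have e1 : (fun ζ : (ι → ℝ) × ℝ × (Fin N → ℝ) => ‖ζ.1‖ ^ (M + d) * ‖ζ.1‖ ^ e) =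
        fun ζ => ‖ζ.1‖ ^ (M + (d + e)) := by
      funext ζ
      ring
    have e2 : (fun ζ : (ι → ℝ) × ℝ × (Fin N → ℝ) => ‖ζ.1‖ ^ d * ‖ζ.1‖ ^ (M + e)) =
        fun ζ => ‖ζ.1‖ ^ (M + (d + e)) := by
      funext ζ
      ring
    rw [e1] at h1
    rw [e2] at h2
    refine ((h1.add h2).add h3).congr_left fun ζ => ?_
    ring

theorem IsExp.const {d : ℕ} {f : FieldFn N ι} (hf : IsHomog d f) (M : ℕ) :
    IsExp qa pb r M d (PowerSeries.C f) fun ζ => (f : _ → ℝ) (ζ.1, (pb, ζ.2.2)) := by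
  refine ⟨fun n => ?_, ?_⟩
  · rw [coeff_C]
    split_ifs with hn
    · rwa [hn, zero_add]
    · exact IsHomog.zero _
  · rcases M with _ | M
    · refine ((hf.isBigO qa pb r).congr_left fun ζ => ?_).trans (isBigO_norm_pow (by omega))
      rw [partialSum, Finset.sum_range_zero, sub_zero]
    · refine (isBigO_zero _ _).congr_left fun ζ => ?_
      rw [partialSum, Finset.sum_range_succ', Finset.sum_eq_zero]
      · rw [coeff_zero_C, pow_zero, zero_add, one_mul, sub_self]
      · intro n _
        rw [coeff_C, if_neg n.succ_ne_zero]
        exact mul_zero _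

/-- The last term of the longer sum is itself within the error. The longer sum is used because its
τ-derivative is a partial sum of length M. -/
theorem IsExp.partialSum_succ {d : ℕ} {A : PowerSeries (FieldFn N ι)}
    (hA : ∀ n, IsHomog (n + d) (coeff n A)) (M : ℕ) :
    IsExp qa pb r M d A (partialSum pb A (M + 1)) := by
  refine ⟨hA, (isBigO_term (pb := pb) (hA M) M).congr_left fun ζ => ?_⟩
  rw [partialSum, partialSum, Finset.sum_range_succ, add_sub_cancel_left]

theorem IsExp.of_sub {M d : ℕ} {A : PowerSeries (FieldFn N ι)}
    {a b : (ι → ℝ) × ℝ × (Fin N → ℝ) → ℝ} (hA : IsExp qa pb r M d A a)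
    (h : (fun ζ => b ζ - a ζ) =O[𝓟 (expDomain ι qa r)] fun ζ => ‖ζ.1‖ ^ (M + d)) :
    IsExp qa pb r M d A b := by
  refine ⟨hA.homog, (h.add hA.approx).congr_left fun ζ => ?_⟩
  ring

theorem isExp_taylorPoly {M d : ℕ} {f : FieldFn N ι} (hf : IsHomog d f)
    {c : Fin N → PowerSeries (FieldFn N ι)} {w : Fin N → (ι → ℝ) × ℝ × (Fin N → ℝ) → ℝ}
    (hc : ∀ k, IsExp qa pb r M 0 (c k) (w k)) (K : ℕ) :
    IsExp qa pb r M d (taylorPoly (phaseDer N ι) PowerSeries.C c K f) fun ζ =>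
      taylorPoly (phaseDer N ι) (fun f => (f : _ → ℝ) (ζ.1, (pb, ζ.2.2))) (fun k => w k ζ) K f := by
  have key : ∀ (j : ℕ) (f : FieldFn N ι), IsHomog d f →
      IsExp qa pb r M d (taylorTerm (phaseDer N ι) PowerSeries.C c j f) fun ζ =>
        taylorTerm (phaseDer N ι) (fun f => (f : _ → ℝ) (ζ.1, (pb, ζ.2.2)))
          (fun k => w k ζ) j f := by
    intro j
    induction j with
    | zero => exact fun f hf => IsExp.const hf M
    | succ j ih =>
      intro f hf
      have h := IsExp.sum Finset.univ fun k _ => (hc k).mul (ih _ (hf.phaseDer (Sum.inl k)))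
      rwa [zero_add] at h
  exact IsExp.sum _ fun j _ => (key j f hf).smul _

theorem taylorTerm_smul (T : ι → ℝ) (x : Phase N) (s : ℝ) (w : Fin N → ℝ) (j : ℕ)
    (f : FieldFn N ι) :
    taylorTerm (phaseDer N ι) (fun f => (f : _ → ℝ) (T, x)) (s • w) j f =
      s ^ j * taylorTerm (phaseDer N ι) (fun f => (f : _ → ℝ) (T, x)) w j f := by
  induction j generalizing f with
  | zero => simp [taylorTerm]
  | succ j ih =>
    simp only [taylorTerm, ih, Finset.mul_sum]
    refine Finset.sum_congr rfl fun k _ => ?_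
    rw [Pi.smul_apply, smul_eq_mul]
    ring

/-- Taylor's theorem in the momenta, uniformly in the parameters. -/
theorem exists_taylor_bound {d : ℕ} (qa pb : Fin N → ℝ) (ρ : ℝ) (M : ℕ)
    {f : FieldFn N ι} (hf : IsHomog d f) :
    ∃ C, 0 ≤ C ∧ ∀ (T : ι → ℝ) (q w : Fin N → ℝ), q ∈ Metric.closedBall qa ρ → ‖w‖ ≤ ρ →
      |(f : _ → ℝ) (T, (pb + w, q)) -
        taylorPoly (phaseDer N ι) (fun f => (f : _ → ℝ) (T, (pb, q))) w M f| ≤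
        C * ‖T‖ ^ d * ‖w‖ ^ M := by
  induction M generalizing f with
  | zero =>
    obtain ⟨C, hC0, hC⟩ := hf.exists_bound (pb, qa) ρ
    refine ⟨C, hC0, fun T q w hq hw => ?_⟩
    rw [taylorPoly, Finset.sum_range_zero, sub_zero, pow_zero, mul_one]
    refine hC _ _ ?_
    rw [Metric.mem_closedBall, Prod.dist_eq]
    exact max_le (by simpa using hw) hq
  | succ M ih =>
    choose C hC0 hC using fun k => ih (hf.phaseDer (Sum.inl k))
    refine ⟨∑ k, C k, Finset.sum_nonneg fun k _ => hC0 k, fun T q w hq hw => ?_⟩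
    let φ : FieldFn N ι → ℝ := fun f => (f : _ → ℝ) (T, (pb, q))
    have hline : ∀ s ∈ Set.Icc (0 : ℝ) 1, HasDerivWithinAt
        (fun s : ℝ => ((pb + s • w, q) : Phase N)) (w, 0) (Set.Icc 0 1) s := by
      intro s _
      have h1 : HasDerivAt (fun s : ℝ => pb + s • w) w s := by
        simpa using ((hasDerivAt_id s).smul_const w).const_add pb
      exact (h1.prodMk (hasDerivAt_const s q)).hasDerivWithinAt
    have hpoly : ∀ s ∈ Set.Icc (0 : ℝ) 1, HasDerivWithinAt
        (fun s : ℝ => taylorPoly (phaseDer N ι) φ (s • w) (M + 1) f)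
        (∑ k, w k * taylorPoly (phaseDer N ι) φ (s • w) M ((phaseDer N ι).d (Sum.inl k) f))
        (Set.Icc 0 1) s := by
      intro s _
      have h1 : ∀ j ∈ Finset.range (M + 1), HasDerivAt
          (fun s : ℝ => ((j.factorial : ℝ)⁻¹) • taylorTerm (phaseDer N ι) φ (s • w) j f)
          (((j.factorial : ℝ)⁻¹) • ((j * s ^ (j - 1)) * taylorTerm (phaseDer N ι) φ w j f)) s := by
        intro j _
        simp only [φ, taylorTerm_smul]
        exact ((hasDerivAt_pow j s).mul_const _).const_smul ((j.factorial : ℝ)⁻¹)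
      have h2 := HasDerivAt.fun_sum h1
      refine (h2.congr_deriv ?_).hasDerivWithinAt
      rw [Finset.sum_range_succ', Nat.cast_zero, zero_mul, zero_mul, smul_zero, add_zero]
      simp only [taylorPoly, Finset.mul_sum]
      rw [Finset.sum_comm]
      refine Finset.sum_congr rfl fun j _ => ?_
      rw [taylorTerm, Finset.mul_sum, Finset.smul_sum]
      refine Finset.sum_congr rfl fun k _ => ?_
      simp only [φ, taylorTerm_smul, smul_eq_mul, Nat.add_sub_cancel, Nat.factorial_succ]
      have h3 := Nat.cast_ne_zero (R := ℝ).mpr j.factorial_ne_zero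
      push_cast
      field_simp
    -- Along s ↦ pb + s w, the remainder of order M + 1 has derivative the sum of w_k times the
    -- remainder of order M of ∂f/∂p_k, which the induction hypothesis bounds.
    have h := Convex.norm_image_sub_le_of_norm_hasDerivWithin_le
      (C := (∑ k, C k) * ‖T‖ ^ d * ‖w‖ ^ (M + 1))
      (fun s hs => (hasDerivWithinAt_fieldFn f T (hline s hs)).sub (hpoly s hs)) ?_
      (convex_Icc 0 1) (Set.left_mem_Icc.mpr zero_le_one) (Set.right_mem_Icc.mpr zero_le_one)
    · have h0 : taylorPoly (phaseDer N ι) φ 0 (M + 1) f = φ f := by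
        rw [← zero_smul ℝ w, taylorPoly, Finset.sum_range_succ', Finset.sum_eq_zero]
        · simp [taylorTerm]
        · intro j _
          simp only [φ, taylorTerm_smul]
          simp
      rw [Pi.sub_apply, Pi.sub_apply] at h
      simp only [h0, one_smul, zero_smul, add_zero, sub_zero, norm_one, mul_one] at h
      simpa only [φ, sub_self, sub_zero, Real.norm_eq_abs] using h
    · intro s hs
      simp only [Pi.zero_apply, zero_mul, Finset.sum_const_zero, add_zero]
      rw [← Finset.sum_sub_distrib, Finset.sum_mul, Finset.sum_mul]
      refine (norm_sum_le _ _).trans (Finset.sum_le_sum fun k _ => ?_)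
      have hsw : ‖s • w‖ ≤ ‖w‖ := by
        rw [norm_smul, Real.norm_of_nonneg hs.1]
        exact mul_le_of_le_one_left (norm_nonneg _) hs.2
      rw [← mul_sub, norm_mul, pow_succ']
      have hk := hC k T q (s • w) hq (hsw.trans hw)
      calc ‖w k‖ * _ ≤ ‖w‖ * (C k * ‖T‖ ^ d * ‖s • w‖ ^ M) :=
            mul_le_mul (norm_le_pi_norm w k) hk (abs_nonneg _) (norm_nonneg _)
        _ ≤ ‖w‖ * (C k * ‖T‖ ^ d * ‖w‖ ^ M) := by
            have := hC0 k
            gcongr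
        _ = _ := by ring

/-- Taylor's remainder is O(‖w‖^M), and w is O(‖T‖), so replacing the function by its Taylor
polynomial costs no more than the allowed error. -/
theorem IsExp.comp_momentum {M d : ℕ} {f : FieldFn N ι} (hf : IsHomog d f)
    {c : Fin N → PowerSeries (FieldFn N ι)} {w : (ι → ℝ) × ℝ × (Fin N → ℝ) → Fin N → ℝ}
    (hc : ∀ k, IsExp qa pb r M 0 (c k) fun ζ => w ζ k)
    (hw : ∀ k, (fun ζ => w ζ k) =O[𝓟 (expDomain ι qa r)] fun ζ => ‖ζ.1‖) :
    IsExp qa pb r M d (taylorPoly (phaseDer N ι) PowerSeries.C c M f) fun ζ =>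
      (f : _ → ℝ) (ζ.1, (pb + w ζ, ζ.2.2)) := by
  refine (isExp_taylorPoly hf hc M).of_sub ?_
  obtain ⟨K, hK⟩ := isBigO_principal.mp (isBigO_pi.mpr hw)
  obtain ⟨C, hC0, hC⟩ := exists_taylor_bound qa pb (max r (max K 0)) M hf
  refine isBigO_principal.mpr ⟨C * (max K 0) ^ M, fun ζ hζ => ?_⟩
  have hw1 : ‖w ζ‖ ≤ max K 0 * ‖ζ.1‖ := by
    refine (hK ζ hζ).trans ?_
    rw [norm_norm]
    exact mul_le_mul_of_nonneg_right (le_max_left _ _) (norm_nonneg _)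
  have hw2 : ‖w ζ‖ ≤ max K 0 :=
    hw1.trans (mul_le_of_le_one_right (le_max_right _ _) hζ.1)
  refine (hC ζ.1 ζ.2.2 (w ζ) (Metric.closedBall_subset_closedBall (le_max_left _ _) hζ.2.2)
    (hw2.trans (le_max_right _ _))).trans ?_
  rw [norm_pow, norm_norm]
  calc C * ‖ζ.1‖ ^ d * ‖w ζ‖ ^ M ≤ C * ‖ζ.1‖ ^ d * (max K 0 * ‖ζ.1‖) ^ M := by gcongr
    _ = C * max K 0 ^ M * ‖ζ.1‖ ^ (M + d) := by ring

end Expansions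

/-! ### Residuals of the truncated Hamilton-Jacobi equation. -/

section HamiltonJacobiAction

open PowerSeries Asymptotics Filter

variable {N : ℕ} {ι : Type*} [Fintype ι]

theorem partialSum_neg (pb : Fin N → ℝ) (A : PowerSeries (FieldFn N ι)) (M : ℕ)
    (ζ : (ι → ℝ) × ℝ × (Fin N → ℝ)) : partialSum pb (-A) M ζ = -partialSum pb A M ζ := by
  rw [partialSum, partialSum, ← Finset.sum_neg_distrib]
  refine Finset.sum_congr rfl fun n _ => ?_
  rw [map_neg, ← mul_neg]
  rfl

theorem partialSum_congr (pb : Fin N → ℝ) {A B : PowerSeries (FieldFn N ι)} {M : ℕ}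
    (h : ∀ n < M, coeff n A = coeff n B) : partialSum pb A M = partialSum pb B M := by
  funext ζ
  refine Finset.sum_congr rfl fun n hn => ?_
  rw [h n (Finset.mem_range.mp hn)]

theorem partialSum_zero_time (pb : Fin N → ℝ) {A : PowerSeries (FieldFn N ι)}
    (hA : coeff 0 A = 0) (M : ℕ) (T : ι → ℝ) (q : Fin N → ℝ) :
    partialSum pb A M (T, 0, q) = 0 := by
  refine Finset.sum_eq_zero fun n _ => ?_
  rcases n with _ | n
  · rw [hA]
    exact mul_zero _
  · rw [zero_pow n.succ_ne_zero, zero_mul]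

theorem isBigO_partialSum_of_coeff_zero {qa pb : Fin N → ℝ} {r : ℝ}
    {A : PowerSeries (FieldFn N ι)} (hA : ∀ n, IsHomog n (coeff n A)) (h0 : coeff 0 A = 0)
    (M : ℕ) : partialSum pb A M =O[𝓟 (expDomain ι qa r)] fun ζ => ‖ζ.1‖ := by
  refine IsBigO.fun_sum fun n _ => ?_
  rcases n with _ | n
  · refine (isBigO_zero _ _).congr_left fun ζ => ?_
    rw [h0]
    exact (mul_zero _).symm
  · simpa using (isBigO_term (pb := pb) (hA (n + 1)) (n + 1)).trans
      (isBigO_norm_pow (k := 1) (Nat.le_add_left 1 n))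

/-- The formal derivative. -/
def derivSeries (A : PowerSeries (FieldFn N ι)) : PowerSeries (FieldFn N ι) :=
  PowerSeries.mk fun n => ((n : ℝ) + 1) • coeff (n + 1) A

/-- The chain rule along a curve in τ and q. The τ-derivative shortens the sum by one, while the
q-derivatives do not. -/
theorem hasDerivWithinAt_partialSum (pb : Fin N → ℝ) (A : PowerSeries (FieldFn N ι)) (M : ℕ)
    (T : ι → ℝ) {τ : ℝ → ℝ} {τ' : ℝ} {q : ℝ → Fin N → ℝ} {q' : Fin N → ℝ} {s : Set ℝ} {t : ℝ}
    (hτ : HasDerivWithinAt τ τ' s t) (hq : HasDerivWithinAt q q' s t) :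
    HasDerivWithinAt (fun t => partialSum pb A (M + 1) (T, τ t, q t))
      (τ' * partialSum pb (derivSeries A) M (T, τ t, q t) +
        ∑ k, q' k * partialSum pb (mapDer ((phaseDer N ι).d (Sum.inr k)) A) (M + 1)
          (T, τ t, q t)) s t := by
  have h1 : ∀ n ∈ Finset.range (M + 1), HasDerivWithinAt
      (fun t => τ t ^ n * ((coeff n A : FieldFn N ι) : _ → ℝ) (T, (pb, q t)))
      (n * τ t ^ (n - 1) * τ' * ((coeff n A : FieldFn N ι) : _ → ℝ) (T, (pb, q t)) +
        τ t ^ n * ∑ k, q' k *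
          ((phaseDer N ι).d (Sum.inr k) (coeff n A) : _ → ℝ) (T, (pb, q t))) s t := by
    intro n _
    have h2 := hasDerivWithinAt_fieldFn (coeff n A) T
      ((hasDerivWithinAt_const t s pb).prodMk hq)
    simp only [Pi.zero_apply, zero_mul, Finset.sum_const_zero, zero_add] at h2
    exact (hτ.fun_pow n).mul h2
  refine (HasDerivWithinAt.fun_sum h1).congr_deriv ?_
  rw [Finset.sum_add_distrib]
  congr 1
  · rw [Finset.sum_range_succ', Nat.cast_zero, zero_mul, zero_mul, zero_mul, add_zero, partialSum,
      Finset.mul_sum]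
    refine Finset.sum_congr rfl fun n _ => ?_
    rw [derivSeries, coeff_mk, Nat.add_sub_cancel]
    change _ = τ' * (τ t ^ n * (((n : ℝ) + 1) * _))
    push_cast
    ring
  · simp only [partialSum, Finset.mul_sum]
    rw [Finset.sum_comm]
    refine Finset.sum_congr rfl fun k _ => Finset.sum_congr rfl fun n _ => ?_
    rw [coeff_mapDer]
    ring

variable {ta tb : ℝ} (H : ι → Phase N → ℝ) (hH : ∀ α, ContDiff ℝ ∞ (H α))

/-- The increment of the momenta up to order `m`. -/
def momentumIncrement (ta tb : ℝ) (H : ι → Phase N → ℝ) (hH : ∀ α, ContDiff ℝ ∞ (H α))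
    (pb : Fin N → ℝ) (m : ℕ) (ζ : (ι → ℝ) × ℝ × (Fin N → ℝ)) : Fin N → ℝ :=
  fun k => partialSum pb (momentumSeries ta tb H hH k) (m + 1) ζ

theorem isHomog_momentumSeries (k : Fin N) (n : ℕ) :
    IsHomog n (coeff n (momentumSeries ta tb H hH k)) := by
  rw [coeff_momentumSeries]
  exact ((isHomog_leadingAction H hH n).phaseDer _).neg

theorem isBigO_momentumIncrement (qa pb : Fin N → ℝ) (r : ℝ) (m : ℕ) :
    momentumIncrement ta tb H hH pb m =O[𝓟 (expDomain ι qa r)] fun ζ => ‖ζ.1‖ := by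
  refine isBigO_pi.mpr fun k => isBigO_partialSum_of_coeff_zero (isHomog_momentumSeries H hH k)
    ?_ (m + 1)
  rw [coeff_momentumSeries, leadingAction_zero, map_zero, neg_zero]

theorem isExp_comp_momentumIncrement {f : FieldFn N ι} {d : ℕ} (hf : IsHomog d f)
    (qa pb : Fin N → ℝ) (r : ℝ) (m : ℕ) :
    IsExp qa pb r m d (taylorPoly (phaseDer N ι) PowerSeries.C (momentumSeries ta tb H hH) m f)
      fun ζ => (f : _ → ℝ) (ζ.1, (pb + momentumIncrement ta tb H hH pb m ζ, ζ.2.2)) :=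
  IsExp.comp_momentum hf
    (fun k => IsExp.partialSum_succ (d := 0) (A := momentumSeries ta tb H hH k) (fun n => isHomog_momentumSeries H hH k n) m)
    fun k => isBigO_pi.mp (isBigO_momentumIncrement H hH qa pb r m) k

/-- The formal equation makes the expansions of both terms cancel up to order m. -/
theorem hamiltonJacobi_residual (hab : ta < tb) (qa pb : Fin N → ℝ) (r : ℝ) (m : ℕ) :
    (fun ζ => (hamFn H hH : _ → ℝ) (ζ.1, (pb + momentumIncrement ta tb H hH pb m ζ, ζ.2.2)) +
      partialSum pb (derivSeries (leadingSeries ta tb H hH)) m ζ)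
      =O[𝓟 (expDomain ι qa r)] fun ζ => ‖ζ.1‖ ^ (m + 1) := by
  have h := isExp_comp_momentumIncrement (ta := ta) (tb := tb) H hH (isHomog_hamFn H hH).neg
    qa pb r m
  have hs : partialSum pb (derivSeries (leadingSeries ta tb H hH)) m =
      partialSum pb (taylorPoly (phaseDer N ι) PowerSeries.C (momentumSeries ta tb H hH) m
        (-hamFn H hH)) m := by
    refine partialSum_congr pb fun n hn => ?_
    rw [derivSeries, coeff_mk, leadingSeries, coeff_mk, hamiltonJacobi_coeff H hH hab hn]
  rw [hs]
  refine h.approx.neg_left.congr_left fun ζ => ?_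
  change -(-_ - _) = _
  ring

theorem hamiltonJacobi_derivative_residual (hab : ta < tb) (qa pb : Fin N → ℝ) (r : ℝ) (m : ℕ)
    (k : Fin N) :
    (fun ζ => ((phaseDer N ι).d (Sum.inr k) (hamFn H hH) : _ → ℝ)
        (ζ.1, (pb + momentumIncrement ta tb H hH pb m ζ, ζ.2.2)) +
      ∑ l, partialSum pb (mapDer ((phaseDer N ι).d (Sum.inr k)) (momentumSeries ta tb H hH l))
        (m + 1) ζ * ((phaseDer N ι).d (Sum.inl l) (hamFn H hH) : _ → ℝ)
          (ζ.1, (pb + momentumIncrement ta tb H hH pb m ζ, ζ.2.2)) -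
      partialSum pb (derivSeries (momentumSeries ta tb H hH k)) m ζ)
      =O[𝓟 (expDomain ι qa r)] fun ζ => ‖ζ.1‖ ^ (m + 1) := by
  have h1 : ∀ j, IsExp qa pb r m 1 _ _ := fun j => isExp_comp_momentumIncrement (ta := ta)
    (tb := tb) H hH ((isHomog_hamFn H hH).phaseDer j).neg qa pb r m
  have h2 : ∀ l, IsExp qa pb r m 0
      (mapDer ((phaseDer N ι).d (Sum.inr k)) (momentumSeries ta tb H hH l)) _ := fun l =>
    IsExp.partialSum_succ (fun n => by
      rw [coeff_mapDer]
      exact (isHomog_momentumSeries H hH l n).phaseDer _) m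
  have h3 := (h1 (Sum.inr k)).add
    (IsExp.sum Finset.univ fun l _ => by simpa using (h2 l).mul (h1 (Sum.inl l)))
  have hs := partialSum_congr (M := m) (A := -derivSeries (momentumSeries ta tb H hH k)) pb fun n hn => by
    have h := hamiltonJacobi_derivative_coeff (ta := ta) (tb := tb) H hH hab hn k
    rw [← h, map_neg, derivSeries, coeff_mk, coeff_momentumSeries, smul_neg, neg_neg]
  refine h3.approx.neg_left.congr_left fun ζ => ?_
  rw [← congrFun hs ζ, partialSum_neg]
  simp only [Finset.sum_neg_distrib]
  change -(-_ + -_ - -_) = _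
  ring

theorem exists_momentum_lipschitz {f : FieldFn N ι} (hf : IsHomog 1 f) (qa pb : Fin N → ℝ)
    (r : ℝ) (m : ℕ) : ∃ C, 0 ≤ C ∧ ∀ ζ ∈ expDomain ι qa r, ∀ p ∈ Metric.closedBall pb r,
      |(f : _ → ℝ) (ζ.1, (p, ζ.2.2)) -
        (f : _ → ℝ) (ζ.1, (pb + momentumIncrement ta tb H hH pb m ζ, ζ.2.2))| ≤
        C * ‖ζ.1‖ * ‖p - pb - momentumIncrement ta tb H hH pb m ζ‖ := by
  obtain ⟨K, hK⟩ := isBigO_principal.mp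
    (isBigO_momentumIncrement (ta := ta) (tb := tb) H hH qa pb r m)
  obtain ⟨C, hC0, hC⟩ := hf.exists_lipschitz (pb, qa) (max r (max K 0))
  refine ⟨C, hC0, fun ζ hζ p hp => ?_⟩
  have hw : ‖momentumIncrement ta tb H hH pb m ζ‖ ≤ max K 0 := by
    refine (hK ζ hζ).trans ((mul_le_mul_of_nonneg_right (le_max_left K 0)
      (norm_nonneg _)).trans ?_)
    rw [norm_norm]
    exact mul_le_of_le_one_right (le_max_right _ _) hζ.1
  have hq : dist ζ.2.2 qa ≤ max r (max K 0) := le_max_of_le_left hζ.2.2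
  have h := hC ζ.1 (pb + momentumIncrement ta tb H hH pb m ζ, ζ.2.2)
    (max_le (by simpa using Or.inr hw) hq) (p, ζ.2.2)
    (max_le (le_max_of_le_left hp) hq)
  rwa [pow_one, Prod.mk_sub_mk, sub_self, Prod.norm_mk, norm_zero,
    max_eq_left (norm_nonneg _), ← sub_sub] at h

/-- The residual is known at the approximate momentum; the Lipschitz estimate transfers it to the
actual momentum p of a solution. -/
theorem exists_action_residual_bound (hab : ta < tb) (qa pb : Fin N → ℝ) (r : ℝ) (m : ℕ) :
    ∃ C, 0 ≤ C ∧ ∀ ζ ∈ expDomain ι qa r, ∀ p ∈ Metric.closedBall pb r,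
      |(hamFn H hH : _ → ℝ) (ζ.1, (p, ζ.2.2)) +
        partialSum pb (derivSeries (leadingSeries ta tb H hH)) m ζ| ≤
        C * ‖ζ.1‖ * ‖p - pb - momentumIncrement ta tb H hH pb m ζ‖ + C * ‖ζ.1‖ ^ (m + 1) := by
  obtain ⟨L, hL0, hL⟩ := exists_momentum_lipschitz (ta := ta) (tb := tb) H hH
    (isHomog_hamFn H hH) qa pb r m
  obtain ⟨R, hR⟩ := isBigO_principal.mp (hamiltonJacobi_residual H hH hab qa pb r m)
  refine ⟨max L R, le_max_of_le_left hL0, fun ζ hζ p hp => ?_⟩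
  have h1 := hL ζ hζ p hp
  have h2 := hR ζ hζ
  rw [norm_pow, norm_norm, Real.norm_eq_abs] at h2
  refine le_trans ?_ (add_le_add (h1.trans ?_) (h2.trans ?_))
  · refine le_trans (le_of_eq ?_) (abs_add_le _ _)
    congr 1
    ring
  · gcongr
    exact le_max_left _ _
  · gcongr
    exact le_max_right _ _

/-- The same transfer for the transport equation; the derivatives of the increments enter as bounded
coefficients. -/
theorem exists_momentum_residual_bound (hab : ta < tb) (qa pb : Fin N → ℝ) (r : ℝ) (m : ℕ) :
    ∃ C, 0 ≤ C ∧ ∀ ζ ∈ expDomain ι qa r, ∀ p ∈ Metric.closedBall pb r, ∀ k,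
      |((phaseDer N ι).d (Sum.inr k) (hamFn H hH) : _ → ℝ) (ζ.1, (p, ζ.2.2)) +
        ∑ l, partialSum pb (mapDer ((phaseDer N ι).d (Sum.inr k)) (momentumSeries ta tb H hH l))
          (m + 1) ζ * ((phaseDer N ι).d (Sum.inl l) (hamFn H hH) : _ → ℝ) (ζ.1, (p, ζ.2.2)) -
        partialSum pb (derivSeries (momentumSeries ta tb H hH k)) m ζ| ≤
        C * ‖ζ.1‖ * ‖p - pb - momentumIncrement ta tb H hH pb m ζ‖ + C * ‖ζ.1‖ ^ (m + 1) := by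
  choose L hL0 hL using fun j => exists_momentum_lipschitz (ta := ta) (tb := tb) H hH
    ((isHomog_hamFn H hH).phaseDer j) qa pb r m
  choose R hR using fun k => isBigO_principal.mp
    (hamiltonJacobi_derivative_residual H hH hab qa pb r m k)
  have hW : ∀ k l, ∃ K, 0 ≤ K ∧ ∀ ζ ∈ expDomain ι qa r, |partialSum pb
      (mapDer ((phaseDer N ι).d (Sum.inr k)) (momentumSeries ta tb H hH l)) (m + 1) ζ| ≤ K := by
    intro k l
    obtain ⟨K, hK⟩ := isBigO_principal.mp (isBigO_partialSum (d := 0) (pb := pb) (qa := qa) (r := r)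
      (A := mapDer ((phaseDer N ι).d (Sum.inr k)) (momentumSeries ta tb H hH l)) (fun n => by
        rw [coeff_mapDer]
        exact (isHomog_momentumSeries H hH l n).phaseDer _) (m + 1))
    refine ⟨max K 0, le_max_right _ _, fun ζ hζ => (hK ζ hζ).trans ?_⟩
    simp
  choose K hK0 hK using hW
  set C : Fin N → ℝ := fun k => L (Sum.inr k) + ∑ l, K k l * L (Sum.inl l) + |R k| with hC
  have hS0 : ∀ k, 0 ≤ ∑ l, K k l * L (Sum.inl l) := fun k =>
    Finset.sum_nonneg fun l _ => mul_nonneg (hK0 k l) (hL0 _)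
  have hC0 : ∀ k, 0 ≤ C k := fun k =>
    add_nonneg (add_nonneg (hL0 _) (hS0 k)) (abs_nonneg _)
  have hCle : ∀ k, C k ≤ ∑ k, C k := fun k =>
    Finset.single_le_sum (fun k _ => hC0 k) (Finset.mem_univ k)
  refine ⟨∑ k, C k, Finset.sum_nonneg fun k _ => hC0 k, fun ζ hζ p hp k => ?_⟩
  have h2 := hR k ζ hζ
  rw [norm_pow, norm_norm, Real.norm_eq_abs] at h2
  set δ := ‖p - pb - momentumIncrement ta tb H hH pb m ζ‖ with hδ
  have hδ0 : 0 ≤ δ := norm_nonneg _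
  have h3 : |∑ l, partialSum pb
      (mapDer ((phaseDer N ι).d (Sum.inr k)) (momentumSeries ta tb H hH l)) (m + 1) ζ *
      (((phaseDer N ι).d (Sum.inl l) (hamFn H hH) : _ → ℝ) (ζ.1, (p, ζ.2.2)) -
        ((phaseDer N ι).d (Sum.inl l) (hamFn H hH) : _ → ℝ)
          (ζ.1, (pb + momentumIncrement ta tb H hH pb m ζ, ζ.2.2)))| ≤
      (∑ l, K k l * L (Sum.inl l)) * ‖ζ.1‖ * δ := by
    rw [Finset.sum_mul, Finset.sum_mul]
    refine (Finset.abs_sum_le_sum_abs _ _).trans (Finset.sum_le_sum fun l _ => ?_)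
    rw [abs_mul, mul_assoc, mul_assoc, ← mul_assoc (L _)]
    exact mul_le_mul (hK k l ζ hζ) (hL _ ζ hζ p hp) (abs_nonneg _) (hK0 k l)
  have h1 := hL (Sum.inr k) ζ hζ p hp
  have htri : ∀ a b c a' b' : ℝ, |a + b - c| ≤ |a - a'| + |b - b'| + |a' + b' - c| := by
    intro a b c a' b'
    calc |a + b - c| = |(a - a') + (b - b') + (a' + b' - c)| := by ring_nf
      _ ≤ _ := abs_add_three _ _ _
  simp only [mul_sub, Finset.sum_sub_distrib] at h3
  refine (htri _ _ _ _ _).trans ((add_le_add (add_le_add h1 h3) h2).trans ?_)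
  rw [← add_mul, ← add_mul]
  refine add_le_add ?_ ?_
  · gcongr
    exact (le_add_of_nonneg_right (abs_nonneg (R k))).trans (hCle k)
  · gcongr
    refine (le_abs_self (R k)).trans ((le_add_of_nonneg_left ?_).trans (hCle k))
    exact add_nonneg (hL0 _) (hS0 k)

end HamiltonJacobiAction

/-! ### Action of the classical solution. -/

section BranchAction

open PowerSeries Asymptotics Filter

variable {N : ℕ} {ι : Type*} [Fintype ι] {ta tb : ℝ} {H : ι → Phase N → ℝ}
  (hH : ∀ α, ContDiff ℝ ∞ (H α))

theorem hasDerivWithinAt_reversed_time (s : Set ℝ) (t : ℝ) :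
    HasDerivWithinAt (fun t => (tb - t) / (tb - ta)) (-(tb - ta)⁻¹) s t := by
  have h := ((hasDerivAt_id t).const_sub tb).div_const (tb - ta)
  refine (h.congr_deriv ?_).hasDerivWithinAt
  rw [neg_div, one_div]

theorem reversed_time_mem (hab : ta < tb) {t : ℝ} (ht : t ∈ Set.Icc ta tb) :
    (tb - t) / (tb - ta) ∈ Set.Icc (0 : ℝ) 1 := by
  have h : 0 < tb - ta := sub_pos.mpr hab
  refine ⟨div_nonneg (sub_nonneg.mpr ht.2) h.le, (div_le_one h).mpr ?_⟩
  linarith [ht.1]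

theorem IsBranch.mem_expDomain (hab : ta < tb) {qa pb : Fin N → ℝ} {r : ℝ} {T : ι → ℝ}
    {x : ℝ → Phase N} (hx : IsBranch H ta tb qa pb r T x) (hT : ‖T‖ ≤ 1) {t : ℝ}
    (ht : t ∈ Set.Icc ta tb) :
    (T, (tb - t) / (tb - ta), (x t).2) ∈ expDomain ι qa r ∧
      (x t).1 ∈ Metric.closedBall pb r := by
  have h : dist (x t) (pb, qa) ≤ r := (hx.2 t ht).le
  exact ⟨⟨hT, reversed_time_mem hab ht, (le_max_right _ _).trans h⟩, (le_max_left _ _).trans h⟩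

/-- On a branch, the momenta are given by the partial sums of their expansion. -/
theorem IsBranch.exists_momentum_bound (hab : ta < tb) (qa pb : Fin N → ℝ) (r : ℝ) (m : ℕ) :
    ∃ C, 0 ≤ C ∧ ∀ᶠ T in 𝓝 (0 : ι → ℝ), ∀ x, IsBranch H ta tb qa pb r T x →
      ∀ t ∈ Set.Icc ta tb, ‖(x t).1 - pb -
        momentumIncrement ta tb H hH pb m (T, (tb - t) / (tb - ta), (x t).2)‖ ≤
        C * ‖T‖ ^ (m + 1) := by
  have hpos : 0 < tb - ta := sub_pos.mpr hab
  obtain ⟨C, hC0, hC⟩ := exists_momentum_residual_bound H hH hab qa pb r m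
  refine ⟨2 * (tb - ta) * ((tb - ta)⁻¹ * C), by positivity, ?_⟩
  have hcont : Continuous fun T : ι → ℝ => (tb - ta)⁻¹ * C * ‖T‖ * (tb - ta) := by fun_prop
  have hsmall : ∀ᶠ T in 𝓝 (0 : ι → ℝ), (tb - ta)⁻¹ * C * ‖T‖ * (tb - ta) < 1 / 2 :=
    hcont.continuousAt.eventually_lt continuousAt_const (by simp)
  have hsmall' : ∀ᶠ T in 𝓝 (0 : ι → ℝ), ‖T‖ < 1 :=
    continuous_norm.continuousAt.eventually_lt continuousAt_const (by simp)
  filter_upwards [hsmall, hsmall'] with T hT hT1 x hx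
  have hx' := (isBranch_iff H hH).mp hx
  set ζ : ℝ → (ι → ℝ) × ℝ × (Fin N → ℝ) := fun t => (T, (tb - t) / (tb - ta), (x t).2) with hζ
  set δ : ℝ → Fin N → ℝ := fun t => (x t).1 - pb - momentumIncrement ta tb H hH pb m (ζ t) with hδ
  -- τ decreases at rate 1/(tb - ta); by the equations of motion and the symmetry of the derivatives
  -- of the increments, δ' is -1/(tb - ta) times the residual of the transport equation.
  let δ' : ℝ → Fin N → ℝ := fun t k => (hamField ta tb H hH T (x t)).1 k -
    (-(tb - ta)⁻¹ * partialSum pb (derivSeries (momentumSeries ta tb H hH k)) m (ζ t) +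
      ∑ l, (hamField ta tb H hH T (x t)).2 l *
        partialSum pb (mapDer ((phaseDer N ι).d (Sum.inr l)) (momentumSeries ta tb H hH k)) (m + 1)
          (ζ t))
  have hderiv : ∀ t ∈ Set.Icc ta tb, HasDerivWithinAt δ (δ' t) (Set.Icc ta tb) t := by
    intro t ht
    rw [hasDerivWithinAt_pi]
    intro k
    have h1 := hasDerivWithinAt_pi.mp (hx'.1 t ht).fst k
    have h2 := hasDerivWithinAt_partialSum pb (momentumSeries ta tb H hH k) m T
      (hasDerivWithinAt_reversed_time (ta := ta) (tb := tb) (Set.Icc ta tb) t) (hx'.1 t ht).snd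
    exact (h1.sub_const (pb k)).sub h2
  have hb : ∀ t ∈ Set.Icc ta tb, ‖δ' t‖ ≤
      (tb - ta)⁻¹ * C * ‖T‖ * ‖δ t‖ + (tb - ta)⁻¹ * C * ‖T‖ ^ (m + 1) := by
    intro t ht
    obtain ⟨h1, h2⟩ := hx.mem_expDomain hab hT1.le ht
    refine (pi_norm_le_iff_of_nonneg (by positivity)).mpr fun k => ?_
    have h3 := hC (ζ t) h1 (x t).1 h2 k
    have h4 : δ' t k = -((tb - ta)⁻¹ *
        (((phaseDer N ι).d (Sum.inr k) (hamFn H hH) : _ → ℝ) (T, x t) +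
        ∑ l, partialSum pb (mapDer ((phaseDer N ι).d (Sum.inr k)) (momentumSeries ta tb H hH l))
          (m + 1) (ζ t) * ((phaseDer N ι).d (Sum.inl l) (hamFn H hH) : _ → ℝ) (T, x t) -
        partialSum pb (derivSeries (momentumSeries ta tb H hH k)) m (ζ t))) := by
      simp only [δ', hamField, mapDer_momentumSeries_comm H hH k]
      rw [mul_sub, mul_add, Finset.mul_sum]
      have h5 : ∀ l, (tb - ta)⁻¹ *
          ((phaseDer N ι).d (Sum.inl l) (hamFn H hH) : _ → ℝ) (T, x t) *
          partialSum pb (mapDer ((phaseDer N ι).d (Sum.inr k)) (momentumSeries ta tb H hH l))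
          (m + 1) (ζ t) = (tb - ta)⁻¹ * (partialSum pb
          (mapDer ((phaseDer N ι).d (Sum.inr k)) (momentumSeries ta tb H hH l))
          (m + 1) (ζ t) * ((phaseDer N ι).d (Sum.inl l) (hamFn H hH) : _ → ℝ) (T, x t)) := by
        intro l
        ring
      simp only [h5]
      ring
    rw [h4, norm_neg, norm_mul, Real.norm_of_nonneg (inv_nonneg.mpr hpos.le), Real.norm_eq_abs]
    refine (mul_le_mul_of_nonneg_left h3 (inv_nonneg.mpr hpos.le)).trans (le_of_eq ?_)
    simp only [hζ, hδ]
    ring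
  -- At tb one has τ = 0, where the increments vanish, and p(tb) = pb.
  have hend : δ tb = 0 := by
    funext k
    have h0 : partialSum pb (momentumSeries ta tb H hH k) (m + 1) (T, 0, (x tb).2) = 0 := by
      refine partialSum_zero_time pb ?_ _ _ _
      rw [coeff_momentumSeries, leadingAction_zero, map_zero, neg_zero]
    change (x tb).1 k - pb k - partialSum pb (momentumSeries ta tb H hH k) (m + 1)
      (T, (tb - tb) / (tb - ta), (x tb).2) = 0
    rw [sub_self, zero_div, h0, hx'.2.2.1, sub_self, sub_zero]
  -- No initial value for q enters: the second component is taken to be zero.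
  have h := norm_le_of_boundary_zero hab.le (δ := fun t => (δ t, (0 : ℝ)))
    (δ' := fun t => (δ' t, 0)) (L := (tb - ta)⁻¹ * C * ‖T‖)
    (ε := (tb - ta)⁻¹ * C * ‖T‖ ^ (m + 1)) (by positivity) hT.le
    (fun t ht => (hderiv t ht).prodMk (hasDerivWithinAt_const _ _ _)) hend rfl
    (fun t ht => by simpa [Prod.norm_mk] using hb t ht)
  intro t ht
  have h1 := h t ht
  rw [Prod.norm_mk, norm_zero, max_eq_left (norm_nonneg _)] at h1
  refine h1.trans (le_of_eq ?_)
  ring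

/-- The mean value inequality for the primitive of f plus g; extending f continuously beyond the
interval makes its primitive differentiable at the endpoints as well. -/
theorem integral_add_sub_le (hab : ta ≤ tb) {f g g' : ℝ → ℝ} {C : ℝ}
    (hf : ContinuousOn f (Set.Icc ta tb))
    (hg : ∀ t ∈ Set.Icc ta tb, HasDerivWithinAt g (g' t) (Set.Icc ta tb) t)
    (hC : ∀ t ∈ Set.Icc ta tb, |f t + g' t| ≤ C) :
    |(∫ t in ta..tb, f t) + g tb - g ta| ≤ C * (tb - ta) := by
  have hcont : Continuous (Set.IccExtend hab ((Set.Icc ta tb).domRestrict f)) :=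
    hf.domRestrict.Icc_extend'
  have heq : ∀ t ∈ Set.Icc ta tb, Set.IccExtend hab ((Set.Icc ta tb).domRestrict f) t = f t := by
    intro t ht
    rw [Set.IccExtend_of_mem _ _ ht, Set.domRestrict_apply]
  have hint : ∫ t in ta..tb, f t =
      ∫ t in ta..tb, Set.IccExtend hab ((Set.Icc ta tb).domRestrict f) t := by
    refine intervalIntegral.integral_congr fun t ht => (heq t ?_).symm
    rwa [Set.uIcc_of_le hab] at ht
  have h := Convex.norm_image_sub_le_of_norm_hasDerivWithin_le (C := C)
    (fun t ht => ((hcont.integral_hasStrictDerivAt ta t).hasDerivAt.hasDerivWithinAt).add (hg t ht))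
    (fun t ht => by
      rw [heq t ht]
      exact hC t ht) (convex_Icc ta tb) (Set.left_mem_Icc.mpr hab) (Set.right_mem_Icc.mpr hab)
  rw [Pi.add_apply, Pi.add_apply, intervalIntegral.integral_same, zero_add, ← hint,
    Real.norm_of_nonneg (sub_nonneg.mpr hab)] at h
  exact h

/-- With g(t) = S(τ, q(t)) - pb·q(t), the Lagrangian plus g' is the momentum defect times dq/dt
minus the Hamilton-Jacobi residual over tb - ta, both O(‖T‖^(m+1)). The value g(tb) is the boundary
term of the action, and g(ta) is S(1, qa) - pb·qa. -/
theorem IsBranch.exists_action_bound (hab : ta < tb) (qa pb : Fin N → ℝ) (r : ℝ) (m : ℕ) :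
    ∃ C, ∀ᶠ T in 𝓝 (0 : ι → ℝ), ∀ x, IsBranch H ta tb qa pb r T x →
      |actionF H ta tb (constConnection ta tb T) x - (-(∑ i, pb i * qa i) +
        ∑ n ∈ Finset.range (m + 1), (leadingAction ta tb H hH n : _ → ℝ) (T, (pb, qa)))| ≤
        C * ‖T‖ ^ (m + 1) := by
  have hpos : 0 < tb - ta := sub_pos.mpr hab
  obtain ⟨A, hA0, hA⟩ := exists_action_residual_bound H hH hab qa pb r m
  obtain ⟨B, hB0, hB⟩ := exists_hamField_bounds H hH hab (pb, qa) r
  obtain ⟨D, hD0, hD⟩ := IsBranch.exists_momentum_bound hH hab qa pb r m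
  have hsmall : ∀ᶠ T in 𝓝 (0 : ι → ℝ), ‖T‖ < 1 :=
    continuous_norm.continuousAt.eventually_lt continuousAt_const (by simp)
  refine ⟨(N * (D * B) + (tb - ta)⁻¹ * (A * D + A)) * (tb - ta), ?_⟩
  filter_upwards [hD, hsmall] with T hT hT1 x hx
  have hx' := (isBranch_iff H hH).mp hx
  have hxcont : ContinuousOn x (Set.Icc ta tb) := fun t ht => (hx'.1 t ht).continuousWithinAt
  set ζ : ℝ → (ι → ℝ) × ℝ × (Fin N → ℝ) := fun t => (T, (tb - t) / (tb - ta), (x t).2) with hζ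
  set f : ℝ → ℝ := fun t => (∑ i, (x t).1 i * (hamField ta tb H hH T (x t)).2 i) -
    (tb - ta)⁻¹ * (hamFn H hH : _ → ℝ) (T, x t) with hf
  set g : ℝ → ℝ := fun t => partialSum pb (leadingSeries ta tb H hH) (m + 1) (ζ t) -
    ∑ i, pb i * (x t).2 i with hg
  let g' : ℝ → ℝ := fun t =>
    (-(tb - ta)⁻¹ * partialSum pb (derivSeries (leadingSeries ta tb H hH)) m (ζ t) +
      ∑ k, (hamField ta tb H hH T (x t)).2 k * partialSum pb
        (mapDer ((phaseDer N ι).d (Sum.inr k)) (leadingSeries ta tb H hH)) (m + 1) (ζ t)) -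
    ∑ i, pb i * (hamField ta tb H hH T (x t)).2 i
  have hfcont : ContinuousOn f (Set.Icc ta tb) := by
    have h1 : Continuous fun y : Phase N => (∑ i, y.1 i * (hamField ta tb H hH T y).2 i) -
        (tb - ta)⁻¹ * (hamFn H hH : _ → ℝ) (T, y) := by
      have h2 := continuous_hamField (ta := ta) (tb := tb) H hH T
      have h3 : Continuous fun y : Phase N => (hamFn H hH : _ → ℝ) (T, y) :=
        (smoothFn.contDiff (hamFn H hH)).continuous.comp (Continuous.prodMk_right T)
      exact (continuous_finsetSum _ fun i _ => ((continuous_apply i).comp continuous_fst).mul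
        ((continuous_apply i).comp h2.snd)).sub (continuous_const.mul h3)
    exact h1.comp_continuousOn hxcont
  have hgderiv : ∀ t ∈ Set.Icc ta tb, HasDerivWithinAt g (g' t) (Set.Icc ta tb) t := by
    intro t ht
    refine (hasDerivWithinAt_partialSum pb (leadingSeries ta tb H hH) m T
      (hasDerivWithinAt_reversed_time (ta := ta) (tb := tb) (Set.Icc ta tb) t)
      (hx'.1 t ht).snd).sub ?_
    exact HasDerivWithinAt.fun_sum fun i _ =>
      (hasDerivWithinAt_pi.mp (hx'.1 t ht).snd i).const_mul (pb i)
  have hbound : ∀ t ∈ Set.Icc ta tb, |f t + g' t| ≤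
      (N * (D * B) + (tb - ta)⁻¹ * (A * D + A)) * ‖T‖ ^ (m + 1) := by
    intro t ht
    obtain ⟨h1, h2⟩ := hx.mem_expDomain hab hT1.le ht
    have h3 := hA (ζ t) h1 (x t).1 h2
    have h4 := hT x hx t ht
    have h5 : ‖hamField ta tb H hH T (x t)‖ ≤ B :=
      ((hB T (x t) (hx.2 t ht).le).1).trans (mul_le_of_le_one_right hB0 hT1.le)
    -- The q-derivatives of S are minus the momentum increments, so the factor of dq/dt is p - pb
    -- minus the increment.
    have h6 : f t + g' t = ∑ k, ((x t).1 - pb - momentumIncrement ta tb H hH pb m (ζ t)) k *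
        (hamField ta tb H hH T (x t)).2 k - (tb - ta)⁻¹ * ((hamFn H hH : _ → ℝ) (T, x t) +
          partialSum pb (derivSeries (leadingSeries ta tb H hH)) m (ζ t)) := by
      have h7 : ∀ k, momentumIncrement ta tb H hH pb m (ζ t) k = -partialSum pb
          (mapDer ((phaseDer N ι).d (Sum.inr k)) (leadingSeries ta tb H hH)) (m + 1) (ζ t) :=
        fun k => partialSum_neg _ _ _ _
      simp only [f, g', Pi.sub_apply, h7, sub_mul, Finset.sum_sub_distrib, neg_mul,
        Finset.sum_neg_distrib]
      simp only [mul_comm ((hamField ta tb H hH T (x t)).2 _)]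
      ring
    rw [h6]
    have h8 : |∑ k, ((x t).1 - pb - momentumIncrement ta tb H hH pb m (ζ t)) k *
        (hamField ta tb H hH T (x t)).2 k| ≤ N * (D * B) * ‖T‖ ^ (m + 1) := by
      refine (Finset.abs_sum_le_sum_abs _ _).trans ((Finset.sum_le_card_nsmul _ _
        (D * ‖T‖ ^ (m + 1) * B) fun k _ => ?_).trans (le_of_eq ?_))
      · rw [abs_mul]
        refine mul_le_mul ((norm_le_pi_norm _ k).trans h4) ?_ (abs_nonneg _) (by positivity)
        exact ((norm_le_pi_norm _ k).trans (norm_snd_le _)).trans h5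
      · rw [Finset.card_univ, Fintype.card_fin, nsmul_eq_mul]
        ring
    have h9 : |(hamFn H hH : _ → ℝ) (T, x t) +
        partialSum pb (derivSeries (leadingSeries ta tb H hH)) m (ζ t)| ≤
        (A * D + A) * ‖T‖ ^ (m + 1) := by
      refine h3.trans ?_
      rw [add_mul]
      refine add_le_add ?_ le_rfl
      calc A * ‖T‖ * _ ≤ A * 1 * (D * ‖T‖ ^ (m + 1)) := by
            gcongr
        _ = _ := by ring
    refine (abs_sub _ _).trans ?_
    rw [abs_mul, abs_of_nonneg (inv_nonneg.mpr hpos.le), add_mul, mul_assoc (tb - ta)⁻¹]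
    exact add_le_add h8 (mul_le_mul_of_nonneg_left h9 (inv_nonneg.mpr hpos.le))
  have h := integral_add_sub_le hab.le hfcont hgderiv hbound
  have hint : ∫ t in ta..tb, f t = ∫ t in ta..tb,
      ((∑ i, (x t).1 i * derivWithin (fun s => (x s).2 i) (Set.Icc ta tb) t)
        - ∑ α, constConnection ta tb T t α * H α (x t)) := by
    refine intervalIntegral.integral_congr fun t ht => ?_
    rw [Set.uIcc_of_le hab.le] at ht
    have h1 : ∀ i, derivWithin (fun s => (x s).2 i) (Set.Icc ta tb) t =
        (hamField ta tb H hH T (x t)).2 i := fun i =>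
      (hasDerivWithinAt_pi.mp (hx'.1 t ht).snd i).derivWithin (uniqueDiffOn_Icc hab t ht)
    simp only [h1, hf]
    congr 1
    change (tb - ta)⁻¹ * ∑ α, T α * H α (x t) = _
    rw [Finset.mul_sum]
    refine Finset.sum_congr rfl fun α _ => ?_
    rw [constConnection]
    ring
  have hgb : g tb = -∑ i, (x tb).1 i * (x tb).2 i := by
    have h0 : partialSum pb (leadingSeries ta tb H hH) (m + 1) (T, 0, (x tb).2) = 0 := by
      refine partialSum_zero_time pb ?_ _ _ _
      rw [leadingSeries, coeff_mk, leadingAction_zero]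
    simp only [hg, hζ, sub_self, zero_div, h0, zero_sub, hx'.2.2.1]
  have hga : g ta = ∑ n ∈ Finset.range (m + 1),
      (leadingAction ta tb H hH n : _ → ℝ) (T, (pb, qa)) - ∑ i, pb i * qa i := by
    simp only [hg, hζ, div_self hpos.ne', hx'.2.1, partialSum, one_pow, one_mul, leadingSeries,
      coeff_mk]
  rw [hgb, hga, hint] at h
  rw [actionF]
  refine le_trans (le_of_eq ?_) (h.trans (le_of_eq ?_))
  · congr 1
    ring
  · ring

theorem exists_unique_isBranch {H : ι → Phase N → ℝ} (hH : ∀ α, ContDiff ℝ ∞ (H α))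
    (hab : ta < tb) (qa pb : Fin N → ℝ) {r : ℝ} (hr : 0 < r) :
    ∀ᶠ T in 𝓝 (0 : ι → ℝ), ∃ x, IsBranch H ta tb qa pb r T x ∧
      ∀ y, IsBranch H ta tb qa pb r T y → Set.EqOn y x (Set.Icc ta tb) := by
  filter_upwards [exists_isBranch hH hab qa pb hr, IsBranch.unique hH hab qa pb r] with T h1 h2
  obtain ⟨x, hx⟩ := h1
  exact ⟨x, hx, fun y hy => h2 x y hx hy⟩

/-- The action estimate holds for every branch, hence for the one selected by choice in `hatSHJ`. -/
theorem hatSHJ_expansion (hab : ta < tb) (qa pb : Fin N → ℝ) {r : ℝ} (hr : 0 < r) (m : ℕ) :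
    (fun T : ι → ℝ => (hatSHJ H ta tb qa pb r T : ℂ) - (-((∑ i, pb i * qa i : ℝ) : ℂ) +
      ∑ n ∈ Finset.range (m + 1), ((leadingAction ta tb H hH n : _ → ℝ) (T, (pb, qa)) : ℂ)))
      =O[𝓝 0] fun T => ‖T‖ ^ (m + 1) := by
  obtain ⟨C, hC⟩ := IsBranch.exists_action_bound hH hab qa pb r m
  refine IsBigO.of_bound C ?_
  filter_upwards [hC, exists_isBranch hH hab qa pb hr] with T h1 h2
  have h3 := h1 _ h2.choose_spec
  rw [hatSHJ, dif_pos h2, norm_pow, norm_norm]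
  exact_mod_cast h3

end BranchAction

end BVBFV

end

open BVBFV in
theorem mainTheorem2 {N : ℕ} {ι : Type*} [Fintype ι] [DecidableEq ι]
    {𝔤 : Type*} [LieRing 𝔤] [LieAlgebra ℝ 𝔤] (b : Module.Basis ι ℝ 𝔤)
    (H : ι → Phase N → ℝ) (hH : ∀ α, ContDiff ℝ ∞ (H α))
    (ta tb : ℝ) (hab : ta < tb) (qa pb : Fin N → ℝ) :
    -- factorization into a physical and a ghost part
    (∀ T, ZI ta tb (structureConst b) H qa pb T = ZIphys ta tb (structureConst b) H qa pb T * ZIgh ta tb (structureConst b) T) ∧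
    -- star-exponential form of the physical part
    (∀ T, ZIphys ta tb (structureConst b) H qa pb T =
      AddMonoidAlgebra.single (-Complex.I * ((∑ i, pb i * qa i : ℝ) : ℂ))
        (scalarState (starExp (pairHT H T) (pb, qa)))) ∧
    -- semiclassical expansion
    ∃ 𝒮 : (ι → ℝ) → PowerSeries (PowerSeries ℂ),
      (∀ T, PowerSeries.constantCoeff (𝒮 T) = 0) ∧
      (∀ T, ZIphys ta tb (structureConst b) H qa pb T = expAction (-((∑ i, pb i * qa i : ℝ) : ℂ)) (𝒮 T)) ∧
      (∀ T n, PowerSeries.constantCoeff (PowerSeries.coeff n (𝒮 T)) =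
        treeAction H ta tb qa pb n T) ∧
      ∀ r > 0,
        (∀ᶠ T in 𝓝 (0 : ι → ℝ), ∃ x, IsBranch H ta tb qa pb r T x ∧
          ∀ y, IsBranch H ta tb qa pb r T y → Set.EqOn y x (Set.Icc ta tb)) ∧
        ∀ m : ℕ,
          (fun T : ι → ℝ => (hatSHJ H ta tb qa pb r T : ℂ) -
            (-((∑ i, pb i * qa i : ℝ) : ℂ) + ∑ n ∈ Finset.range (m + 1),
              PowerSeries.constantCoeff (PowerSeries.coeff n (𝒮 T))))
          =O[𝓝 0] fun T => ‖T‖ ^ (m + 1) := by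
  refine ⟨ZI_eq_mul hab _ H hH qa pb, ZIphys_eq_starExp hab _ H hH qa pb,
    formalAction ta tb H hH (pb, qa), constantCoeff_formalAction H hH (pb, qa),
    ZIphys_eq_expAction H hH hab _ qa pb, fun T n => ?_, fun r hr => ⟨?_, fun m => ?_⟩⟩
  · rw [leading_formalAction, leadingAction_eq_treeAction]
  · exact exists_unique_isBranch hH hab qa pb hr
  · simp only [leading_formalAction]
    exact hatSHJ_expansion hH hab qa pb hr m
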